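/- **Notation.** Let $A,B,C,D,E,F,G,H,J,K\ge 0$ be integers and let $(a)=(a_1,\dots,a_A)$, $(b)=(b_1,\dots,b_B)$, $(c),(d),(e),(f),(g),(h),(j),(k)$ be families of complex numbers of lengths $A,\dots,H,J,K$. A family in an argument of $\Gamma$ or of a Pochhammer symbol stands for the product over its members, $\Gamma\left[{u\atop v}\right]=\prod\Gamma(u)/\prod\Gamma(v)$ (with $1/\Gamma=0$ at the poles of $\Gamma$), and $(a)'_\mu$ is $(a)$ without $a_\mu$. For $n\ge0$, $(\alpha)_n=\alpha(\alpha+1)\cdots(\alpha+n-1)$ and $(\alpha)_{-n}=1/\big((\alpha-n)\cdots(\alpha-1)\big)$ (with $1/(\alpha)_{-n}=0$ where $(\alpha)_{-n}=\infty$), so $(\alpha)_n=\Gamma(\alpha+n)/\Gamma(\alpha)$ when $\alpha\notin\{0,-1,-2,\dots\}$. Powers $z^s$ and $\arg z$ are principal values. Assume no $f_i$ is in $\{0,-1,-2,\dots\}$. Let $\gamma$ be a $C^1$ curve from $-i\infty$ to $+i\infty$, equal to $\gamma(t)=\sigma+it$ ($\sigma\in\mathbb R$ fixed) for all large $|t|$,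 having all points $-a_i-n,\,-g_i-n$ ($n\ge 0$) on its left and all points $b_i+n,\,h_i+n$ ($n\ge0$) on its right (a point $P\notin\gamma$ is on the left, resp. right, if $\lim_{R\to\infty}\int_{-R}^{R}\frac{\gamma'(t)}{\gamma(t)-P}dt=i\pi$, resp. $-i\pi$). For $x\in\mathbb C$ and $z\in\mathbb C\setminus\{0\}$ put $$\mathcal I(z)=\frac1{2\pi i}\int_\gamma\Gamma\left[{(a)+s,(b)-s,(g)+s,(h)-s\atop (c)+s,(d)-s,(j)+s,(k)-s}\right]{}_{A+B+E}F_{C+D+F}\left[{(a)+s,(b)-s,(e);\atop (c)+s,(d)-s,(f);}\ x\right]z^s\,ds ,$$ $$\Sigma_A(z)=\sum_{\mu=1}^{A}\Gamma\left[{(a)'_\mu-a_\mu,(b)+a_\mu,(g)-a_\mu,(h)+a_\mu\atop (c)-a_\mu,(d)+a_\mu,(j)-a_\mu,(k)+a_\mu}\right]\sum_{m=0}^\infty\sum_{n=0}^\infty\frac{((b)+a_\mu)_{2m+n}((h)+a_\mu)_{m+n}((e))_m(1+a_\mu-(c))_n(1+a_\mu-(j))_{m+n}}{(1+a_\mu-(a)'_\mu)_n(1+a_\mu-(g))_{m+n}((f))_m((d)+a_\mu)_{2m+n}((k)+a_\mu)_{m+n}}\,\frac{x^mz^{-a_\mu-m-n}(-1)^{n(A+G-C-J)+m(G-J)}}{m!\,n!}$$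 $$+\sum_{\mu=1}^{G}\Gamma\left[{(a)-g_\mu,(b)+g_\mu,(g)'_\mu-g_\mu,(h)+g_\mu\atop (c)-g_\mu,(d)+g_\mu,(j)-g_\mu,(k)+g_\mu}\right]\sum_{m=0}^\infty\sum_{n=0}^\infty\frac{((a)-g_\mu)_{m-n}((b)+g_\mu)_{m+n}(1+g_\mu-(j))_n((h)+g_\mu)_n((e))_m}{((c)-g_\mu)_{m-n}((d)+g_\mu)_{m+n}(1+g_\mu-(g)'_\mu)_n((k)+g_\mu)_n((f))_m}\,\frac{x^mz^{-g_\mu-n}(-1)^{n(G-J)}}{m!\,n!},$$ $$\Sigma_B(z)=\sum_{\nu=1}^{B}\Gamma\left[{(a)+b_\nu,(b)'_\nu-b_\nu,(g)+b_\nu,(h)-b_\nu\atop (c)+b_\nu,(d)-b_\nu,(j)+b_\nu,(k)-b_\nu}\right]\sum_{m=0}^\infty\sum_{n=0}^\infty\frac{((a)+b_\nu)_{2m+n}((g)+b_\nu)_{m+n}((e))_m(1+b_\nu-(d))_n(1+b_\nu-(k))_{m+n}}{(1+b_\nu-(b)'_\nu)_n(1+b_\nu-(h))_{m+n}((f))_m((c)+b_\nu)_{2m+n}((j)+b_\nu)_{m+n}}\,\frac{x^mz^{b_\nu+m+n}(-1)^{n(B+H-K-D)+m(H-K)}}{m!\,n!}$$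 $$+\sum_{\nu=1}^{H}\Gamma\left[{(a)+h_\nu,(b)-h_\nu,(g)+h_\nu,(h)'_\nu-h_\nu\atop (c)+h_\nu,(d)-h_\nu,(j)+h_\nu,(k)-h_\nu}\right]\sum_{m=0}^\infty\sum_{n=0}^\infty\frac{((a)+h_\nu)_{m+n}((b)-h_\nu)_{m-n}(1+h_\nu-(k))_n((g)+h_\nu)_n((e))_m}{((d)-h_\nu)_{m-n}((c)+h_\nu)_{m+n}(1+h_\nu-(h)'_\nu)_n((j)+h_\nu)_n((f))_m}\,\frac{x^mz^{h_\nu+n}(-1)^{n(H-K)}}{m!\,n!}.$$ *Meaning of $\mathcal I(z)=\Sigma_A(z)$:* every series over $n$ converges absolutely; after collecting, for each $m$, the $A+G$ summands of $\Sigma_A(z)$ (prefactor times series over $n$), the series over $m$ of these finite sums converges absolutely to $\mathcal I(z)$; and if each of the $A+G$ series over $m$ converges absolutely by itself, then $\mathcal I(z)$ equals $\Sigma_A(z)$ summed in the displayed order. Likewise for $\Sigma_B$. *Absolute convergence* at $(x,z)$ means $\int_\gamma\sum_{m\ge0}\left|\Gamma[\cdots]\,t_m(s)\,z^s\right||ds|<\infty$,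 where $t_m(s)$ is the $m$-th term of the hypergeometric series. *Generic for $\Sigma_A$:* $a_i-a_{i'}$, $g_i-g_{i'}$ ($i\ne i'$) and $a_i-g_{i'}$ are never integers, and none of $d_i+a_{i'}$, $k_i+a_{i'}$, $d_i+g_{i'}$, $k_i+g_{i'}$, $c_i-g_{i'}$ lies in $\{0,-1,-2,\dots\}$. *Generic for $\Sigma_B$:* $b_i-b_{i'}$, $h_i-h_{i'}$ ($i\neq i'$) and $b_i-h_{i'}$ are never integers, and none of $c_i+b_{i'}$, $j_i+b_{i'}$, $c_i+h_{i'}$, $j_i+h_{i'}$, $d_i-h_{i'}$ lies in $\{0,-1,-2,\dots\}$. *Convergence region:* $x=0$; or some $e_i\in\{0,-1,-2,\dots\}$; or $A+B+E\le C+D+F$; or $A+B+E=C+D+F+1$ and $|x|<1$ and, if $q=A+B-C-D\geq 1$, also $q\arcsin(|x|^{1/q})+|\arg z|<\frac\pi2(A+G+B+H-C-D-J-K)$. *Unit condition:* $\delta:=A+G-C-J=B+H-D-K\ge 0$, and for each $m\ge0$ with $x^m\prod_i(e_i)_m\neq0$, $$\operatorname{Re}\Big(\sum (c_i+m)+\sum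 (d_i+m)+\sum j_i+\sum k_i-\sum (a_i+m)-\sum (b_i+m)-\sum g_i-\sum h_i\Big)>1-\delta .$$ **Statement.** 1. Absolute convergence holds at $(x,z)$ whenever $|\arg z|<\frac\pi2(A+G+B+H-C-D-J-K)$ and $(x,z)$ is in the convergence region. It also holds at $(x,1)$ whenever the unit condition holds and $(x,1)$ is in the convergence region. 2. Suppose $|\arg z|<\frac\pi2(A+G+B+H-C-D-J-K)$ and absolute convergence holds at $(x,z)$. Then (i) $\mathcal I(z)=\Sigma_A(z)$ if the parameters are generic for $\Sigma_A$ and either $A+G+D+K>B+H+C+J$, or $A+G+D+K=B+H+C+J$ and $|z|>1$; (ii) $\mathcal I(z)=\Sigma_B(z)$ if the parameters are generic for $\Sigma_B$ and either $A+G+D+K<B+H+C+J$, or $A+G+D+K=B+H+C+J$ and $|z|<1$. 3. (iii) $\mathcal I(1)=\Sigma_A(1)=\Sigma_B(1)$ if the unit condition holds, absolute convergence holds at $(x,1)$, and the parameters are generic for $\Sigma_A$ and for $\Sigma_B$. -/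

import Mathlib

open scoped BigOperators

/-- Pochhammer symbol with integer index: `(α)_n = α (α + 1) ⋯ (α + n - 1)` for `n ≥ 0` and
`(α)_{-n} = 1 / ((α - n) ⋯ (α - 1))`. This is `Γ(α + n) / Γ(α)` as soon as `α` is not a pole of
`Γ`, see `poch_eq_Gamma_div`; for `n ≥ 0` it keeps its usual (limit) value at the poles too. -/
noncomputable def poch (α : ℂ) : ℤ → ℂ
  | Int.ofNat n => ∏ i ∈ Finset.range n, (α + i)
  | Int.negSucc n => (∏ i ∈ Finset.range (n + 1), (α - ((n : ℂ) + 1) + i))⁻¹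

/-- `w` is one of `0, -1, -2, …`, i.e. a pole of `Γ`. -/
def IsNonposInt (w : ℂ) : Prop := ∃ n : ℕ, w = -(n : ℂ)

/-- `w` is a (rational) integer. -/
def IsInt (w : ℂ) : Prop := ∃ n : ℤ, w = (n : ℂ)

theorem Gamma_add_nat_eq (α : ℂ) (n : ℕ) (h : ∀ i < n, α + i ≠ 0) :
    Complex.Gamma (α + n) = (∏ i ∈ Finset.range n, (α + i)) * Complex.Gamma α := by
  induction n with
  | zero => simp
  | succ n ih =>
    rw [Finset.prod_range_succ, Nat.cast_succ, ← add_assoc,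
      Complex.Gamma_add_one _ (h n (Nat.lt_succ_self n)),
      ih (fun i hi => h i (Nat.lt_succ_of_lt hi))]
    ring

/-- The Pochhammer symbol is the quotient of Gamma values. -/
theorem poch_eq_Gamma_div (α : ℂ) (hα : ¬ IsNonposInt α) (k : ℤ) :
    poch α k = Complex.Gamma (α + k) / Complex.Gamma α := by
  have hα' : ∀ m : ℕ, α ≠ -(m : ℂ) := fun m hm => hα ⟨m, hm⟩
  have hΓ : Complex.Gamma α ≠ 0 := Complex.Gamma_ne_zero hα'
  cases k with
  | ofNat n =>
    have h := Gamma_add_nat_eq α n (fun i _ hi => hα' i (eq_neg_of_add_eq_zero_left hi))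
    simp only [poch, Int.ofNat_eq_natCast, Int.cast_natCast]
    rw [h, mul_div_cancel_right₀ _ hΓ]
  | negSucc n =>
    have e : α + ((Int.negSucc n : ℤ) : ℂ) = α - ((n : ℂ) + 1) := by
      rw [Int.cast_negSucc]; push_cast; ring
    simp only [poch]
    rw [e]
    by_cases h : ∀ i < n + 1, α - ((n : ℂ) + 1) + i ≠ 0
    · have h1 := Gamma_add_nat_eq (α - ((n : ℂ) + 1)) (n + 1) h
      have h2 : α - ((n : ℂ) + 1) + ((n + 1 : ℕ) : ℂ) = α := by push_cast; ring
      rw [h2] at h1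
      have h3 : Complex.Gamma (α - ((n : ℂ) + 1)) ≠ 0 := by
        intro h0; rw [h0, mul_zero] at h1; exact hΓ h1
      rw [h1, div_mul_cancel_right₀ h3]
    · push Not at h
      obtain ⟨i, hi, h0⟩ := h
      have h1 : Complex.Gamma (α - ((n : ℂ) + 1)) = 0 := by
        rw [eq_neg_of_add_eq_zero_left h0]; exact Complex.Gamma_neg_nat_eq_zero i
      rw [h1, zero_div, inv_eq_zero]
      exact Finset.prod_eq_zero (Finset.mem_range.mpr hi) h0

/-- The `m`-th term of the generalized hypergeometric series with upper parameters `u`, lower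
parameters `v` and argument `x`. -/
noncomputable def hypTerm {ι κ : Type} [Fintype ι] [Fintype κ] (u : ι → ℂ) (v : κ → ℂ) (x : ℂ)
    (m : ℕ) : ℂ :=
  (∏ i, poch (u i) m) / (∏ i, poch (v i) m) * x ^ m / (m.factorial : ℂ)

/-- The generalized hypergeometric function. -/
noncomputable def hypF {ι κ : Type} [Fintype ι] [Fintype κ] (u : ι → ℂ) (v : κ → ℂ) (x : ℂ) : ℂ :=
  ∑' m : ℕ, hypTerm u v x m

/-- `P` lies to the left of the curve `γ`, which runs from `-i∞` to `+i∞`: `P` is not on `γ` and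
the argument of `γ t - P` increases by `π` in total. -/
def IsLeftOf (γ : ℝ → ℂ) (P : ℂ) : Prop :=
  (∀ t, γ t ≠ P) ∧
    Filter.Tendsto (fun R : ℝ => ∫ t in (-R)..R, deriv γ t / (γ t - P)) Filter.atTop
      (nhds ((Real.pi : ℂ) * Complex.I))

/-- `P` lies to the right of the curve `γ`: the argument of `γ t - P` decreases by `π`. -/
def IsRightOf (γ : ℝ → ℂ) (P : ℂ) : Prop :=
  (∀ t, γ t ≠ P) ∧
    Filter.Tendsto (fun R : ℝ => ∫ t in (-R)..R, deriv γ t / (γ t - P)) Filter.atTop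
      (nhds (-((Real.pi : ℂ) * Complex.I)))

/-- The ten finite families of complex parameters. -/
structure MBParams (A B C D E F G H J K : ℕ) where
  a : Fin A → ℂ
  b : Fin B → ℂ
  c : Fin C → ℂ
  d : Fin D → ℂ
  e : Fin E → ℂ
  f : Fin F → ℂ
  g : Fin G → ℂ
  h : Fin H → ℂ
  j : Fin J → ℂ
  k : Fin K → ℂ

namespace MBParams

/-- A Mellin–Barnes contour: a `C¹` curve from `-i∞` to `+i∞`, vertical near both ends, that has
the poles of every `Γ(a + s)`, `Γ(g + s)` on its left and those of every `Γ(b - s)`, `Γ(h - s)` on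
its right. -/
structure IsContour {A B C D E F G H J K : ℕ} (p : MBParams A B C D E F G H J K)
    (γ : ℝ → ℂ) : Prop where
  contDiff : ContDiff ℝ 1 γ
  vertical : ∃ σ T : ℝ, ∀ t : ℝ, T ≤ |t| → γ t = (σ : ℂ) + (t : ℂ) * Complex.I
  left_a : ∀ (i : Fin A) (n : ℕ), IsLeftOf γ (-p.a i - n)
  left_g : ∀ (i : Fin G) (n : ℕ), IsLeftOf γ (-p.g i - n)
  right_b : ∀ (i : Fin B) (n : ℕ), IsRightOf γ (p.b i + n)
  right_h : ∀ (i : Fin H) (n : ℕ), IsRightOf γ (p.h i + n)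

/-- `Γ[(a)+s, (b)-s, (g)+s, (h)-s; (c)+s, (d)-s, (j)+s, (k)-s]`. -/
noncomputable def gammaRatio {A B C D E F G H J K : ℕ} (p : MBParams A B C D E F G H J K)
    (s : ℂ) : ℂ :=
  ((∏ i, Complex.Gamma (p.a i + s)) * (∏ i, Complex.Gamma (p.b i - s)) *
    (∏ i, Complex.Gamma (p.g i + s)) * (∏ i, Complex.Gamma (p.h i - s))) /
  ((∏ i, Complex.Gamma (p.c i + s)) * (∏ i, Complex.Gamma (p.d i - s)) *
    (∏ i, Complex.Gamma (p.j i + s)) * (∏ i, Complex.Gamma (p.k i - s)))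

/-- The upper parameters `(a)+s, (b)-s, (e)`. -/
def upper {A B C D E F G H J K : ℕ} (p : MBParams A B C D E F G H J K) (s : ℂ) :
    Fin A ⊕ Fin B ⊕ Fin E → ℂ :=
  Sum.elim (fun i => p.a i + s) (Sum.elim (fun i => p.b i - s) p.e)

/-- The lower parameters `(c)+s, (d)-s, (f)`. -/
def lower {A B C D E F G H J K : ℕ} (p : MBParams A B C D E F G H J K) (s : ℂ) :
    Fin C ⊕ Fin D ⊕ Fin F → ℂ :=
  Sum.elim (fun i => p.c i + s) (Sum.elim (fun i => p.d i - s) p.f)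

/-- The integral `𝓘(z)` along the contour `γ`. -/
noncomputable def integral {A B C D E F G H J K : ℕ} (p : MBParams A B C D E F G H J K)
    (γ : ℝ → ℂ) (x z : ℂ) : ℂ :=
  1 / (2 * (Real.pi : ℂ) * Complex.I) *
    ∫ t : ℝ, p.gammaRatio (γ t) * hypF (p.upper (γ t)) (p.lower (γ t)) x * z ^ (γ t) * deriv γ t

/-- Absolute convergence of the integral together with the hypergeometric series in it:
`∫ ∑ₘ |Γ[…] · (m-th term) · z^s| |ds| < ∞`. -/
def AbsConv {A B C D E F G H J K : ℕ} (p : MBParams A B C D E F G H J K)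
    (γ : ℝ → ℂ) (x z : ℂ) : Prop :=
  ∫⁻ t : ℝ, ∑' m : ℕ, ‖p.gammaRatio (γ t) * hypTerm (p.upper (γ t)) (p.lower (γ t)) x m *
    z ^ (γ t) * deriv γ t‖ₑ < ⊤

/-- The explicit convergence condition on `x`: `x = 0`, or the hypergeometric series terminates,
or it has infinite radius of convergence, or it has radius of convergence `1`, `|x| < 1` and, in
case `q = A + B - C - D` is positive,
`q arcsin(|x|^(1/q)) + |arg z| < (π/2) (A + B + G + H - C - D - J - K)`. -/
def ConvRegion {A B C D E F G H J K : ℕ} (p : MBParams A B C D E F G H J K) (x z : ℂ) : Prop :=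
  x = 0 ∨ (∃ i, IsNonposInt (p.e i)) ∨ A + B + E ≤ C + D + F ∨
    (A + B + E = C + D + F + 1 ∧ ‖x‖ < 1 ∧
      ∀ q : ℕ, 0 < q → A + B = C + D + q →
        (q : ℝ) * Real.arcsin (‖x‖ ^ (1 / (q : ℝ))) + |z.arg| <
          Real.pi / 2 * ((A : ℝ) + G + B + H - C - D - J - K))

/-- Genericity for the series `Σ_A`: the poles to the left of the contour are simple, and the
Pochhammer symbols in the denominators of `Σ_A` are defined and nonzero. -/
structure GenericA {A B C D E F G H J K : ℕ} (p : MBParams A B C D E F G H J K) : Prop where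
  aa : ∀ i i', i ≠ i' → ¬ IsInt (p.a i - p.a i')
  gg : ∀ i i', i ≠ i' → ¬ IsInt (p.g i - p.g i')
  ag : ∀ i i', ¬ IsInt (p.a i - p.g i')
  da : ∀ i i', ¬ IsNonposInt (p.d i + p.a i')
  ka : ∀ i i', ¬ IsNonposInt (p.k i + p.a i')
  dg : ∀ i i', ¬ IsNonposInt (p.d i + p.g i')
  kg : ∀ i i', ¬ IsNonposInt (p.k i + p.g i')
  cg : ∀ i i', ¬ IsNonposInt (p.c i - p.g i')

/-- Genericity for the series `Σ_B`. -/
structure GenericB {A B C D E F G H J K : ℕ} (p : MBParams A B C D E F G H J K) : Prop where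
  bb : ∀ i i', i ≠ i' → ¬ IsInt (p.b i - p.b i')
  hh : ∀ i i', i ≠ i' → ¬ IsInt (p.h i - p.h i')
  bh : ∀ i i', ¬ IsInt (p.b i - p.h i')
  cb : ∀ i i', ¬ IsNonposInt (p.c i + p.b i')
  jb : ∀ i i', ¬ IsNonposInt (p.j i + p.b i')
  ch : ∀ i i', ¬ IsNonposInt (p.c i + p.h i')
  jh : ∀ i i', ¬ IsNonposInt (p.j i + p.h i')
  dh : ∀ i i', ¬ IsNonposInt (p.d i - p.h i')

/-- Gamma prefactor of the `μ`-th summand of the first sum in `Σ_A`. -/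
noncomputable def prefA {A B C D E F G H J K : ℕ} (p : MBParams A B C D E F G H J K)
    (μ : Fin A) : ℂ :=
  ((∏ i ∈ Finset.univ.erase μ, Complex.Gamma (p.a i - p.a μ)) *
    (∏ i, Complex.Gamma (p.b i + p.a μ)) * (∏ i, Complex.Gamma (p.g i - p.a μ)) *
    (∏ i, Complex.Gamma (p.h i + p.a μ))) /
  ((∏ i, Complex.Gamma (p.c i - p.a μ)) * (∏ i, Complex.Gamma (p.d i + p.a μ)) *
    (∏ i, Complex.Gamma (p.j i - p.a μ)) * (∏ i, Complex.Gamma (p.k i + p.a μ)))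

/-- `(m, n)`-term of the double series of the `μ`-th summand of the first sum in `Σ_A`. -/
noncomputable def termA {A B C D E F G H J K : ℕ} (p : MBParams A B C D E F G H J K)
    (x z : ℂ) (μ : Fin A) (m n : ℕ) : ℂ :=
  ((∏ i, poch (p.b i + p.a μ) (2 * m + n)) * (∏ i, poch (p.h i + p.a μ) (m + n)) *
    (∏ i, poch (p.e i) m) * (∏ i, poch (1 + p.a μ - p.c i) n) *
    (∏ i, poch (1 + p.a μ - p.j i) (m + n))) /
  ((∏ i ∈ Finset.univ.erase μ, poch (1 + p.a μ - p.a i) n) *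
    (∏ i, poch (1 + p.a μ - p.g i) (m + n)) * (∏ i, poch (p.f i) m) *
    (∏ i, poch (p.d i + p.a μ) (2 * m + n)) * (∏ i, poch (p.k i + p.a μ) (m + n))) *
  (x ^ m * z ^ (-p.a μ - m - n) *
    (-1 : ℂ) ^ ((n : ℤ) * ((A : ℤ) + G - C - J) + (m : ℤ) * ((G : ℤ) - J))) /
  ((m.factorial : ℂ) * (n.factorial : ℂ))

/-- Gamma prefactor of the `μ`-th summand of the second sum in `Σ_A`. -/
noncomputable def prefG {A B C D E F G H J K : ℕ} (p : MBParams A B C D E F G H J K)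
    (μ : Fin G) : ℂ :=
  ((∏ i, Complex.Gamma (p.a i - p.g μ)) * (∏ i, Complex.Gamma (p.b i + p.g μ)) *
    (∏ i ∈ Finset.univ.erase μ, Complex.Gamma (p.g i - p.g μ)) *
    (∏ i, Complex.Gamma (p.h i + p.g μ))) /
  ((∏ i, Complex.Gamma (p.c i - p.g μ)) * (∏ i, Complex.Gamma (p.d i + p.g μ)) *
    (∏ i, Complex.Gamma (p.j i - p.g μ)) * (∏ i, Complex.Gamma (p.k i + p.g μ)))

/-- `(m, n)`-term of the double series of the `μ`-th summand of the second sum in `Σ_A`. -/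
noncomputable def termG {A B C D E F G H J K : ℕ} (p : MBParams A B C D E F G H J K)
    (x z : ℂ) (μ : Fin G) (m n : ℕ) : ℂ :=
  ((∏ i, poch (p.a i - p.g μ) ((m : ℤ) - n)) * (∏ i, poch (p.b i + p.g μ) (m + n)) *
    (∏ i, poch (1 + p.g μ - p.j i) n) * (∏ i, poch (p.h i + p.g μ) n) *
    (∏ i, poch (p.e i) m)) /
  ((∏ i, poch (p.c i - p.g μ) ((m : ℤ) - n)) * (∏ i, poch (p.d i + p.g μ) (m + n)) *
    (∏ i ∈ Finset.univ.erase μ, poch (1 + p.g μ - p.g i) n) *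
    (∏ i, poch (p.k i + p.g μ) n) * (∏ i, poch (p.f i) m)) *
  (x ^ m * z ^ (-p.g μ - n) * (-1 : ℂ) ^ ((n : ℤ) * ((G : ℤ) - J))) /
  ((m.factorial : ℂ) * (n.factorial : ℂ))

/-- Gamma prefactor of the `ν`-th summand of the first sum in `Σ_B`. -/
noncomputable def prefB {A B C D E F G H J K : ℕ} (p : MBParams A B C D E F G H J K)
    (ν : Fin B) : ℂ :=
  ((∏ i, Complex.Gamma (p.a i + p.b ν)) *
    (∏ i ∈ Finset.univ.erase ν, Complex.Gamma (p.b i - p.b ν)) *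
    (∏ i, Complex.Gamma (p.g i + p.b ν)) * (∏ i, Complex.Gamma (p.h i - p.b ν))) /
  ((∏ i, Complex.Gamma (p.c i + p.b ν)) * (∏ i, Complex.Gamma (p.d i - p.b ν)) *
    (∏ i, Complex.Gamma (p.j i + p.b ν)) * (∏ i, Complex.Gamma (p.k i - p.b ν)))

/-- `(m, n)`-term of the double series of the `ν`-th summand of the first sum in `Σ_B`. -/
noncomputable def termB {A B C D E F G H J K : ℕ} (p : MBParams A B C D E F G H J K)
    (x z : ℂ) (ν : Fin B) (m n : ℕ) : ℂ :=
  ((∏ i, poch (p.a i + p.b ν) (2 * m + n)) * (∏ i, poch (p.g i + p.b ν) (m + n)) *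
    (∏ i, poch (p.e i) m) * (∏ i, poch (1 + p.b ν - p.d i) n) *
    (∏ i, poch (1 + p.b ν - p.k i) (m + n))) /
  ((∏ i ∈ Finset.univ.erase ν, poch (1 + p.b ν - p.b i) n) *
    (∏ i, poch (1 + p.b ν - p.h i) (m + n)) * (∏ i, poch (p.f i) m) *
    (∏ i, poch (p.c i + p.b ν) (2 * m + n)) * (∏ i, poch (p.j i + p.b ν) (m + n))) *
  (x ^ m * z ^ (p.b ν + m + n) *
    (-1 : ℂ) ^ ((n : ℤ) * ((B : ℤ) + H - K - D) + (m : ℤ) * ((H : ℤ) - K))) /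
  ((m.factorial : ℂ) * (n.factorial : ℂ))

/-- Gamma prefactor of the `ν`-th summand of the second sum in `Σ_B`. -/
noncomputable def prefH {A B C D E F G H J K : ℕ} (p : MBParams A B C D E F G H J K)
    (ν : Fin H) : ℂ :=
  ((∏ i, Complex.Gamma (p.a i + p.h ν)) * (∏ i, Complex.Gamma (p.b i - p.h ν)) *
    (∏ i, Complex.Gamma (p.g i + p.h ν)) *
    (∏ i ∈ Finset.univ.erase ν, Complex.Gamma (p.h i - p.h ν))) /
  ((∏ i, Complex.Gamma (p.c i + p.h ν)) * (∏ i, Complex.Gamma (p.d i - p.h ν)) *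
    (∏ i, Complex.Gamma (p.j i + p.h ν)) * (∏ i, Complex.Gamma (p.k i - p.h ν)))

/-- `(m, n)`-term of the double series of the `ν`-th summand of the second sum in `Σ_B`. -/
noncomputable def termH {A B C D E F G H J K : ℕ} (p : MBParams A B C D E F G H J K)
    (x z : ℂ) (ν : Fin H) (m n : ℕ) : ℂ :=
  ((∏ i, poch (p.a i + p.h ν) (m + n)) * (∏ i, poch (p.b i - p.h ν) ((m : ℤ) - n)) *
    (∏ i, poch (1 + p.h ν - p.k i) n) * (∏ i, poch (p.g i + p.h ν) n) *
    (∏ i, poch (p.e i) m)) /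
  ((∏ i, poch (p.d i - p.h ν) ((m : ℤ) - n)) * (∏ i, poch (p.c i + p.h ν) (m + n)) *
    (∏ i ∈ Finset.univ.erase ν, poch (1 + p.h ν - p.h i) n) *
    (∏ i, poch (p.j i + p.h ν) n) * (∏ i, poch (p.f i) m)) *
  (x ^ m * z ^ (p.h ν + n) * (-1 : ℂ) ^ ((n : ℤ) * ((H : ℤ) - K))) /
  ((m.factorial : ℂ) * (n.factorial : ℂ))

/-- The double series `Σ_A(z)`. -/
noncomputable def sigmaA {A B C D E F G H J K : ℕ} (p : MBParams A B C D E F G H J K)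
    (x z : ℂ) : ℂ :=
  (∑ μ, p.prefA μ * ∑' m : ℕ, ∑' n : ℕ, p.termA x z μ m n) +
    ∑ μ, p.prefG μ * ∑' m : ℕ, ∑' n : ℕ, p.termG x z μ m n

/-- The double series `Σ_B(z)`. -/
noncomputable def sigmaB {A B C D E F G H J K : ℕ} (p : MBParams A B C D E F G H J K)
    (x z : ℂ) : ℂ :=
  (∑ ν, p.prefB ν * ∑' m : ℕ, ∑' n : ℕ, p.termB x z ν m n) +
    ∑ ν, p.prefH ν * ∑' m : ℕ, ∑' n : ℕ, p.termH x z ν m n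

/-- `w = Σ_A(z)` with convergence: every series over `n` converges absolutely; collecting, for
each `m`, the finitely many summands of `Σ_A`, the resulting series over `m` converges absolutely
to `w`; and if each of the `A + G` series over `m` converges by itself, then `w` is `Σ_A(z)` with
the sums in the displayed order. -/
def IsSigmaA {A B C D E F G H J K : ℕ} (p : MBParams A B C D E F G H J K)
    (x z w : ℂ) : Prop :=
  (∀ μ m, Summable (fun n : ℕ => p.termA x z μ m n)) ∧
  (∀ μ m, Summable (fun n : ℕ => p.termG x z μ m n)) ∧
  HasSum (fun m : ℕ => (∑ μ, p.prefA μ * ∑' n : ℕ, p.termA x z μ m n) +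
    ∑ μ, p.prefG μ * ∑' n : ℕ, p.termG x z μ m n) w ∧
  ((∀ μ, Summable (fun m : ℕ => ∑' n : ℕ, p.termA x z μ m n)) →
    (∀ μ, Summable (fun m : ℕ => ∑' n : ℕ, p.termG x z μ m n)) → w = p.sigmaA x z)

/-- `w = Σ_B(z)` with convergence, in the same sense. -/
def IsSigmaB {A B C D E F G H J K : ℕ} (p : MBParams A B C D E F G H J K)
    (x z w : ℂ) : Prop :=
  (∀ ν m, Summable (fun n : ℕ => p.termB x z ν m n)) ∧
  (∀ ν m, Summable (fun n : ℕ => p.termH x z ν m n)) ∧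
  HasSum (fun m : ℕ => (∑ ν, p.prefB ν * ∑' n : ℕ, p.termB x z ν m n) +
    ∑ ν, p.prefH ν * ∑' n : ℕ, p.termH x z ν m n) w ∧
  ((∀ ν, Summable (fun m : ℕ => ∑' n : ℕ, p.termB x z ν m n)) →
    (∀ ν, Summable (fun m : ℕ => ∑' n : ℕ, p.termH x z ν m n)) → w = p.sigmaB x z)

/-- The balance and real-part condition at `z = 1`: with `δ = A + G - C - J`,
`δ = B + H - D - K ≥ 0`, and, for each `m` for which the `m`-th term of the hypergeometric series
does not vanish identically, the real-part condition
`Re(Σ(c+m) + Σ(d+m) + Σj + Σk - Σ(a+m) - Σ(b+m) - Σg - Σh) > 1 - δ`. -/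
def UnitCondition {A B C D E F G H J K : ℕ} (p : MBParams A B C D E F G H J K)
    (x : ℂ) : Prop :=
  (A : ℤ) + G - C - J = (B : ℤ) + H - D - K ∧ 0 ≤ (A : ℤ) + G - C - J ∧
  ∀ m : ℕ, (∏ i, poch (p.e i) m) * x ^ m ≠ 0 →
    1 - ((A : ℝ) + G - C - J) <
      ((∑ i, (p.c i + m)) + (∑ i, (p.d i + m)) + (∑ i, p.j i) + (∑ i, p.k i)
        - (∑ i, (p.a i + m)) - (∑ i, (p.b i + m)) - (∑ i, p.g i) - (∑ i, p.h i)).re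

end MBParams

/-! Since Γ(α+s)(α+s)_m = Γ(α+m+s), the m-th hypergeometric term times the Gamma quotient is a
constant times a Mellin–Barnes kernel with no hypergeometric factor, in which (a), (b), (c), (d) are
raised by m (`gammaRatio_mul_hypTerm`). Raising (a) and (b) only removes poles, so one contour
serves every m. Absolute convergence allows termwise integration, and Slater's theorem
(`slater_left`) evaluates each integral as the sum of its residues on the left; these are the series
over n in Σ_A. The statement for Σ_B follows by the reflection s ↦ -s (`swap`).

Slater's theorem moves the contour to Re s = -(L+k) and lets k → ∞. The shift (`contour_shift`) uses
no homotopy: once the terms c/(s-P) are subtracted, the integrand has a primitive off its poles, and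
the two integrals then differ only through the winding integrals that define left and right. The
integrand at s-k is, up to sign, the integrand at s times a quotient of rising factorials and
exp(-ℓk). The same factor relates successive residues, so the single condition `RatioCond` yields
both the convergence of the residue series and the vanishing of the shifted integrals. The decay
along vertical lines comes from the exact modulus of Γ on Re s = 1, carried elsewhere by |Γ(w+β)| ≍
|w|^(Re β) |Γ(w)|.

For absolute convergence, all rising factorials on the vertical ends are compared with (1+it)_m, up
to powers of m+1 that do not depend on t. The m-th term then behaves like |(1+it)_m|^(A+B-C-D). If
this exponent is not positive, |(1+it)_m| ≥ m! suffices. If it is q > 0, Cauchy's estimate for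
(1-z)^(-1-it) on |z| = sin θ costs a factor exp(qθ|t|), which the decay of the kernel must absorb;
this is the arcsine condition. At z = 1 the unit condition itself forces A+B ≤ C+D, unless x = 0 or
the series terminates. -/

/-! ### Comparison and growth of rising factorials and of the Gamma function -/

open Finset Filter Topology in
-- The terms β/v of first order cancel, and what is left is quadratic in 1/v, hence summable along v
-- = w + i. The threshold 2X + 2 places 1/v and β/v in the disc of radius 1/2.
theorem norm_log_ratio_le {X : ℝ} (hX : 0 ≤ X) {β v : ℂ} (hβ : ‖β‖ ≤ X) (hv : 2 * X + 2 ≤ ‖v‖) :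
    ‖β * Complex.log (1 + 1 / v) - Complex.log (1 + β / v)‖ ≤ (X + X ^ 2) / ‖v‖ ^ 2 := by
  have hv0 : 0 < ‖v‖ := by linarith
  have key : ∀ z : ℂ, ‖z‖ ≤ 1 / 2 → ‖Complex.log (1 + z) - z‖ ≤ ‖z‖ ^ 2 := by
    intro z hz
    refine (Complex.norm_log_one_add_sub_self_le (by linarith)).trans ?_
    have : (1 - ‖z‖)⁻¹ ≤ 2 := by
      rw [inv_le_comm₀ (by linarith) (by norm_num)]; linarith
    nlinarith [sq_nonneg ‖z‖]
  have h1 := key (1 / v) (by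
    rw [norm_div, norm_one, div_le_div_iff₀ hv0 (by norm_num)]; linarith)
  have h2 := key (β / v) (by
    rw [norm_div, div_le_div_iff₀ hv0 (by norm_num)]; linarith)
  have e : β * Complex.log (1 + 1 / v) - Complex.log (1 + β / v) =
      β * (Complex.log (1 + 1 / v) - 1 / v) - (Complex.log (1 + β / v) - β / v) := by ring
  rw [e]
  refine (norm_sub_le _ _).trans ?_
  rw [norm_mul, add_div]
  rw [norm_div] at h1 h2
  rw [norm_one] at h1
  refine add_le_add ?_ ?_
  · calc ‖β‖ * _ ≤ X * (1 / ‖v‖) ^ 2 := by gcongr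
      _ = X / ‖v‖ ^ 2 := by ring
  · refine h2.trans ?_
    rw [div_pow]; gcongr

/-- The rising factorial `α (α + 1) ⋯ (α + n - 1)`. -/
noncomputable def rise (α : ℂ) (n : ℕ) : ℂ := ∏ i ∈ Finset.range n, (α + i)

theorem poch_natCast (α : ℂ) (n : ℕ) : poch α (n : ℤ) = rise α n := rfl

theorem rise_zero (α : ℂ) : rise α 0 = 1 := by simp [rise]

theorem rise_succ (α : ℂ) (n : ℕ) : rise α (n + 1) = rise α n * (α + n) := by
  simp [rise, Finset.prod_range_succ]

theorem rise_add (α : ℂ) (m n : ℕ) : rise α (m + n) = rise α m * rise (α + m) n := by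
  simp only [rise, Finset.prod_range_add]
  push_cast; simp only [add_assoc]

theorem norm_add_natCast_ge {w : ℂ} (hw : 0 ≤ w.re) (i : ℕ) : ‖w‖ ≤ ‖w + i‖ := by
  rw [← sq_le_sq₀ (norm_nonneg _) (norm_nonneg _), ← Complex.normSq_eq_norm_sq,
    ← Complex.normSq_eq_norm_sq, Complex.normSq_apply, Complex.normSq_apply]
  simp
  have : (0 : ℝ) ≤ i := Nat.cast_nonneg i
  nlinarith

theorem natCast_le_norm_add {w : ℂ} (hw : 1 ≤ w.re) (i : ℕ) : (i : ℝ) + 1 ≤ ‖w + i‖ := by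
  have := Complex.re_le_norm (w + i)
  simp at this; linarith

/-- Telescoping is legitimate for principal logarithms because w + n and 1 + 1/(w+n) both lie in the
right half-plane, so their arguments add without crossing the cut. -/
theorem sum_log_one_add_inv {w : ℂ} (hw : 1 ≤ w.re) (n : ℕ) :
    ∑ i ∈ Finset.range n, Complex.log (1 + 1 / (w + i)) = Complex.log (w + n) - Complex.log w := by
  induction n with
  | zero => simp
  | succ n ih =>
    rw [Finset.sum_range_succ, ih]
    have h0 : 0 < (w + n).re := by
      simp; have : (0 : ℝ) ≤ n := Nat.cast_nonneg n
      linarith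
    have h1 : w + n ≠ 0 := fun h => by rw [h] at h0; simp at h0
    have h2 : 0 < (1 + 1 / (w + n)).re := by
      have : 0 ≤ ((w + n)⁻¹).re := by
        rw [Complex.inv_re]; exact div_nonneg h0.le (Complex.normSq_nonneg _)
      simp at this ⊢; linarith
    have h3 : 1 + 1 / (w + n) ≠ 0 := fun h => by rw [h] at h2; simp at h2
    have e : w + ((n + 1 : ℕ) : ℂ) = (w + n) * (1 + 1 / (w + n)) := by
      field_simp; push_cast; ring
    have a1 := abs_lt.1 (Complex.abs_arg_lt_pi_div_two_iff.2 (Or.inl h0))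
    have a2 := abs_lt.1 (Complex.abs_arg_lt_pi_div_two_iff.2 (Or.inl h2))
    rw [e, (Complex.log_mul_eq_add_log_iff h1 h3).2 ⟨by linarith, by linarith⟩]
    ring

/-- Each factor w+β+i is (w+i)(1+1/(w+i))^β up to a correction with summable logarithm. The main
parts telescope to ((w+n)/w)^β, and the corrections are bounded uniformly because |w+i| ≥ i+1. -/
theorem exists_rise_ratio_bound {X : ℝ} (hX : 0 ≤ X) : ∃ C : ℝ, 1 ≤ C ∧ ∀ β w : ℂ, ‖β‖ ≤ X →
    1 ≤ w.re → 2 * X + 2 ≤ ‖w‖ → ∀ n : ℕ,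
      ‖rise (w + β) n‖ ≤ C * (‖w + n‖ / ‖w‖) ^ β.re * ‖rise w n‖ ∧
      (‖w + n‖ / ‖w‖) ^ β.re * ‖rise w n‖ ≤ C * ‖rise (w + β) n‖ := by
  have hs : Summable fun i : ℕ => 1 / ((i : ℝ) + 1) ^ 2 := by
    have := (summable_nat_add_iff 1).2 (Real.summable_one_div_nat_pow.2 one_lt_two)
    simpa using this
  set Z := ∑' i : ℕ, 1 / ((i : ℝ) + 1) ^ 2
  have hZ : 0 ≤ Z := tsum_nonneg fun i => by positivity
  have hpi := Real.pi_pos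
  -- X π bounds Im β times the change of argument from w to w + n; the second term bounds the sum of
  -- the logarithmic corrections.
  refine ⟨Real.exp (X * Real.pi + (X + X ^ 2) * Z), Real.one_le_exp (by positivity), ?_⟩
  intro β w hβ hw hwX n
  have hw0 : 0 < ‖w‖ := by linarith
  have hwne : w ≠ 0 := norm_pos_iff.1 hw0
  have hge : ∀ i : ℕ, 2 * X + 2 ≤ ‖w + i‖ := fun i =>
    hwX.trans (norm_add_natCast_ge (by linarith) i)
  have hne : ∀ i : ℕ, w + i ≠ 0 := fun i => norm_pos_iff.1 (by linarith [hge i])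
  have hne2 : ∀ i : ℕ, 1 + β / (w + i) ≠ 0 := fun i h => by
    have h1 : w + i = -β := by
      have := hne i
      field_simp at h; linear_combination h
    have := hge i
    rw [h1, norm_neg] at this; linarith
  set u : ℕ → ℂ := fun i =>
    β * Complex.log (1 + 1 / (w + i)) - Complex.log (1 + β / (w + i)) with hu
  have hfac : ∀ i : ℕ, w + β + i = (w + i) * Complex.exp (β * Complex.log (1 + 1 / (w + i)) - u i) := by
    intro i
    rw [hu]
    simp only [sub_sub_cancel]
    rw [Complex.exp_log (hne2 i)]
    have := hne i
    field_simp; ring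
  have hprod : rise (w + β) n = rise w n *
      Complex.exp (β * (Complex.log (w + n) - Complex.log w) - ∑ i ∈ Finset.range n, u i) := by
    rw [rise, Finset.prod_congr rfl fun i _ => hfac i, Finset.prod_mul_distrib, ← Complex.exp_sum,
      Finset.sum_sub_distrib, ← Finset.mul_sum, sum_log_one_add_inv hw, rise]
  have hsum : ‖∑ i ∈ Finset.range n, u i‖ ≤ (X + X ^ 2) * Z := by
    calc _ ≤ ∑ i ∈ Finset.range n, ‖u i‖ := norm_sum_le _ _
      _ ≤ ∑ i ∈ Finset.range n, (X + X ^ 2) * (1 / ((i : ℝ) + 1) ^ 2) := by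
        refine Finset.sum_le_sum fun i _ => (norm_log_ratio_le hX hβ (hge i)).trans ?_
        rw [mul_one_div]
        have := natCast_le_norm_add hw i
        gcongr
      _ ≤ _ := by
        rw [← Finset.mul_sum]
        gcongr
        exact hs.sum_le_tsum _ fun i _ => by positivity
  set V := ∑ i ∈ Finset.range n, u i
  have hVre := abs_le.1 ((Complex.abs_re_le_norm V).trans hsum)
  have hre : (Complex.log (w + n) - Complex.log w).re = Real.log (‖w + n‖ / ‖w‖) := by
    rw [Real.log_div (norm_ne_zero_iff.2 (hne n)) hw0.ne']
    simp [Complex.log_re]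
  have him : |(Complex.log (w + n) - Complex.log w).im| ≤ Real.pi := by
    have h0 : 0 < (w + n).re := by
      simp; have : (0 : ℝ) ≤ n := Nat.cast_nonneg n
      linarith
    have a1 := abs_lt.1 (Complex.abs_arg_lt_pi_div_two_iff.2 (Or.inl h0))
    have a2 := abs_lt.1 (Complex.abs_arg_lt_pi_div_two_iff.2 (Or.inl (show 0 < w.re by linarith)))
    simp only [Complex.sub_im, Complex.log_im]
    rw [abs_le]; constructor <;> linarith
  set D := Complex.log (w + n) - Complex.log w
  have hbi : |β.im * D.im| ≤ X * Real.pi := by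
    rw [abs_mul]
    exact mul_le_mul ((Complex.abs_im_le_norm β).trans hβ) him (abs_nonneg _) hX
  have hbi' := abs_le.1 hbi
  have hpos : 0 < ‖w + n‖ / ‖w‖ := div_pos (norm_pos_iff.2 (hne n)) hw0
  have hnorm : ‖rise (w + β) n‖ = ‖rise w n‖ * ((‖w + n‖ / ‖w‖) ^ β.re *
      Real.exp (- (β.im * D.im) - V.re)) := by
    rw [hprod, norm_mul, Complex.norm_exp, Real.rpow_def_of_pos hpos, ← Real.exp_add, ← hre]
    congr 2
    simp [Complex.mul_re]; ring
  rw [hnorm]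
  have hr : 0 ≤ ‖rise w n‖ := norm_nonneg _
  have hq : 0 ≤ (‖w + n‖ / ‖w‖) ^ β.re := Real.rpow_nonneg hpos.le _
  constructor
  · have : Real.exp (- (β.im * D.im) - V.re) ≤ Real.exp (X * Real.pi + (X + X ^ 2) * Z) :=
      Real.exp_le_exp.2 (by linarith)
    calc _ = (‖w + n‖ / ‖w‖) ^ β.re * ‖rise w n‖ * Real.exp (- (β.im * D.im) - V.re) := by ring
      _ ≤ (‖w + n‖ / ‖w‖) ^ β.re * ‖rise w n‖ * Real.exp (X * Real.pi + (X + X ^ 2) * Z) := by gcongr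
      _ = _ := by ring
  · have : 1 ≤ Real.exp (X * Real.pi + (X + X ^ 2) * Z) * Real.exp (- (β.im * D.im) - V.re) := by
      rw [← Real.exp_add]; exact Real.one_le_exp (by linarith)
    calc _ = (‖w + n‖ / ‖w‖) ^ β.re * ‖rise w n‖ * 1 := by ring
      _ ≤ (‖w + n‖ / ‖w‖) ^ β.re * ‖rise w n‖ * (Real.exp (X * Real.pi + (X + X ^ 2) * Z) * Real.exp (- (β.im * D.im) - V.re)) := by gcongr
      _ = _ := by ring

open Filter Topology in
theorem tendsto_natCast_div_norm_add (w : ℂ) :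
    Tendsto (fun n : ℕ => ‖w + ((n + 1 : ℕ) : ℂ)‖ / (n : ℝ)) atTop (𝓝 1) := by
  have h1 : Tendsto (fun n : ℕ => (w + 1) * ((n : ℝ)⁻¹ : ℝ) + 1) atTop (𝓝 ((w + 1) * ((0 : ℝ) : ℂ) + 1)) := by
    refine Tendsto.add_const _ (Tendsto.const_mul _ ?_)
    exact (Complex.continuous_ofReal.tendsto 0).comp (tendsto_inv_atTop_nhds_zero_nat (𝕜 := ℝ))
  have h2 := h1.norm
  simp only [Complex.ofReal_zero, mul_zero, zero_add, norm_one] at h2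
  refine h2.congr' ?_
  filter_upwards [eventually_gt_atTop 0] with n hn
  have hn' : (n : ℂ) ≠ 0 := by exact_mod_cast hn.ne'
  have e : (w + 1) * ((n : ℝ)⁻¹ : ℝ) + 1 = (w + ((n + 1 : ℕ) : ℂ)) / ((n : ℝ) : ℂ) := by
    push_cast; field_simp; ring
  rw [e, norm_div, Complex.norm_real, Real.norm_of_nonneg (by positivity)]

-- Euler's limit expresses Γ through rising factorials, so the comparison of rising factorials
-- passes to the limit.
open Filter Topology in
theorem exists_Gamma_ratio_bound {X : ℝ} (hX : 0 ≤ X) : ∃ C : ℝ, 1 ≤ C ∧ ∀ β w : ℂ, ‖β‖ ≤ X →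
    1 ≤ w.re → 2 * X + 2 ≤ ‖w‖ →
      ‖Complex.Gamma (w + β)‖ ≤ C * (‖w‖ ^ β.re * ‖Complex.Gamma w‖) ∧
      ‖w‖ ^ β.re * ‖Complex.Gamma w‖ ≤ C * ‖Complex.Gamma (w + β)‖ := by
  obtain ⟨C, hC, h⟩ := exists_rise_ratio_bound hX
  refine ⟨C, hC, fun β w hβ hw hwX => ?_⟩
  have hw0 : 0 < ‖w‖ := by linarith
  have hge : ∀ i : ℕ, 2 * X + 2 ≤ ‖w + i‖ := fun i =>
    hwX.trans (norm_add_natCast_ge (by linarith) i)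
  have hne : ∀ i : ℕ, w + i ≠ 0 := fun i => norm_pos_iff.1 (by linarith [hge i])
  have hne2 : ∀ i : ℕ, w + β + i ≠ 0 := fun i h => by
    have h1 : w + i = -β := by linear_combination h
    have := hge i
    rw [h1, norm_neg] at this; linarith
  have r1 : ∀ n, 0 < ‖rise w n‖ := fun n => by
    rw [rise]; exact norm_pos_iff.2 (Finset.prod_ne_zero_iff.2 fun i _ => hne i)
  have r2 : ∀ n, 0 < ‖rise (w + β) n‖ := fun n => by
    rw [rise]; exact norm_pos_iff.2 (Finset.prod_ne_zero_iff.2 fun i _ => hne2 i)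
  have hseq : ∀ (s : ℂ) (n : ℕ), 0 < n → ‖Complex.GammaSeq s n‖ =
      (n : ℝ) ^ s.re * (n.factorial : ℝ) / ‖rise s (n + 1)‖ := by
    intro s n hn
    rw [Complex.GammaSeq, norm_div, norm_mul, Complex.norm_natCast_cpow_of_pos hn,
      Complex.norm_natCast, rise]
  -- This factor tends to 1, so it may be inserted freely; it trades the n^(Re β) of Euler's limit
  -- for the |w+n+1|^(Re β) of the rising factorials.
  have t0 : Tendsto (fun n : ℕ => (‖w + ((n + 1 : ℕ) : ℂ)‖ / (n : ℝ)) ^ β.re) atTop (𝓝 1) := by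
    have := (tendsto_natCast_div_norm_add w).rpow_const (p := β.re) (Or.inl one_ne_zero)
    simpa using this
  have t1 := (Complex.GammaSeq_tendsto_Gamma w).norm
  have t2 := (Complex.GammaSeq_tendsto_Gamma (w + β)).norm
  constructor
  · have l := t2.mul t0
    rw [mul_one] at l
    refine le_of_tendsto_of_tendsto l ((t1.const_mul (‖w‖ ^ β.re)).const_mul C) ?_
    filter_upwards [eventually_gt_atTop 0] with n hn
    have hn' : (0 : ℝ) < n := by exact_mod_cast hn
    rw [hseq _ _ hn, hseq _ _ hn]
    have key := (h β w hβ hw hwX (n + 1)).2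
    have hwn : 0 < ‖w + ((n + 1 : ℕ) : ℂ)‖ := norm_pos_iff.2 (hne _)
    rw [Real.div_rpow hwn.le hw0.le] at key
    rw [Real.div_rpow hwn.le hn'.le, Complex.add_re, Real.rpow_add hn']
    have p1 : 0 < (n : ℝ) ^ β.re := Real.rpow_pos_of_pos hn' _
    have p2 : 0 < ‖w‖ ^ β.re := Real.rpow_pos_of_pos hw0 _
    have p3 : 0 < (n : ℝ) ^ w.re := Real.rpow_pos_of_pos hn' _
    have p4 : 0 < (n.factorial : ℝ) := by positivity
    rw [div_mul_div_comm, ← mul_div_assoc, ← mul_div_assoc, div_le_div_iff₀ (by have := r2 (n+1); positivity) (r1 _)]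
    have key2 : ‖w + ((n + 1 : ℕ) : ℂ)‖ ^ β.re * ‖rise w (n + 1)‖ ≤ ‖w‖ ^ β.re * (C * ‖rise (w + β) (n + 1)‖) := by
      have := mul_le_mul_of_nonneg_left key p2.le
      have e : ‖w‖ ^ β.re * (‖w + ((n + 1 : ℕ) : ℂ)‖ ^ β.re / ‖w‖ ^ β.re * ‖rise w (n + 1)‖) =
        ‖w + ((n + 1 : ℕ) : ℂ)‖ ^ β.re * ‖rise w (n + 1)‖ := by field_simp
      linarith
    calc _ = (n : ℝ) ^ w.re * (n : ℝ) ^ β.re * n.factorial * (‖w + ((n + 1 : ℕ) : ℂ)‖ ^ β.re * ‖rise w (n + 1)‖) := by ring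
      _ ≤ (n : ℝ) ^ w.re * (n : ℝ) ^ β.re * n.factorial * (‖w‖ ^ β.re * (C * ‖rise (w + β) (n + 1)‖)) := by gcongr
      _ = _ := by ring
  · have l := t2.mul t0
    rw [mul_one] at l
    refine le_of_tendsto_of_tendsto (t1.const_mul (‖w‖ ^ β.re)) (l.const_mul C) ?_
    filter_upwards [eventually_gt_atTop 0] with n hn
    have hn' : (0 : ℝ) < n := by exact_mod_cast hn
    rw [hseq _ _ hn, hseq _ _ hn]
    have key := (h β w hβ hw hwX (n + 1)).1
    have hwn : 0 < ‖w + ((n + 1 : ℕ) : ℂ)‖ := norm_pos_iff.2 (hne _)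
    rw [Real.div_rpow hwn.le hw0.le] at key
    rw [Real.div_rpow hwn.le hn'.le, Complex.add_re, Real.rpow_add hn']
    have p1 : 0 < (n : ℝ) ^ β.re := Real.rpow_pos_of_pos hn' _
    have p2 : 0 < ‖w‖ ^ β.re := Real.rpow_pos_of_pos hw0 _
    have p3 : 0 < (n : ℝ) ^ w.re := Real.rpow_pos_of_pos hn' _
    have p4 : 0 < (n.factorial : ℝ) := by positivity
    rw [div_mul_div_comm, ← mul_div_assoc, ← mul_div_assoc, div_le_div_iff₀ (r1 _) (by have := r2 (n+1); positivity)]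
    have key2 : ‖w‖ ^ β.re * ‖rise (w + β) (n + 1)‖ ≤ C * (‖w + ((n + 1 : ℕ) : ℂ)‖ ^ β.re * ‖rise w (n + 1)‖) := by
      have := mul_le_mul_of_nonneg_left key p2.le
      have e : ‖w‖ ^ β.re * (C * (‖w + ((n + 1 : ℕ) : ℂ)‖ ^ β.re / ‖w‖ ^ β.re) * ‖rise w (n + 1)‖) =
        C * (‖w + ((n + 1 : ℕ) : ℂ)‖ ^ β.re * ‖rise w (n + 1)‖) := by field_simp
      linarith
    calc _ = (n : ℝ) ^ w.re * (n : ℝ) ^ β.re * n.factorial * (‖w‖ ^ β.re * ‖rise (w + β) (n + 1)‖) := by ring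
      _ ≤ (n : ℝ) ^ w.re * (n : ℝ) ^ β.re * n.factorial * (C * (‖w + ((n + 1 : ℕ) : ℂ)‖ ^ β.re * ‖rise w (n + 1)‖)) := by gcongr
      _ = _ := by ring

/-- The reflection formula at iy, since Γ(1-iy) is the conjugate of Γ(1+iy). -/
theorem norm_sq_Gamma_one_add_mul_I {y : ℝ} (hy : y ≠ 0) :
    ‖Complex.Gamma (1 + y * Complex.I)‖ ^ 2 = Real.pi * y / Real.sinh (Real.pi * y) := by
  have h0 : (y : ℂ) * Complex.I ≠ 0 := mul_ne_zero (by exact_mod_cast hy) Complex.I_ne_zero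
  have h1 : Complex.Gamma (1 + y * Complex.I) = (y * Complex.I) * Complex.Gamma (y * Complex.I) := by
    rw [add_comm, Complex.Gamma_add_one _ h0]
  have h2 := Complex.Gamma_mul_Gamma_one_sub (y * Complex.I)
  have h3 : Complex.Gamma (1 - y * Complex.I) =
      (starRingEnd ℂ) (Complex.Gamma (1 + y * Complex.I)) := by
    rw [← Complex.Gamma_conj]
    congr 1
    simp [sub_eq_add_neg]
  have h4 : ((‖Complex.Gamma (1 + y * Complex.I)‖ ^ 2 : ℝ) : ℂ) =
      ((Real.pi * y / Real.sinh (Real.pi * y) : ℝ) : ℂ) := by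
    rw [← Complex.normSq_eq_norm_sq, Complex.normSq_eq_conj_mul_self, ← h3, h1]
    have : Complex.sin (Real.pi * (y * Complex.I)) = Complex.sinh (Real.pi * y) * Complex.I := by
      rw [← mul_assoc, Complex.sin_mul_I]
    rw [this] at h2
    push_cast
    calc _ = (y * Complex.I) * (Complex.Gamma (y * Complex.I) * Complex.Gamma (1 - y * Complex.I)) := by ring
      _ = _ := by
        rw [h2, ← mul_div_assoc, mul_comm (Complex.sinh _) Complex.I]
        rw [show (y : ℂ) * Complex.I * Real.pi = Complex.I * (Real.pi * y) by ring,
          mul_div_mul_left _ _ Complex.I_ne_zero]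
  exact_mod_cast h4

/-- The only source of the exponential factor exp(-π|y|/2); all other vertical lines are reached by
the ratio bound, which changes only the power of |y|. -/
theorem norm_Gamma_one_add_mul_I_bounds {y : ℝ} (hy : 1 ≤ |y|) :
    |y| ^ (1 / 2 : ℝ) * Real.exp (-(Real.pi / 2 * |y|)) ≤ ‖Complex.Gamma (1 + y * Complex.I)‖ ∧
    ‖Complex.Gamma (1 + y * Complex.I)‖ ≤
      4 * (|y| ^ (1 / 2 : ℝ) * Real.exp (-(Real.pi / 2 * |y|))) := by
  have hy0 : y ≠ 0 := by rintro rfl; simp at hy; linarith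
  have hsq : ‖Complex.Gamma (1 + y * Complex.I)‖ ^ 2 =
      Real.pi * |y| / Real.sinh (Real.pi * |y|) := by
    rw [norm_sq_Gamma_one_add_mul_I hy0]
    rcases abs_cases y with ⟨h, _⟩ | ⟨h, _⟩
    · rw [h]
    · rw [h, mul_neg, Real.sinh_neg, neg_div_neg_eq]
  set t := |y|
  have ht : 0 < t := by linarith
  set E := Real.exp (-(Real.pi / 2 * t)) with hE
  have hEE : (t ^ (1 / 2 : ℝ) * E) ^ 2 = t * Real.exp (-(Real.pi * t)) := by
    rw [mul_pow, ← Real.rpow_natCast, ← Real.rpow_mul ht.le, hE, ← Real.exp_nat_mul]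
    norm_num
    left; ring
  have hpi := Real.pi_gt_three
  have hpi4 := Real.pi_le_four
  have hs : Real.sinh (Real.pi * t) = (Real.exp (Real.pi * t) - Real.exp (-(Real.pi * t))) / 2 :=
    Real.sinh_eq _
  have hexp : Real.exp (Real.pi * t) * Real.exp (-(Real.pi * t)) = 1 := by
    rw [← Real.exp_add]; simp
  have hbig : 2 ≤ Real.exp (Real.pi * t) := by
    have := Real.add_one_le_exp (Real.pi * t); nlinarith
  have hp : 0 < Real.exp (-(Real.pi * t)) := Real.exp_pos _
  have hspos : 0 < Real.sinh (Real.pi * t) := Real.sinh_pos_iff.2 (by positivity)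
  constructor
  · rw [← sq_le_sq₀ (by positivity) (norm_nonneg _), hsq, hEE, le_div_iff₀ hspos, hs]
    nlinarith
  · rw [← sq_le_sq₀ (norm_nonneg _) (by positivity), hsq, mul_pow, hEE, div_le_iff₀ hspos, hs]
    have : Real.exp (-(Real.pi * t)) ≤ 1 / 2 := by nlinarith
    have h3 : 1 / 4 ≤ Real.exp (-(Real.pi * t)) * ((Real.exp (Real.pi * t) - Real.exp (-(Real.pi * t))) / 2) := by
      nlinarith
    nlinarith [mul_le_mul_of_nonneg_left h3 ht.le]

/-- Growth of the Gamma function along vertical lines, uniformly in strips. -/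
theorem exists_Gamma_vertical_bound (α : ℂ) {X : ℝ} (hX : 0 ≤ X) :
    ∃ C T : ℝ, 1 ≤ C ∧ 1 ≤ T ∧ ∀ x y : ℝ, |x| ≤ X → T ≤ |y| →
      ‖Complex.Gamma (α + (x + y * Complex.I))‖ ≤
        C * (|y| ^ (x + α.re - 1 / 2) * Real.exp (-(Real.pi / 2 * |y|))) ∧
      |y| ^ (x + α.re - 1 / 2) * Real.exp (-(Real.pi / 2 * |y|)) ≤
        C * ‖Complex.Gamma (α + (x + y * Complex.I))‖ := by
  -- Y bounds the shift β = α + x - 1 that leads from the line Re = 1 to the point considered.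
  set Y := ‖α‖ + X + 1 with hY
  have hY1 : 1 ≤ Y := by have := norm_nonneg α; linarith
  obtain ⟨C, hC, h⟩ := exists_Gamma_ratio_bound (X := Y) (by linarith)
  have h2Y : (1 : ℝ) ≤ 2 ^ Y := Real.one_le_rpow (by norm_num) (by linarith)
  refine ⟨C * 2 ^ Y * 4, 2 * Y + 2, by nlinarith [mul_le_mul hC h2Y zero_le_one (by linarith)], by linarith, fun x y hx hy => ?_⟩
  have hy1 : 1 ≤ |y| := by linarith
  have hy0 : 0 < |y| := by linarith
  set w : ℂ := 1 + y * Complex.I with hw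
  set β : ℂ := α + x - 1 with hβ
  have e : α + (x + y * Complex.I) = w + β := by rw [hw, hβ]; ring
  have hwre : w.re = 1 := by simp [hw]
  have hwim : w.im = y := by simp [hw]
  have hβre : β.re = α.re + x - 1 := by simp [hβ]
  have hβn : ‖β‖ ≤ Y := by
    refine (norm_sub_le _ _).trans ?_
    have := norm_add_le α (x : ℂ)
    rw [Complex.norm_real, Real.norm_eq_abs] at this
    rw [norm_one]; linarith
  have hlow : |y| ≤ ‖w‖ := by rw [← hwim]; exact Complex.abs_im_le_norm w
  have hhigh : ‖w‖ ≤ 2 * |y| := by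
    have := Complex.norm_le_abs_re_add_abs_im w
    rw [hwre, hwim, abs_one] at this; linarith
  have hw0 : 0 < ‖w‖ := by linarith
  obtain ⟨h1, h2⟩ := h β w hβn hwre.ge (by linarith)
  obtain ⟨g1, g2⟩ := norm_Gamma_one_add_mul_I_bounds hy1
  rw [e]
  have hβabs : |β.re| ≤ Y := (Complex.abs_re_le_norm β).trans hβn
  have hβa := abs_le.1 hβabs
  have hr1 : 1 ≤ ‖w‖ / |y| := by rw [le_div_iff₀ hy0]; linarith
  have hr2 : ‖w‖ / |y| ≤ 2 := by rw [div_le_iff₀ hy0]; linarith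
  have hwq : ‖w‖ ^ β.re = |y| ^ β.re * (‖w‖ / |y|) ^ β.re := by
    rw [← Real.mul_rpow hy0.le (by positivity), mul_div_cancel₀ _ hy0.ne']
  have q1 : (‖w‖ / |y|) ^ β.re ≤ 2 ^ Y :=
    (Real.rpow_le_rpow_of_exponent_le hr1 hβa.2).trans
      (Real.rpow_le_rpow (by positivity) hr2 (by linarith))
  have q2 : 1 ≤ 2 ^ Y * (‖w‖ / |y|) ^ β.re := by
    have a : (‖w‖ / |y|) ^ (-Y) ≤ (‖w‖ / |y|) ^ β.re := Real.rpow_le_rpow_of_exponent_le hr1 hβa.1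
    have b : (‖w‖ / |y|) ^ Y ≤ 2 ^ Y := Real.rpow_le_rpow (by positivity) hr2 (by linarith)
    have c : (‖w‖ / |y|) ^ Y * (‖w‖ / |y|) ^ (-Y) = 1 := by
      rw [← Real.rpow_add (by positivity)]; simp
    rw [← c]
    have : 0 < (‖w‖ / |y|) ^ (-Y) := Real.rpow_pos_of_pos (by positivity) _
    gcongr
  have hpow : |y| ^ (x + α.re - 1 / 2) = |y| ^ β.re * |y| ^ (1 / 2 : ℝ) := by
    rw [← Real.rpow_add hy0, hβre]; congr 1; ring
  rw [hpow]
  set E := Real.exp (-(Real.pi / 2 * |y|))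
  have hE : 0 < E := Real.exp_pos _
  have p1 : 0 < |y| ^ β.re := Real.rpow_pos_of_pos hy0 _
  have p2 : 0 < |y| ^ (1 / 2 : ℝ) := Real.rpow_pos_of_pos hy0 _
  have p3 : 0 < (‖w‖ / |y|) ^ β.re := Real.rpow_pos_of_pos (by positivity) _
  rw [hwq] at h1 h2
  constructor
  · calc _ ≤ _ := h1
      _ ≤ C * (|y| ^ β.re * 2 ^ Y * (4 * (|y| ^ (1 / 2 : ℝ) * E))) := by gcongr
      _ = _ := by ring
  · calc |y| ^ β.re * |y| ^ (1 / 2 : ℝ) * E = |y| ^ β.re * 1 * (|y| ^ (1 / 2 : ℝ) * E) := by ring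
      _ ≤ |y| ^ β.re * (2 ^ Y * (‖w‖ / |y|) ^ β.re) * ‖Complex.Gamma w‖ := by gcongr
      _ = 2 ^ Y * (|y| ^ β.re * (‖w‖ / |y|) ^ β.re * ‖Complex.Gamma w‖) := by ring
      _ ≤ 2 ^ Y * (C * ‖Complex.Gamma (w + β)‖) := by gcongr
      _ = C * 2 ^ Y * 1 * ‖Complex.Gamma (w + β)‖ := by ring
      _ ≤ C * 2 ^ Y * 4 * ‖Complex.Gamma (w + β)‖ := by gcongr; norm_num

/-! ### Principal parts, primitives off the poles, winding of a vertical line -/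

section Residue
open Filter Topology

/-- Splitting off the principal part at a pole: a pure pole term `c / (s - P)`, a part `ψ` with
single-valued primitive `Ψ`, and an analytic part. -/
theorem exists_principal_part_of_pow {P : ℂ} (n : ℕ) : ∀ {h : ℂ → ℂ}, AnalyticAt ℂ h P →
    ∃ (c : ℂ) (g Ψ ψ : ℂ → ℂ), AnalyticAt ℂ g P ∧ (∀ s, s ≠ P → HasDerivAt Ψ (ψ s) s) ∧
      (∀ s, s ≠ P → DifferentiableAt ℂ ψ s) ∧ MeromorphicAt ψ P ∧
      ∀ s, s ≠ P → ((s - P) ^ n)⁻¹ * h s = g s + ψ s + c / (s - P) := by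
  induction n with
  | zero =>
    intro h hh
    exact ⟨0, h, fun _ => 0, fun _ => 0, hh, fun s _ => hasDerivAt_const _ _,
      fun s _ => differentiableAt_const _, MeromorphicAt.const _ _, fun s _ => by simp⟩
  | succ n ih =>
    intro h hh
    -- Writing h(s) = h(P) + (s-P) · dslope h P s lowers the order of the pole by one and leaves
    -- h(P)/(s-P)^(n+1).
    obtain ⟨c, g, Ψ, ψ, hg, hΨ, hψ, hψm, e⟩ := ih (h := dslope h P) (by
      obtain ⟨p, hp⟩ := hh
      exact ⟨_, hp.has_fpower_series_dslope_fslope⟩)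
    have step : ∀ s, s ≠ P → ((s - P) ^ (n + 1))⁻¹ * h s =
        ((s - P) ^ n)⁻¹ * dslope h P s + h P * ((s - P) ^ (n + 1))⁻¹ := by
      intro s hs
      have h0 : s - P ≠ 0 := sub_ne_zero.2 hs
      rw [dslope_of_ne _ hs, slope_def_field]
      field_simp; ring
    -- The leftover is a simple pole if n = 0 and joins c; otherwise it has the primitive -h(P)/(n
    -- (s-P)^n) and joins ψ.
    rcases Nat.eq_zero_or_pos n with rfl | hn
    · refine ⟨c + h P, g, Ψ, ψ, hg, hΨ, hψ, hψm, fun s hs => ?_⟩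
      rw [step s hs, e s hs]; simp; ring
    · refine ⟨c, g, fun s => Ψ s + h P * (-(n : ℂ)⁻¹ * (s - P) ^ (-(n : ℤ))),
        fun s => ψ s + h P * ((s - P) ^ (n + 1))⁻¹, hg, fun s hs => ?_, fun s hs => ?_, ?_,
        fun s hs => ?_⟩
      · have h0 : s - P ≠ 0 := sub_ne_zero.2 hs
        refine (hΨ s hs).add (HasDerivAt.const_mul _ ?_)
        have h1 := ((hasDerivAt_zpow (-(n : ℤ)) (s - P) (Or.inl h0)).comp s
          ((hasDerivAt_id s).sub_const P)).const_mul (-(n : ℂ)⁻¹)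
        refine h1.congr_deriv ?_
        have hn' : (n : ℂ) ≠ 0 := by exact_mod_cast hn.ne'
        have e2 : (-(n : ℤ) - 1) = -((n + 1 : ℕ) : ℤ) := by push_cast; ring
        rw [e2, zpow_neg, zpow_natCast]
        push_cast; field_simp
      · have h0 : s - P ≠ 0 := sub_ne_zero.2 hs
        refine (hψ s hs).add (DifferentiableAt.const_mul ?_ _)
        exact DifferentiableAt.inv (by fun_prop) (pow_ne_zero _ h0)
      · have : MeromorphicAt (fun s => s - P) P := (MeromorphicAt.id P).sub (MeromorphicAt.const P P)
        exact hψm.add ((MeromorphicAt.const _ _).mul ((this.pow _).inv))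
      · rw [step s hs, e s hs]; ring

/-- The last clause identifies c only when (s-P)f has a limit, that is, at a pole of order at most
one. That is enough: residues are needed only at the poles that are crossed, while the others may
have any order. -/
theorem exists_principal_part {f : ℂ → ℂ} {P : ℂ} (hf : MeromorphicAt f P) :
    ∃ (c : ℂ) (g Ψ ψ : ℂ → ℂ), AnalyticAt ℂ g P ∧ (∀ s, s ≠ P → HasDerivAt Ψ (ψ s) s) ∧
      (∀ s, s ≠ P → DifferentiableAt ℂ ψ s) ∧ MeromorphicAt ψ P ∧
      (∀ᶠ s in 𝓝[≠] P, f s = g s + ψ s + c / (s - P)) ∧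
      ∀ r, Tendsto (fun s => (s - P) * f s) (𝓝[≠] P) (𝓝 r) → c = r := by
  have hsub : MeromorphicAt (fun s => s - P) P := (MeromorphicAt.id P).sub (MeromorphicAt.const P P)
  by_cases hr : ∃ r, Tendsto (fun s => (s - P) * f s) (𝓝[≠] P) (𝓝 r)
  · obtain ⟨r, hr⟩ := hr
    set h : ℂ → ℂ := Function.update (fun s => (s - P) * f s) P r with hh
    have hne : ∀ s, s ≠ P → h s = (s - P) * f s := fun s hs => Function.update_of_ne hs _ _
    have hP : h P = r := Function.update_self _ _ _
    have ha : AnalyticAt ℂ h P := by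
      refine MeromorphicAt.analyticAt ?_ (continuousAt_update_same.2 hr)
      refine (hsub.mul hf).congr ?_
      filter_upwards [self_mem_nhdsWithin] with s hs
      exact (hne s hs).symm
    refine ⟨r, dslope h P, fun _ => 0, fun _ => 0, ?_, fun s _ => hasDerivAt_const _ _,
      fun s _ => differentiableAt_const _, MeromorphicAt.const _ _, ?_, ?_⟩
    · obtain ⟨p, hp⟩ := ha
      exact ⟨_, hp.has_fpower_series_dslope_fslope⟩
    · filter_upwards [self_mem_nhdsWithin] with s hs
      have h0 : s - P ≠ 0 := sub_ne_zero.2 hs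
      rw [dslope_of_ne _ hs, slope_def_field, hne s hs, hP]
      field_simp; ring
    · intro r' hr'
      exact tendsto_nhds_unique hr hr'
  · obtain ⟨n, hn⟩ := hf
    obtain ⟨c, g, Ψ, ψ, hg, hΨ, hψ, hψm, e⟩ := exists_principal_part_of_pow n hn
    refine ⟨c, g, Ψ, ψ, hg, hΨ, hψ, hψm, ?_, fun r h => absurd ⟨r, h⟩ hr⟩
    filter_upwards [self_mem_nhdsWithin] with s hs
    have h0 : s - P ≠ 0 := sub_ne_zero.2 hs
    rw [← e s hs, smul_eq_mul, inv_mul_cancel_left₀ (pow_ne_zero _ h0)]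

/-- Principal parts are removed one pole at a time. What remains is holomorphic on a convex open set
and so has a primitive, the higher order parts bring their own primitives, and only the terms
c/(s-P) stay outside. -/
theorem exists_primitive_off_poles {U : Set ℂ} (hU : Convex ℝ U) (hUo : IsOpen U)
    (S : Finset ℂ) : ∀ {f : ℂ → ℂ}, (∀ s ∈ U, s ∉ S → DifferentiableAt ℂ f s) →
    (∀ P ∈ S, MeromorphicAt f P) →
    ∃ c Φ : ℂ → ℂ, (∀ s ∈ U, s ∉ S → HasDerivAt Φ (f s - ∑ P ∈ S, c P / (s - P)) s) ∧
      ∀ P ∈ S, ∀ r, Tendsto (fun s => (s - P) * f s) (𝓝[≠] P) (𝓝 r) → c P = r := by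
  classical
  induction S using Finset.induction_on with
  | empty =>
    intro f hf _
    obtain ⟨Φ, hΦ⟩ := hU.exists_forall_hasDerivWithinAt (f := f)
      (fun s hs => (hf s hs (by simp)).differentiableWithinAt)
    exact ⟨0, Φ, fun s hs _ => by simpa using (hΦ s hs).hasDerivAt (hUo.mem_nhds hs), by simp⟩
  | insert P S hPS ih =>
    intro f hf hm
    obtain ⟨c0, g, Ψ, ψ, hg, hΨ, hψ, hψm, hfe, hr⟩ :=
      exists_principal_part (hm P (Finset.mem_insert_self _ _))
    -- The value g(P) fills the removable singularity, so f' is differentiable at P and P can be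
    -- dropped from the set.
    set f' : ℂ → ℂ := Function.update (fun s => f s - ψ s - c0 / (s - P)) P (g P) with hf'
    have hne : ∀ s, s ≠ P → f' s = f s - ψ s - c0 / (s - P) :=
      fun s hs => Function.update_of_ne hs _ _
    have hne' : ∀ s, s ≠ P → f' =ᶠ[𝓝 s] fun s => f s - ψ s - c0 / (s - P) := by
      intro s hs
      filter_upwards [isOpen_ne.mem_nhds hs] with t ht using hne t ht
    have hfP : f' =ᶠ[𝓝 P] g := by
      have : ∀ᶠ s in 𝓝[≠] P, f' s = g s := by
        filter_upwards [hfe, self_mem_nhdsWithin] with s hs hs'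
        rw [hne s hs', hs]; ring
      rw [eventually_nhdsWithin_iff] at this
      filter_upwards [this] with s hs
      by_cases h : s = P
      · rw [h]; exact Function.update_self _ _ _
      · exact hs h
    have hd0 : ∀ s, s ≠ P → DifferentiableAt ℂ (fun s => ψ s + c0 / (s - P)) s := fun s hs =>
      (hψ s hs).add (DifferentiableAt.div (by fun_prop) (by fun_prop) (sub_ne_zero.2 hs))
    have hd : ∀ s ∈ U, s ∉ S → DifferentiableAt ℂ f' s := by
      intro s hs hsS
      by_cases h : s = P
      · rw [h]; exact hg.differentiableAt.congr_of_eventuallyEq hfP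
      · refine DifferentiableAt.congr_of_eventuallyEq ?_ (hne' s h)
        exact ((hf s hs (by simp [h, hsS])).sub (hψ s h)).sub
          (DifferentiableAt.div (by fun_prop) (by fun_prop) (sub_ne_zero.2 h))
    have hQP : ∀ Q ∈ S, Q ≠ P := fun Q hQ h => hPS (h ▸ hQ)
    obtain ⟨c, Φ, hΦ, hc⟩ := ih hd (by
      intro Q hQ
      have hmf := hm Q (Finset.mem_insert_of_mem hQ)
      have ha : AnalyticAt ℂ (fun s => ψ s + c0 / (s - P)) Q := by
        refine DifferentiableOn.analyticAt (s := {P}ᶜ) (fun s hs => ?_) (isOpen_ne.mem_nhds (hQP Q hQ))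
        exact (hd0 s hs).differentiableWithinAt
      refine (hmf.sub ha.meromorphicAt).congr ?_
      filter_upwards [(hne' Q (hQP Q hQ)).filter_mono nhdsWithin_le_nhds] with s hs
      rw [hs]; simp; ring)
    refine ⟨Function.update c P c0, fun s => Φ s + Ψ s, ?_, ?_⟩
    · intro s hs hsS
      simp only [Finset.mem_insert, not_or] at hsS
      refine ((hΦ s hs hsS.2).add (hΨ s hsS.1)).congr_deriv ?_
      rw [Finset.sum_insert hPS, Function.update_self, hne s hsS.1]
      have : ∑ Q ∈ S, Function.update c P c0 Q / (s - Q) = ∑ Q ∈ S, c Q / (s - Q) :=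
        Finset.sum_congr rfl fun Q hQ => by rw [Function.update_of_ne (hQP Q hQ)]
      rw [this]; ring
    · intro Q hQ r hlim
      rcases Finset.mem_insert.1 hQ with rfl | hQ'
      · rw [Function.update_self]; exact hr r hlim
      · rw [Function.update_of_ne (hQP Q hQ')]
        refine hc Q hQ' r ?_
        -- What was removed at P is regular at Q, so it does not affect the residue there.
        have h1 : Tendsto (fun s => (s - Q) * (ψ s + c0 / (s - P))) (𝓝[≠] Q) (𝓝 0) := by
          have : ContinuousAt (fun s => (s - Q) * (ψ s + c0 / (s - P))) Q :=
            ContinuousAt.mul (by fun_prop) (hd0 Q (hQP Q hQ')).continuousAt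
          have h2 := this.tendsto
          simp only [sub_self, zero_mul] at h2
          exact h2.mono_left nhdsWithin_le_nhds
        have h2 := hlim.sub h1
        rw [sub_zero] at h2
        refine h2.congr' ?_
        filter_upwards [(hne' Q (hQP Q hQ')).filter_mono nhdsWithin_le_nhds] with s hs
        rw [hs]; ring

/-- `f` tends to zero at `±i∞`, uniformly in the strip `x₁ < Re s < x₂`. -/
def VanishesInStrip (f : ℂ → ℂ) (x₁ x₂ : ℝ) : Prop :=
  ∀ ε > 0, ∃ R : ℝ, ∀ s : ℂ, x₁ < s.re → s.re < x₂ → R ≤ |s.im| → ‖f s‖ ≤ ε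

theorem VanishesInStrip.sub {f g : ℂ → ℂ} {x₁ x₂ : ℝ} (hf : VanishesInStrip f x₁ x₂)
    (hg : VanishesInStrip g x₁ x₂) : VanishesInStrip (fun s => f s - g s) x₁ x₂ := by
  intro ε hε
  obtain ⟨R, hR⟩ := hf (ε / 2) (by linarith)
  obtain ⟨R', hR'⟩ := hg (ε / 2) (by linarith)
  refine ⟨max R R', fun s h1 h2 h3 => (norm_sub_le _ _).trans ?_⟩
  have a := hR s h1 h2 ((le_max_left _ _).trans h3)
  have b := hR' s h1 h2 ((le_max_right _ _).trans h3)
  linarith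

theorem VanishesInStrip.sum_div_sub (c : ℂ → ℂ) (S : Finset ℂ) (x₁ x₂ : ℝ) :
    VanishesInStrip (fun s => ∑ P ∈ S, c P / (s - P)) x₁ x₂ := by
  intro ε hε
  have hb : (0 : ℝ) ≤ ∑ P ∈ S, ‖c P‖ := Finset.sum_nonneg fun _ _ => norm_nonneg _
  set b := ∑ P ∈ S, ‖c P‖
  set q := ∑ P ∈ S, |P.im|
  refine ⟨q + (b + 1) / ε, fun s _ _ h => (norm_sum_le _ _).trans ?_⟩
  have hpos : 0 < (b + 1) / ε := by positivity
  have : ∀ P ∈ S, ‖c P / (s - P)‖ ≤ ‖c P‖ / ((b + 1) / ε) := by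
    intro P hP
    rw [norm_div]
    have h1 : |P.im| ≤ q := Finset.single_le_sum (f := fun P : ℂ => |P.im|) (fun _ _ => abs_nonneg _) hP
    have h2 : |s.im| - |P.im| ≤ ‖s - P‖ := by
      refine (abs_sub_abs_le_abs_sub _ _).trans ?_
      rw [← Complex.sub_im]; exact Complex.abs_im_le_norm _
    gcongr
    linarith
  refine (Finset.sum_le_sum this).trans ?_
  rw [← Finset.sum_div, div_div_eq_mul_div, div_le_iff₀ (by linarith)]
  nlinarith

/-- Multiplying by the sign ε brings s - P into the right half-plane along the whole line, where the
principal logarithm is a primitive. Its end values are compared after rescaling by 1/R, which adds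
the same real number to both. -/
theorem tendsto_integral_line_div {lam : ℝ} {P : ℂ} (h : P.re ≠ lam) :
    Tendsto (fun R : ℝ => ∫ t in (-R)..R, Complex.I / ((lam : ℂ) + t * Complex.I - P)) atTop
      (𝓝 (if P.re < lam then (Real.pi : ℂ) * Complex.I else -((Real.pi : ℂ) * Complex.I))) := by
  set ε : ℝ := if P.re < lam then 1 else -1 with hε
  have hε2 : ε * ε = 1 := by rw [hε]; split_ifs <;> norm_num
  have hε0 : (ε : ℂ) ≠ 0 := by
    intro h0
    have : ε = 0 := by exact_mod_cast h0
    rw [this] at hε2; norm_num at hε2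
  have hpos : 0 < ε * (lam - P.re) := by
    rw [hε]; split_ifs with h1
    · linarith
    · have := lt_of_le_of_ne (not_lt.1 h1) (Ne.symm h); linarith
  set q : ℝ → ℂ := fun t => (ε : ℂ) * ((lam : ℂ) + t * Complex.I - P) with hq
  have hre : ∀ t, (q t).re = ε * (lam - P.re) := fun t => by simp [hq]
  have hslit : ∀ t, q t ∈ Complex.slitPlane := fun t => Or.inl (by rw [hre]; exact hpos)
  have hq0 : ∀ t, q t ≠ 0 := fun t => Complex.slitPlane_ne_zero (hslit t)
  have hd : ∀ t : ℝ, HasDerivAt (fun t : ℝ => Complex.log (q t))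
      (Complex.I / ((lam : ℂ) + t * Complex.I - P)) t := by
    intro t
    have h1 : HasDerivAt q ((ε : ℂ) * Complex.I) t := by
      have := ((((Complex.ofRealCLM.hasDerivAt (x := t)).mul_const Complex.I).const_add
        (lam : ℂ)).sub_const P).const_mul (ε : ℂ)
      simpa using this
    refine (h1.clog_real (hslit t)).congr_deriv ?_
    rw [hq]; exact mul_div_mul_left _ _ hε0
  have hcont : Continuous fun t : ℝ => Complex.I / ((lam : ℂ) + t * Complex.I - P) := by
    refine Continuous.div (by fun_prop) (by fun_prop) fun t h0 => hq0 t ?_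
    rw [hq]; simp only [h0, mul_zero]
  have hint : ∀ R : ℝ, ∫ t in (-R)..R, Complex.I / ((lam : ℂ) + t * Complex.I - P) =
      Complex.log (q R) - Complex.log (q (-R)) := fun R =>
    intervalIntegral.integral_eq_sub_of_hasDerivAt (fun t _ => hd t) (hcont.intervalIntegrable _ _)
  simp only [hint]
  have hscale : ∀ κ : ℝ, κ * κ = 1 → Tendsto (fun R : ℝ => Complex.log (((R⁻¹ : ℝ) : ℂ) * q (κ * R))) atTop
      (𝓝 (Complex.log ((ε : ℂ) * κ * Complex.I))) := by
    intro κ hκ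
    have him : ((ε : ℂ) * κ * Complex.I).im ≠ 0 := by
      simp; constructor
      · intro h0; rw [h0] at hε2; norm_num at hε2
      · intro h0; rw [h0] at hκ; norm_num at hκ
    have hc : ContinuousAt Complex.log ((ε : ℂ) * κ * Complex.I) :=
      continuousAt_clog (Or.inr him)
    refine hc.tendsto.comp ?_
    have h1 : Tendsto (fun R : ℝ => ((R⁻¹ : ℝ) : ℂ) * (ε * (lam - P)) + (ε : ℂ) * κ * Complex.I) atTop
        (𝓝 (((0 : ℝ) : ℂ) * (ε * (lam - P)) + (ε : ℂ) * κ * Complex.I)) := by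
      refine (Tendsto.mul_const _ ?_).add_const _
      exact (Complex.continuous_ofReal.tendsto 0).comp tendsto_inv_atTop_zero
    simp only [Complex.ofReal_zero, zero_mul, zero_add] at h1
    refine h1.congr' ?_
    filter_upwards [eventually_gt_atTop 0] with R hR
    have : (R : ℂ) ≠ 0 := by exact_mod_cast hR.ne'
    rw [hq]; push_cast; field_simp; ring
  have h1 := (hscale 1 (by norm_num)).sub (hscale (-1) (by norm_num))
  have hval : Complex.log ((ε : ℂ) * ((1 : ℝ) : ℂ) * Complex.I) - Complex.log ((ε : ℂ) * ((-1 : ℝ) : ℂ) * Complex.I) =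
      (if P.re < lam then (Real.pi : ℂ) * Complex.I else -((Real.pi : ℂ) * Complex.I)) := by
    rw [hε]; split_ifs
    · simp only [Complex.ofReal_one, one_mul, Complex.ofReal_neg, neg_mul, Complex.log_I,
        Complex.log_neg_I]; ring
    · simp only [Complex.ofReal_one, one_mul, mul_one, Complex.ofReal_neg, neg_mul, Complex.log_I,
        Complex.log_neg_I, mul_neg, neg_neg]; ring
  rw [hval] at h1
  refine h1.congr' ?_
  filter_upwards [eventually_gt_atTop 0] with R hR
  have hR' : 0 < R⁻¹ := inv_pos.2 hR
  rw [Complex.log_ofReal_mul hR' (hq0 _), Complex.log_ofReal_mul hR' (hq0 _)]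
  simp

end Residue

/-! ### Shifting the contour -/

section Shift
open Filter Topology MeasureTheory

theorem integral_comp_of_primitive {γ : ℝ → ℂ} (hγ : ContDiff ℝ 1 γ) {g Φ : ℂ → ℂ}
    (hΦ : ∀ t, HasDerivAt Φ (g (γ t)) (γ t)) (hg : Continuous fun t => g (γ t)) (a b : ℝ) :
    ∫ t in a..b, g (γ t) * deriv γ t = Φ (γ b) - Φ (γ a) := by
  have hd : ∀ t, HasDerivAt γ (deriv γ t) t := fun t =>
    (hγ.differentiable one_ne_zero t).hasDerivAt
  refine intervalIntegral.integral_eq_sub_of_hasDerivAt (f := fun t => Φ (γ t)) (fun t _ => ?_) ?_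
  · exact (hΦ t).comp_of_eq t (hd t) rfl
  · exact (hg.mul (hγ.continuous_deriv le_rfl)).intervalIntegrable _ _

/-- The two points are joined by a horizontal segment of fixed length, on which the derivative of Φ
tends to zero. This replaces the estimate of the horizontal sides of a rectangle. -/
theorem tendsto_primitive_sub {g Φ : ℂ → ℂ} {x₁ x₂ R₀ : ℝ}
    (hΦ : ∀ s : ℂ, x₁ < s.re → s.re < x₂ → R₀ ≤ |s.im| → HasDerivAt Φ (g s) s)
    (hg : VanishesInStrip g x₁ x₂) {u v : ℝ} (hu : x₁ < u ∧ u < x₂) (hv : x₁ < v ∧ v < x₂)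
    {l : Filter ℝ} (hl : Tendsto (fun t : ℝ => |t|) l atTop) :
    Tendsto (fun t : ℝ => Φ (u + t * Complex.I) - Φ (v + t * Complex.I)) l (𝓝 0) := by
  rw [Metric.tendsto_nhds]
  intro ε hε
  obtain ⟨R, hR⟩ := hg (ε / (|u - v| + 1)) (by positivity)
  filter_upwards [hl.eventually_ge_atTop (max R R₀)] with t ht
  have hconv : Convex ℝ {s : ℂ | x₁ < s.re ∧ s.re < x₂ ∧ s.im = t} := by
    have h1 : Convex ℝ {s : ℂ | x₁ < s.re} := convex_halfSpace_re_gt x₁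
    have h2 : Convex ℝ {s : ℂ | s.re < x₂} := convex_halfSpace_re_lt x₂
    have h3 : Convex ℝ {s : ℂ | s.im = t} := convex_hyperplane Complex.imLm.isLinear t
    exact h1.inter (h2.inter h3)
  have key := hconv.norm_image_sub_le_of_norm_hasDerivWithin_le (f := Φ) (f' := g)
    (C := ε / (|u - v| + 1)) (x := v + t * Complex.I) (y := u + t * Complex.I)
    (fun s hs => (hΦ s hs.1 hs.2.1 (by rw [hs.2.2]; exact (le_max_right _ _).trans ht)).hasDerivWithinAt)
    (fun s hs => hR s hs.1 hs.2.1 (by rw [hs.2.2]; exact (le_max_left _ _).trans ht))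
    (by simpa using hv) (by simpa using hu)
  rw [dist_zero_right]
  refine key.trans_lt ?_
  have e : (u + t * Complex.I) - (v + t * Complex.I) = ((u - v : ℝ) : ℂ) := by push_cast; ring
  rw [e, Complex.norm_real, Real.norm_eq_abs, div_mul_eq_mul_div, div_lt_iff₀ (by positivity)]
  nlinarith [abs_nonneg (u - v)]

/-- Subtracting the terms c_P/(s-P) leaves a function with a primitive Φ off the poles, and the end
values of Φ on the two curves agree in the limit. So the integrals differ by the sum of c_P times
the difference of the winding integrals: zero for P in S₀, which lies on the same side of both
curves, and 2πi for P in S₁. -/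
theorem contour_shift {γ : ℝ → ℂ} (hγ : ContDiff ℝ 1 γ) {σ T : ℝ}
    (hv : ∀ t : ℝ, T ≤ |t| → γ t = (σ : ℂ) + (t : ℂ) * Complex.I) {x₁ x₂ lam : ℝ}
    (hγU : ∀ t, x₁ < (γ t).re ∧ (γ t).re < x₂) (hlam : x₁ < lam ∧ lam < x₂)
    {S₀ S₁ : Finset ℂ} {f : ℂ → ℂ}
    (hf : ∀ s : ℂ, x₁ < s.re → s.re < x₂ → s ∉ S₀ → s ∉ S₁ → DifferentiableAt ℂ f s)
    (hm : ∀ P, MeromorphicAt f P) (hvan : VanishesInStrip f x₁ x₂)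
    (h₀ : ∀ P ∈ S₀, (IsLeftOf γ P ∧ P.re < lam) ∨ (IsRightOf γ P ∧ lam < P.re))
    (h₁ : ∀ P ∈ S₁, IsLeftOf γ P ∧ lam < P.re) {r : ℂ → ℂ}
    (hr : ∀ P ∈ S₁, Tendsto (fun s => (s - P) * f s) (𝓝[≠] P) (𝓝 (r P)))
    (hi : Integrable fun t => f (γ t) * deriv γ t)
    (hi' : Integrable fun t : ℝ => f (lam + t * Complex.I) * Complex.I) :
    (∫ t, f (γ t) * deriv γ t) - ∫ t : ℝ, f (lam + t * Complex.I) * Complex.I =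
      2 * Real.pi * Complex.I * ∑ P ∈ S₁, r P := by
  classical
  set S := S₀ ∪ S₁ with hS
  have hU : Convex ℝ {s : ℂ | x₁ < s.re ∧ s.re < x₂} :=
    (convex_halfSpace_re_gt x₁).inter (convex_halfSpace_re_lt x₂)
  have hUo : IsOpen {s : ℂ | x₁ < s.re ∧ s.re < x₂} :=
    (isOpen_lt continuous_const Complex.continuous_re).inter
      (isOpen_lt Complex.continuous_re continuous_const)
  have hf' : ∀ s : ℂ, x₁ < s.re → s.re < x₂ → s ∉ S → DifferentiableAt ℂ f s := by
    intro s a b c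
    rw [hS, Finset.mem_union, not_or] at c
    exact hf s a b c.1 c.2
  obtain ⟨c, Φ, hΦ, hc⟩ := exists_primitive_off_poles hU hUo S (f := f)
    (fun s hs hsS => hf' s hs.1 hs.2 hsS) (fun P _ => hm P)
  set g : ℂ → ℂ := fun s => f s - ∑ P ∈ S, c P / (s - P) with hg
  set ln : ℝ → ℂ := fun t => (lam : ℂ) + t * Complex.I with hln
  have hlnC : ContDiff ℝ 1 ln :=
    contDiff_const.add (Complex.ofRealCLM.contDiff.mul contDiff_const)
  have hlnd : ∀ t, deriv ln t = Complex.I := by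
    intro t
    have : HasDerivAt ln (Complex.ofRealCLM 1 * Complex.I) t :=
      ((Complex.ofRealCLM.hasDerivAt (x := t)).mul_const Complex.I).const_add (lam : ℂ)
    rw [this.deriv]; simp
  have hlre : ∀ t, (ln t).re = lam := fun t => by simp [hln]
  -- the winding integrals of both curves
  set V : ℂ → ℂ := fun P => if P.re < lam then (Real.pi : ℂ) * Complex.I else -((Real.pi : ℂ) * Complex.I) with hV
  set W : ℂ → ℂ := fun P => if P ∈ S₁ then (Real.pi : ℂ) * Complex.I else V P with hW
  have hPre : ∀ P ∈ S, P.re ≠ lam := by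
    intro P hP
    rcases Finset.mem_union.1 hP with h | h
    · rcases h₀ P h with h | h
      · exact h.2.ne
      · exact h.2.ne'
    · exact (h₁ P h).2.ne'
  have hWt : ∀ P ∈ S, (∀ t, γ t ≠ P) ∧ Tendsto (fun R : ℝ => ∫ t in (-R)..R, deriv γ t / (γ t - P)) atTop
      (𝓝 (W P)) := by
    intro P hP
    rw [hW]; dsimp only
    split_ifs with h
    · exact (h₁ P h).1
    · rcases Finset.mem_union.1 hP with h' | h'
      · rcases h₀ P h' with h' | h'
        · rw [hV]; simp only [if_pos h'.2]; exact h'.1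
        · rw [hV]; simp only [if_neg h'.2.not_gt]; exact h'.1
      · exact absurd h' h
  have hlnP : ∀ P ∈ S, ∀ t, ln t ≠ P := fun P hP t h => hPre P hP (by rw [← h, hlre])
  have hγS : ∀ t, γ t ∉ S := fun t h => (hWt _ h).1 t rfl
  have hlnS : ∀ t, ln t ∉ S := fun t h => hlnP _ h t rfl
  -- Stated for a general curve so that it applies both to γ and to the vertical line.
  have gen : ∀ δ : ℝ → ℂ, ContDiff ℝ 1 δ → (∀ t, x₁ < (δ t).re ∧ (δ t).re < x₂) → (∀ t, δ t ∉ S) →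
      ∀ w : ℂ → ℂ, (∀ P ∈ S, Tendsto (fun R : ℝ => ∫ t in (-R)..R, deriv δ t / (δ t - P)) atTop (𝓝 (w P))) →
      Integrable (fun t => f (δ t) * deriv δ t) →
      Tendsto (fun R : ℝ => Φ (δ R) - Φ (δ (-R))) atTop
        (𝓝 ((∫ t, f (δ t) * deriv δ t) - ∑ P ∈ S, c P * w P)) := by
    intro δ hδ hδU hδS w hw hint
    have hcf : Continuous fun t => f (δ t) := continuous_iff_continuousAt.2 fun t =>
      ContinuousAt.comp_of_eq (hf' _ (hδU t).1 (hδU t).2 (hδS t)).continuousAt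
        hδ.continuous.continuousAt rfl
    have hne : ∀ P ∈ S, ∀ t, δ t - P ≠ 0 := fun P hP t h => hδS t (by rw [sub_eq_zero.1 h]; exact hP)
    have hcd : ∀ P ∈ S, Continuous fun t => deriv δ t / (δ t - P) := fun P hP =>
      (hδ.continuous_deriv le_rfl).div (hδ.continuous.sub continuous_const) (hne P hP)
    have hcg : Continuous fun t => g (δ t) := by
      refine hcf.sub (continuous_finsetSum _ fun P hP => ?_)
      exact continuous_const.div (hδ.continuous.sub continuous_const) (hne P hP)
    have e : ∀ R : ℝ, Φ (δ R) - Φ (δ (-R)) = (∫ t in (-R)..R, f (δ t) * deriv δ t) -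
        ∑ P ∈ S, c P * ∫ t in (-R)..R, deriv δ t / (δ t - P) := by
      intro R
      rw [← integral_comp_of_primitive hδ (g := g) (fun t => hΦ _ (hδU t) (hδS t)) hcg]
      simp only [← intervalIntegral.integral_const_mul]
      rw [← intervalIntegral.integral_finsetSum fun P hP =>
          ((hcd P hP).const_mul (c P)).intervalIntegrable _ _, ← intervalIntegral.integral_sub]
      · refine intervalIntegral.integral_congr fun t _ => ?_
        simp only [hg, sub_mul, Finset.sum_mul]
        congr 1
        refine Finset.sum_congr rfl fun P _ => ?_
        ring
      · exact (hcf.mul (hδ.continuous_deriv le_rfl)).intervalIntegrable _ _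
      · exact (continuous_finsetSum _ fun P hP => (hcd P hP).const_mul (c P)).intervalIntegrable _ _
    simp only [e]
    refine Tendsto.sub ?_ (tendsto_finsetSum _ fun P hP => (hw P hP).const_mul _)
    exact intervalIntegral_tendsto_integral hint tendsto_neg_atTop_atBot tendsto_id
  have t1 := gen γ hγ hγU hγS W (fun P hP => (hWt P hP).2) hi
  have t2 := gen ln hlnC (fun t => by rw [hlre]; exact hlam) hlnS V (fun P hP => by
    simp only [hlnd]; exact tendsto_integral_line_div (hPre P hP)) (by simpa only [hlnd] using hi')
  have hgv : VanishesInStrip g x₁ x₂ := hvan.sub (VanishesInStrip.sum_div_sub c S x₁ x₂)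
  have hΦ' : ∀ s : ℂ, x₁ < s.re → s.re < x₂ → (∑ P ∈ S, |P.im|) + 1 ≤ |s.im| → HasDerivAt Φ (g s) s := by
    intro s a b h
    refine hΦ s ⟨a, b⟩ fun hs => ?_
    have := Finset.single_le_sum (f := fun P : ℂ => |P.im|) (fun _ _ => abs_nonneg _) hs
    linarith
  have hσ : x₁ < σ ∧ σ < x₂ := by
    have := hγU |T|
    rw [hv |T| (by rw [abs_abs]; exact le_abs_self T)] at this
    simpa using this
  have t3 := tendsto_primitive_sub hΦ' hgv hσ hlam tendsto_abs_atTop_atTop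
  have t4 := tendsto_primitive_sub hΦ' hgv hσ hlam tendsto_abs_atBot_atTop
  have t5 := t3.sub (t4.comp tendsto_neg_atTop_atBot)
  rw [sub_zero] at t5
  have t6 := t1.sub t2
  have hlim := tendsto_nhds_unique (t6.congr' ?_) t5
  · simp only [hlnd] at hlim
    -- The unknown coefficients at poles outside S₁ drop out here, so nothing about them is needed.
    have hsum : ∑ P ∈ S, c P * W P - ∑ P ∈ S, c P * V P = 2 * Real.pi * Complex.I * ∑ P ∈ S₁, r P := by
      rw [← Finset.sum_sub_distrib, Finset.mul_sum]
      symm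
      refine (Finset.sum_subset_zero_on_sdiff Finset.subset_union_right ?_ ?_)
      · intro P hP
        rw [Finset.mem_sdiff] at hP
        simp only [hW, if_neg hP.2, sub_self]
      · intro P hP
        have hcr := hc P (Finset.mem_union_right _ hP) _ (hr P hP)
        simp only [hW, hV, if_pos hP, if_neg (h₁ P hP).2.not_gt, hcr]
        ring
    linear_combination hlim + hsum
  · filter_upwards [eventually_ge_atTop |T|] with R hR
    have hTR : T ≤ |R| := (le_abs_self T).trans (hR.trans (le_abs_self R))
    simp only [Function.comp, hln]
    rw [hv R hTR, hv (-R) (by rwa [abs_neg])]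
    ring

end Shift

/-! ### Growth of Gamma quotients in vertical strips -/

section Kernel

/-- The product of Gamma quotients in a Mellin–Barnes integral. -/
noncomputable def mbKernel {ι₁ ι₂ ι₃ ι₄ : Type} [Fintype ι₁] [Fintype ι₂] [Fintype ι₃] [Fintype ι₄]
    (α : ι₁ → ℂ) (β : ι₂ → ℂ) (ρ : ι₃ → ℂ) (τ : ι₄ → ℂ) (s : ℂ) : ℂ :=
  ((∏ i, Complex.Gamma (α i + s)) * ∏ i, Complex.Gamma (β i - s)) /
    ((∏ i, Complex.Gamma (ρ i + s)) * ∏ i, Complex.Gamma (τ i - s))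

theorem exists_prod_Gamma_vertical_bound {ι : Type} [Fintype ι] (α : ι → ℂ) {X : ℝ} (hX : 0 ≤ X) :
    ∃ C T : ℝ, 1 ≤ C ∧ 1 ≤ T ∧ ∀ x y : ℝ, |x| ≤ X → T ≤ |y| →
      ‖∏ i, Complex.Gamma (α i + (x + y * Complex.I))‖ ≤
        C * (|y| ^ ((Fintype.card ι : ℝ) * (x - 1 / 2) + (∑ i, α i).re) *
          Real.exp (-(Real.pi / 2 * Fintype.card ι * |y|))) ∧
      |y| ^ ((Fintype.card ι : ℝ) * (x - 1 / 2) + (∑ i, α i).re) *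
          Real.exp (-(Real.pi / 2 * Fintype.card ι * |y|)) ≤
        C * ‖∏ i, Complex.Gamma (α i + (x + y * Complex.I))‖ := by
  choose C T hC hT h using fun i => exists_Gamma_vertical_bound (α i) hX
  refine ⟨∏ i, C i, 1 + ∑ i, T i, ?_, ?_, fun x y hx hy => ?_⟩
  · exact Finset.one_le_prod fun i _ => hC i
  · have : 0 ≤ ∑ i, T i := Finset.sum_nonneg fun i _ => by linarith [hT i]
    linarith
  · have hT' : ∀ i, T i ≤ |y| := fun i => by
      have := Finset.single_le_sum (f := T) (fun i _ => by linarith [hT i]) (Finset.mem_univ i)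
      linarith
    have hs : 0 ≤ ∑ i, T i := Finset.sum_nonneg fun i _ => by linarith [hT i]
    have hy0 : 0 < |y| := by linarith
    have e : |y| ^ ((Fintype.card ι : ℝ) * (x - 1 / 2) + (∑ i, α i).re) *
          Real.exp (-(Real.pi / 2 * Fintype.card ι * |y|)) =
        ∏ i, (|y| ^ (x + (α i).re - 1 / 2) * Real.exp (-(Real.pi / 2 * |y|))) := by
      rw [Finset.prod_mul_distrib, ← Real.rpow_sum_of_pos hy0, ← Real.exp_sum]
      congr 2
      · rw [Complex.re_sum, Finset.sum_sub_distrib, Finset.sum_add_distrib]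
        simp; ring
      · simp; ring
    rw [e, norm_prod, ← Finset.prod_mul_distrib, ← Finset.prod_mul_distrib]
    have hE := Real.exp_pos (-(Real.pi / 2 * |y|))
    constructor
    · exact Finset.prod_le_prod (fun i _ => norm_nonneg _) fun i _ => (h i x y hx (hT' i)).1
    · exact Finset.prod_le_prod (fun i _ => mul_nonneg (Real.rpow_nonneg hy0.le _) hE.le)
        fun i _ => (h i x y hx (hT' i)).2

variable {ι₁ ι₂ ι₃ ι₄ : Type} [Fintype ι₁] [Fintype ι₂] [Fintype ι₃] [Fintype ι₄]

/-- Upper bounds for the numerator are divided by lower bounds for the denominator; the latter also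
show that the denominator does not vanish high up. The families with -s are evaluated at (-x, -y),
which reverses the sign of their contribution to the coefficient of x. -/
theorem exists_mbKernel_strip_bound (α : ι₁ → ℂ) (β : ι₂ → ℂ) (ρ : ι₃ → ℂ) (τ : ι₄ → ℂ)
    {X : ℝ} (hX : 0 ≤ X) : ∃ C T : ℝ, 1 ≤ C ∧ 1 ≤ T ∧ ∀ x y : ℝ, |x| ≤ X → T ≤ |y| →
      ‖mbKernel α β ρ τ (x + y * Complex.I)‖ ≤
        C * (|y| ^ (((Fintype.card ι₁ : ℝ) - Fintype.card ι₂ - Fintype.card ι₃ + Fintype.card ι₄) * x +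
            ((∑ i, α i) + (∑ i, β i) - (∑ i, ρ i) - ∑ i, τ i).re -
            ((Fintype.card ι₁ : ℝ) + Fintype.card ι₂ - Fintype.card ι₃ - Fintype.card ι₄) / 2) *
          Real.exp (-(Real.pi / 2 * ((Fintype.card ι₁ : ℝ) + Fintype.card ι₂ - Fintype.card ι₃ -
            Fintype.card ι₄) * |y|))) := by
  obtain ⟨C₁, T₁, hC₁, hT₁, h₁⟩ := exists_prod_Gamma_vertical_bound α hX
  obtain ⟨C₂, T₂, hC₂, hT₂, h₂⟩ := exists_prod_Gamma_vertical_bound β hX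
  obtain ⟨C₃, T₃, hC₃, hT₃, h₃⟩ := exists_prod_Gamma_vertical_bound ρ hX
  obtain ⟨C₄, T₄, hC₄, hT₄, h₄⟩ := exists_prod_Gamma_vertical_bound τ hX
  refine ⟨C₁ * C₂ * (C₃ * C₄), T₁ + T₂ + T₃ + T₄, ?_, by linarith, fun x y hx hy => ?_⟩
  · exact one_le_mul_of_one_le_of_one_le (one_le_mul_of_one_le_of_one_le hC₁ hC₂)
      (one_le_mul_of_one_le_of_one_le hC₃ hC₄)
  have hy0 : 0 < |y| := by linarith
  have a₁ := (h₁ x y hx (by linarith)).1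
  have a₂ := (h₂ (-x) (-y) (by rwa [abs_neg]) (by rw [abs_neg]; linarith)).1
  have a₃ := (h₃ x y hx (by linarith)).2
  have a₄ := (h₄ (-x) (-y) (by rwa [abs_neg]) (by rw [abs_neg]; linarith)).2
  have e : ((-x : ℝ) : ℂ) + ((-y : ℝ) : ℂ) * Complex.I = -((x : ℂ) + y * Complex.I) := by
    push_cast; ring
  simp only [e, ← sub_eq_add_neg, abs_neg] at a₂ a₄
  rw [mbKernel, norm_div, norm_mul, norm_mul]
  set P₁ := ‖∏ i, Complex.Gamma (α i + (x + y * Complex.I))‖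
  set P₂ := ‖∏ i, Complex.Gamma (β i - (x + y * Complex.I))‖
  set P₃ := ‖∏ i, Complex.Gamma (ρ i + (x + y * Complex.I))‖
  set P₄ := ‖∏ i, Complex.Gamma (τ i - (x + y * Complex.I))‖
  have key : |y| ^ (((Fintype.card ι₁ : ℝ) - Fintype.card ι₂ - Fintype.card ι₃ + Fintype.card ι₄) * x +
            ((∑ i, α i) + (∑ i, β i) - (∑ i, ρ i) - ∑ i, τ i).re -
            ((Fintype.card ι₁ : ℝ) + Fintype.card ι₂ - Fintype.card ι₃ - Fintype.card ι₄) / 2) *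
          Real.exp (-(Real.pi / 2 * ((Fintype.card ι₁ : ℝ) + Fintype.card ι₂ - Fintype.card ι₃ -
            Fintype.card ι₄) * |y|)) *
      ((|y| ^ ((Fintype.card ι₃ : ℝ) * (x - 1 / 2) + (∑ i, ρ i).re) *
          Real.exp (-(Real.pi / 2 * Fintype.card ι₃ * |y|))) *
        (|y| ^ ((Fintype.card ι₄ : ℝ) * (-x - 1 / 2) + (∑ i, τ i).re) *
          Real.exp (-(Real.pi / 2 * Fintype.card ι₄ * |y|)))) =
      (|y| ^ ((Fintype.card ι₁ : ℝ) * (x - 1 / 2) + (∑ i, α i).re) *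
          Real.exp (-(Real.pi / 2 * Fintype.card ι₁ * |y|))) *
        (|y| ^ ((Fintype.card ι₂ : ℝ) * (-x - 1 / 2) + (∑ i, β i).re) *
          Real.exp (-(Real.pi / 2 * Fintype.card ι₂ * |y|))) := by
    rw [mul_mul_mul_comm (_ ^ _) _ (_ ^ _) _, mul_mul_mul_comm (_ ^ _) _ (_ * _) _,
      mul_mul_mul_comm (_ ^ _) _ (_ ^ _) _]
    simp only [← Real.rpow_add hy0, ← Real.exp_add]
    congr 2
    · simp only [Complex.sub_re, Complex.add_re]; ring
    · ring
  set B₁ := |y| ^ ((Fintype.card ι₁ : ℝ) * (x - 1 / 2) + (∑ i, α i).re) *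
          Real.exp (-(Real.pi / 2 * Fintype.card ι₁ * |y|))
  set B₂ := |y| ^ ((Fintype.card ι₂ : ℝ) * (-x - 1 / 2) + (∑ i, β i).re) *
          Real.exp (-(Real.pi / 2 * Fintype.card ι₂ * |y|))
  have hB₃ : 0 < |y| ^ ((Fintype.card ι₃ : ℝ) * (x - 1 / 2) + (∑ i, ρ i).re) *
          Real.exp (-(Real.pi / 2 * Fintype.card ι₃ * |y|)) :=
    mul_pos (Real.rpow_pos_of_pos hy0 _) (Real.exp_pos _)
  have hB₄ : 0 < |y| ^ ((Fintype.card ι₄ : ℝ) * (-x - 1 / 2) + (∑ i, τ i).re) *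
          Real.exp (-(Real.pi / 2 * Fintype.card ι₄ * |y|)) :=
    mul_pos (Real.rpow_pos_of_pos hy0 _) (Real.exp_pos _)
  set B₃ := |y| ^ ((Fintype.card ι₃ : ℝ) * (x - 1 / 2) + (∑ i, ρ i).re) *
          Real.exp (-(Real.pi / 2 * Fintype.card ι₃ * |y|))
  set B₄ := |y| ^ ((Fintype.card ι₄ : ℝ) * (-x - 1 / 2) + (∑ i, τ i).re) *
          Real.exp (-(Real.pi / 2 * Fintype.card ι₄ * |y|))
  set B := |y| ^ (((Fintype.card ι₁ : ℝ) - Fintype.card ι₂ - Fintype.card ι₃ + Fintype.card ι₄) * x +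
            ((∑ i, α i) + (∑ i, β i) - (∑ i, ρ i) - ∑ i, τ i).re -
            ((Fintype.card ι₁ : ℝ) + Fintype.card ι₂ - Fintype.card ι₃ - Fintype.card ι₄) / 2) *
          Real.exp (-(Real.pi / 2 * ((Fintype.card ι₁ : ℝ) + Fintype.card ι₂ - Fintype.card ι₃ -
            Fintype.card ι₄) * |y|))
  have hP₁ : 0 ≤ P₁ := norm_nonneg _
  have hP₂ : 0 ≤ P₂ := norm_nonneg _
  have hP₃ : 0 < P₃ := by
    have : 0 < C₃ * P₃ := hB₃.trans_le a₃
    exact pos_of_mul_pos_right this (by linarith)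
  have hP₄ : 0 < P₄ := by
    have : 0 < C₄ * P₄ := hB₄.trans_le a₄
    exact pos_of_mul_pos_right this (by linarith)
  have hB : 0 < B := mul_pos (Real.rpow_pos_of_pos hy0 _) (Real.exp_pos _)
  rw [div_le_iff₀ (mul_pos hP₃ hP₄)]
  calc P₁ * P₂ ≤ (C₁ * B₁) * (C₂ * B₂) := by gcongr
    _ = C₁ * C₂ * (B * (B₃ * B₄)) := by rw [key]; ring
    _ ≤ C₁ * C₂ * (B * ((C₃ * P₃) * (C₄ * P₄))) := by gcongr
    _ = _ := by ring

end Kernel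

/-! ### Series of quotients of rising factorials -/

section RiseQuotient

/-- Quotient of products of rising factorials. -/
noncomputable def riseQuot {ι κ : Type} [Fintype ι] [Fintype κ] (u : ι → ℂ) (v : κ → ℂ) (w : ℂ)
    (k : ℕ) : ℂ := (∏ i, rise (w + u i) k) / ∏ j, rise (w + v j) k

theorem riseQuot_add {ι κ : Type} [Fintype ι] [Fintype κ] (u : ι → ℂ) (v : κ → ℂ) (w : ℂ)
    (m k : ℕ) : riseQuot u v w (m + k) = riseQuot u v w m * riseQuot u v (w + m) k := by
  simp only [riseQuot, rise_add, Finset.prod_mul_distrib, div_mul_div_comm, add_right_comm]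

theorem exists_prod_rise_bound {ι : Type} [Fintype ι] (u : ι → ℂ) : ∃ C L : ℝ, 1 ≤ C ∧ 1 ≤ L ∧
    ∀ w : ℂ, 1 ≤ w.re → L ≤ ‖w‖ → ∀ k : ℕ,
      ‖∏ i, rise (w + u i) k‖ ≤ C * ((‖w + k‖ / ‖w‖) ^ (∑ i, u i).re * ‖rise w k‖ ^ Fintype.card ι) ∧
      (‖w + k‖ / ‖w‖) ^ (∑ i, u i).re * ‖rise w k‖ ^ Fintype.card ι ≤ C * ‖∏ i, rise (w + u i) k‖ := by
  have hX : (0 : ℝ) ≤ ∑ i, ‖u i‖ := Finset.sum_nonneg fun _ _ => norm_nonneg _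
  obtain ⟨C, hC, h⟩ := exists_rise_ratio_bound hX
  refine ⟨C ^ Fintype.card ι, 2 * (∑ i, ‖u i‖) + 2, one_le_pow₀ hC, by linarith, fun w hw hwL k => ?_⟩
  have hu : ∀ i, ‖u i‖ ≤ ∑ i, ‖u i‖ := fun i =>
    Finset.single_le_sum (f := fun i => ‖u i‖) (fun _ _ => norm_nonneg _) (Finset.mem_univ i)
  have hw0 : 0 < ‖w‖ := by linarith
  have hwk : 0 < ‖w + k‖ / ‖w‖ := div_pos (hw0.trans_le (norm_add_natCast_ge (by linarith) k)) hw0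
  have e : (‖w + k‖ / ‖w‖) ^ (∑ i, u i).re * ‖rise w k‖ ^ Fintype.card ι =
      ∏ i, ((‖w + k‖ / ‖w‖) ^ (u i).re * ‖rise w k‖) := by
    rw [Finset.prod_mul_distrib, ← Real.rpow_sum_of_pos hwk, Complex.re_sum]; simp
  have e2 : ∀ z : ℝ, C ^ Fintype.card ι * z = (∏ _i : ι, C) * z := fun z => by simp
  rw [e, e2, e2, norm_prod, ← Finset.prod_mul_distrib, ← Finset.prod_mul_distrib]
  constructor
  · refine Finset.prod_le_prod (fun i _ => norm_nonneg _) fun i _ => ?_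
    rw [← mul_assoc]; exact (h (u i) w (hu i) hw hwL k).1
  · exact Finset.prod_le_prod (fun i _ => mul_nonneg (Real.rpow_nonneg hwk.le _) (norm_nonneg _))
      fun i _ => (h (u i) w (hu i) hw hwL k).2

theorem norm_rise_pos {w : ℂ} (hw : 1 ≤ w.re) (k : ℕ) : 0 < ‖rise w k‖ := by
  rw [rise, norm_prod]
  refine Finset.prod_pos fun i _ => ?_
  have := natCast_le_norm_add hw i
  have : (0 : ℝ) ≤ i := Nat.cast_nonneg i
  linarith

theorem factorial_le_norm_rise {w : ℂ} (hw : 1 ≤ w.re) (k : ℕ) : (k.factorial : ℝ) ≤ ‖rise w k‖ := by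
  rw [← Finset.prod_range_add_one_eq_factorial, rise, norm_prod]
  push_cast
  exact Finset.prod_le_prod (fun i _ => by positivity) fun i _ => natCast_le_norm_add hw i

/-- The surplus of factors leaves a power of |rise w k| ≥ k!, which decides convergence when the
counts differ; with equal counts only a power of |w+k|/|w| remains. -/
theorem exists_riseQuot_bound {ι κ : Type} [Fintype ι] [Fintype κ] (u : ι → ℂ) (v : κ → ℂ) :
    ∃ C L : ℝ, 1 ≤ C ∧ 1 ≤ L ∧ ∀ w : ℂ, 1 ≤ w.re → L ≤ ‖w‖ → ∀ k : ℕ,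
      ‖riseQuot u v w k‖ ≤ C * ((‖w + k‖ / ‖w‖) ^ ((∑ i, u i) - ∑ j, v j).re *
        (‖rise w k‖ ^ Fintype.card ι / ‖rise w k‖ ^ Fintype.card κ)) := by
  obtain ⟨C₁, L₁, hC₁, hL₁, h₁⟩ := exists_prod_rise_bound u
  obtain ⟨C₂, L₂, hC₂, hL₂, h₂⟩ := exists_prod_rise_bound v
  refine ⟨C₁ * C₂, L₁ + L₂, one_le_mul_of_one_le_of_one_le hC₁ hC₂, by linarith,
    fun w hw hwL k => ?_⟩
  have a₁ := (h₁ w hw (by linarith) k).1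
  have a₂ := (h₂ w hw (by linarith) k).2
  have hw0 : 0 < ‖w‖ := by linarith
  have hq : 0 < ‖w + k‖ / ‖w‖ := div_pos (hw0.trans_le (norm_add_natCast_ge (by linarith) k)) hw0
  have hr := norm_rise_pos hw k
  rw [riseQuot, norm_div, Complex.sub_re, Real.rpow_sub hq]
  set q := ‖w + k‖ / ‖w‖
  have b₁ : 0 < q ^ (∑ i, u i).re := Real.rpow_pos_of_pos hq _
  have b₂ : 0 < q ^ (∑ i, v i).re := Real.rpow_pos_of_pos hq _
  set N := ‖∏ i, rise (w + u i) k‖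
  set D := ‖∏ i, rise (w + v i) k‖
  have hD : 0 < D := by
    have : 0 < C₂ * D := lt_of_lt_of_le (mul_pos b₂ (pow_pos hr _)) a₂
    exact pos_of_mul_pos_right this (by linarith)
  rw [div_mul_div_comm, ← mul_div_assoc, div_le_div_iff₀ hD (by positivity)]
  calc _ ≤ (C₁ * (q ^ (∑ i, u i).re * ‖rise w k‖ ^ Fintype.card ι)) * (C₂ * D) := by gcongr
    _ = _ := by ring

theorem summable_succ_pow_mul_geometric (p : ℕ) {y : ℝ} (hy : 0 ≤ y) (hy1 : y < 1) :
    Summable fun k : ℕ => ((k : ℝ) + 1) ^ p * y ^ k := by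
  rcases hy.eq_or_lt with rfl | hy0
  · refine summable_of_ne_finset_zero (s := {0}) fun k hk => ?_
    rw [zero_pow (by simpa using hk), mul_zero]
  · have h := (summable_nat_add_iff 1).2 (summable_pow_mul_geometric_of_norm_lt_one (R := ℝ) p
      (r := y) (by rwa [Real.norm_of_nonneg hy]))
    refine (h.mul_left y⁻¹).congr fun k => ?_
    push_cast; field_simp; ring

theorem summable_succ_pow_mul_div_factorial (p : ℕ) {y : ℝ} (hy : 0 ≤ y) :
    Summable fun k : ℕ => ((k : ℝ) + 1) ^ p * (y ^ k / (k.factorial : ℝ)) := by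
  refine Summable.of_nonneg_of_le (fun k => by positivity) (fun k => ?_)
    ((summable_succ_pow_mul_geometric p (y := 1 / 2) (by norm_num) (by norm_num)).mul_left (Real.exp (2 * y)))
  have h := Real.pow_div_factorial_le_exp (2 * y) (by linarith) k
  have e : y ^ k / (k.factorial : ℝ) = (1 / 2) ^ k * ((2 * y) ^ k / k.factorial) := by
    rw [mul_pow, ← mul_div_assoc, ← mul_assoc, ← mul_pow]; norm_num
  rw [e]
  calc _ = (2 * y) ^ k / k.factorial * (((k : ℝ) + 1) ^ p * (1 / 2) ^ k) := by ring
    _ ≤ _ := by gcongr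

/-- The hypothesis under which `∑ riseQuot u v w k * exp (-ℓ k)` converges. -/
def RatioCond {ι κ : Type} [Fintype ι] [Fintype κ] (u : ι → ℂ) (v : κ → ℂ) (ℓ : ℂ) : Prop :=
  Fintype.card ι < Fintype.card κ ∨ (Fintype.card ι = Fintype.card κ ∧
    (0 < ℓ.re ∨ (ℓ.re = 0 ∧ ((∑ i, u i) - ∑ j, v j).re < -1)))

theorem rpow_le_succ_pow {q r : ℝ} {k : ℕ} (h1 : 1 ≤ q) (h2 : q ≤ k + 1) :
    q ^ r ≤ ((k : ℝ) + 1) ^ ⌈|r|⌉₊ := by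
  calc q ^ r ≤ q ^ ((⌈|r|⌉₊ : ℕ) : ℝ) :=
        Real.rpow_le_rpow_of_exponent_le h1 ((le_abs_self r).trans (Nat.le_ceil _))
    _ = q ^ ⌈|r|⌉₊ := Real.rpow_natCast _ _
    _ ≤ _ := by gcongr

theorem norm_add_natCast_div_le {w : ℂ} (hw : 1 ≤ ‖w‖) (k : ℕ) : ‖w + k‖ / ‖w‖ ≤ k + 1 := by
  rw [div_le_iff₀ (by linarith)]
  have := norm_add_le w (k : ℂ)
  rw [Complex.norm_natCast] at this
  have hk : (0 : ℝ) ≤ k := Nat.cast_nonneg k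
  nlinarith

/-- The constant must not depend on w, since it provides the dominating function when the contour
goes to -∞. The terms are controlled by factorials, by a geometric series, or by a power below -1 in
the boundary case. -/
theorem RatioCond.exists_bound {ι κ : Type} [Fintype ι] [Fintype κ] {u : ι → ℂ} {v : κ → ℂ} {ℓ : ℂ}
    (h : RatioCond u v ℓ) : ∃ C L : ℝ, 1 ≤ L ∧ ∀ w : ℂ, L ≤ w.re →
      (∀ k : ℕ, ‖riseQuot u v w k * Complex.exp (-(ℓ * k))‖ ≤ C) ∧
      Summable fun k : ℕ => riseQuot u v w k * Complex.exp (-(ℓ * k)) := by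
  obtain ⟨C, L, hC, hL, hb⟩ := exists_riseQuot_bound u v
  have hexp : ∀ k : ℕ, ‖Complex.exp (-(ℓ * k))‖ = Real.exp (-ℓ.re) ^ k := by
    intro k
    rw [Complex.norm_exp, ← Real.exp_nat_mul]
    congr 1; simp; ring
  set r := ((∑ i, u i) - ∑ j, v j).re with hr
  set y := Real.exp (-ℓ.re) with hy
  have hy0 : 0 < y := Real.exp_pos _
  have hwn : ∀ w : ℂ, L ≤ w.re → L ≤ ‖w‖ := fun w h => h.trans (Complex.re_le_norm w)
  have hq1 : ∀ w : ℂ, L ≤ w.re → ∀ k : ℕ, 1 ≤ ‖w + k‖ / ‖w‖ := fun w h k => by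
    have := hwn w h
    rw [le_div_iff₀ (by linarith), one_mul]; exact norm_add_natCast_ge (by linarith) k
  have hq2 : ∀ w : ℂ, L ≤ w.re → ∀ k : ℕ, ‖w + k‖ / ‖w‖ ≤ k + 1 := fun w h k =>
    norm_add_natCast_div_le (hL.trans (hwn w h)) k
  have geom : ∀ b : ℕ → ℝ, Summable b → (∀ k, 0 ≤ b k) →
      (∀ w : ℂ, L ≤ w.re → ∀ k : ℕ, ‖riseQuot u v w k * Complex.exp (-(ℓ * k))‖ ≤ b k) →
      ∃ C L : ℝ, 1 ≤ L ∧ ∀ w : ℂ, L ≤ w.re →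
      (∀ k : ℕ, ‖riseQuot u v w k * Complex.exp (-(ℓ * k))‖ ≤ C) ∧
      Summable fun k : ℕ => riseQuot u v w k * Complex.exp (-(ℓ * k)) := by
    intro b hbs hb0 hbb
    refine ⟨∑' k, b k, L, hL, fun w hw => ⟨fun k => (hbb w hw k).trans (hbs.le_tsum k fun j _ => hb0 j), ?_⟩⟩
    exact Summable.of_norm_bounded hbs (hbb w hw)
  rcases h with h | ⟨h, h' | ⟨h', h''⟩⟩
  · refine geom (fun k => C * (((k : ℝ) + 1) ^ ⌈|r|⌉₊ * (y ^ k / (k.factorial : ℝ))))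
      ((summable_succ_pow_mul_div_factorial _ hy0.le).mul_left C) (fun k => by positivity) ?_
    intro w hw k
    rw [norm_mul, hexp]
    have hrp := norm_rise_pos (hL.trans hw) k
    have hrf := factorial_le_norm_rise (hL.trans hw) k
    have hf1 : (1 : ℝ) ≤ k.factorial := by exact_mod_cast k.factorial_pos
    have hdiv : ‖rise w k‖ ^ Fintype.card ι / ‖rise w k‖ ^ Fintype.card κ ≤ 1 / k.factorial := by
      rw [div_le_div_iff₀ (by positivity) (by positivity), one_mul]
      calc _ ≤ ‖rise w k‖ ^ Fintype.card ι * ‖rise w k‖ := by gcongr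
        _ = ‖rise w k‖ ^ (Fintype.card ι + 1) := (pow_succ _ _).symm
        _ ≤ _ := pow_le_pow_right₀ (hf1.trans hrf) h
    have hqr : (‖w + k‖ / ‖w‖) ^ r ≤ ((k : ℝ) + 1) ^ ⌈|r|⌉₊ :=
      rpow_le_succ_pow (hq1 w hw k) (hq2 w hw k)
    calc _ ≤ C * ((‖w + k‖ / ‖w‖) ^ r * (‖rise w k‖ ^ Fintype.card ι / ‖rise w k‖ ^ Fintype.card κ)) * y ^ k := by
          gcongr; exact hb w (hL.trans hw) (hwn w hw) k
      _ ≤ C * (((k : ℝ) + 1) ^ ⌈|r|⌉₊ * (1 / k.factorial)) * y ^ k := by gcongr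
      _ = _ := by ring
  · have hy1 : y < 1 := Real.exp_lt_one_iff.2 (by linarith)
    refine geom (fun k => C * (((k : ℝ) + 1) ^ ⌈|r|⌉₊ * y ^ k))
      ((summable_succ_pow_mul_geometric _ hy0.le hy1).mul_left C) (fun k => by positivity) ?_
    intro w hw k
    rw [norm_mul, hexp]
    have hrp := norm_rise_pos (hL.trans hw) k
    have hqr : (‖w + k‖ / ‖w‖) ^ r ≤ ((k : ℝ) + 1) ^ ⌈|r|⌉₊ :=
      rpow_le_succ_pow (hq1 w hw k) (hq2 w hw k)
    have hb' := hb w (hL.trans hw) (hwn w hw) k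
    rw [h, div_self (by positivity), mul_one] at hb'
    calc _ ≤ C * ((‖w + k‖ / ‖w‖) ^ r) * y ^ k := by gcongr
      _ ≤ C * (((k : ℝ) + 1) ^ ⌈|r|⌉₊) * y ^ k := by gcongr
      _ = _ := by ring
  -- In the boundary case the sum is not claimed to be bounded uniformly in w; only the single terms
  -- are, since |w+k|/|w| ≥ 1 is raised to a negative power.
  · have hy1 : y = 1 := by rw [hy, h']; simp
    have hmain : ∀ w : ℂ, L ≤ w.re → ∀ k : ℕ,
        ‖riseQuot u v w k * Complex.exp (-(ℓ * k))‖ ≤ C * (‖w + k‖ / ‖w‖) ^ r := by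
      intro w hw k
      have hrp := norm_rise_pos (hL.trans hw) k
      have hb' := hb w (hL.trans hw) (hwn w hw) k
      rw [h, div_self (by positivity), mul_one] at hb'
      rw [norm_mul, hexp, hy1, one_pow, mul_one]
      exact hb'
    refine ⟨C, L, hL, fun w hw => ⟨fun k => (hmain w hw k).trans ?_, ?_⟩⟩
    · have : (‖w + k‖ / ‖w‖) ^ r ≤ 1 :=
        Real.rpow_le_one_of_one_le_of_nonpos (hq1 w hw k) (by linarith)
      nlinarith
    · have hs : Summable fun k : ℕ => C * (‖w‖⁻¹ ^ r * ((k : ℝ) + 1) ^ r) := by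
        have := (summable_nat_add_iff 1).2 (Real.summable_nat_rpow.2 h'')
        push_cast at this
        exact (this.mul_left _).mul_left C
      refine Summable.of_norm_bounded hs fun k => (hmain w hw k).trans ?_
      have hw0 : 0 < ‖w‖ := by linarith [hwn w hw]
      have hk := natCast_le_norm_add (hL.trans hw) k
      have hk0 : (0 : ℝ) < k + 1 := by positivity
      rw [div_eq_inv_mul, Real.mul_rpow (by positivity) (norm_nonneg _)]
      have : ‖w + k‖ ^ r ≤ ((k : ℝ) + 1) ^ r := Real.rpow_le_rpow_of_nonpos hk0 hk (by linarith)
      have h3 : 0 ≤ ‖w‖⁻¹ ^ r := Real.rpow_nonneg (by positivity) _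
      gcongr

/-- Splitting off the first M factors moves w to w + M, into the half-plane where the uniform bound
applies. -/
theorem RatioCond.summable {ι κ : Type} [Fintype ι] [Fintype κ] {u : ι → ℂ} {v : κ → ℂ} {ℓ : ℂ}
    (h : RatioCond u v ℓ) (w : ℂ) :
    Summable fun k : ℕ => riseQuot u v w k * Complex.exp (-(ℓ * k)) := by
  obtain ⟨C, L, hL, hb⟩ := h.exists_bound
  obtain ⟨M, hM⟩ := exists_nat_ge (L - w.re)
  rw [← summable_nat_add_iff M]
  have h1 := (hb (w + M) (by simp; linarith)).2.mul_left
    (riseQuot u v w M * Complex.exp (-(ℓ * M)))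
  refine h1.congr fun k => ?_
  rw [add_comm k M, riseQuot_add]
  have : Complex.exp (-(ℓ * ((M + k : ℕ) : ℂ))) = Complex.exp (-(ℓ * M)) * Complex.exp (-(ℓ * k)) := by
    rw [← Complex.exp_add]; push_cast; ring_nf
  rw [this]; ring

end RiseQuotient

/-! ### Decay along vertical lines -/

section Decay
open Filter Topology MeasureTheory

/-- Integrable decay at `±i∞`, uniformly in every vertical strip. -/
def DecaysInStrips (f : ℂ → ℂ) : Prop := ∀ X : ℝ, 0 ≤ X → ∃ C T η : ℝ, 1 ≤ T ∧ 1 < η ∧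
  ∀ x y : ℝ, |x| ≤ X → T ≤ |y| → ‖f (x + y * Complex.I)‖ ≤ C * |y| ^ (-η)

theorem integrable_of_rpow_decay {φ : ℝ → ℂ} (hφ : Continuous φ) {C T η : ℝ} (hT : 1 ≤ T)
    (hη : 1 < η) (h : ∀ t : ℝ, T ≤ |t| → ‖φ t‖ ≤ C * |t| ^ (-η)) : Integrable φ := by
  have hg : Integrable fun t : ℝ => (1 + ‖t‖) ^ (-η) :=
    integrable_one_add_norm (by simpa using hη)
  have hO : ∀ l : Filter ℝ, Tendsto (fun t : ℝ => |t|) l atTop →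
      φ =O[l] fun t : ℝ => (1 + ‖t‖) ^ (-η) := by
    intro l hl
    refine Asymptotics.IsBigO.of_bound (|C| * 2 ^ η) ?_
    filter_upwards [hl.eventually_ge_atTop T] with t ht
    have ht1 : 1 ≤ |t| := hT.trans ht
    have ht0 : 0 < |t| := by linarith
    rw [Real.norm_of_nonneg (Real.rpow_nonneg (by positivity) _), Real.norm_eq_abs]
    refine (h t ht).trans ?_
    have h1 : (1 + |t|) ^ η ≤ 2 ^ η * |t| ^ η := by
      rw [← Real.mul_rpow (by norm_num) ht0.le]
      exact Real.rpow_le_rpow (by positivity) (by linarith) (by linarith)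
    have h2 : |t| ^ (-η) ≤ 2 ^ η * (1 + |t|) ^ (-η) := by
      rw [Real.rpow_neg ht0.le, Real.rpow_neg (by positivity), inv_le_iff_one_le_mul₀ (by positivity)]
      have : 0 < (1 + |t|) ^ η := by positivity
      rw [mul_right_comm, ← div_eq_mul_inv, one_le_div this]
      exact h1
    have h3 : 0 ≤ |t| ^ (-η) := Real.rpow_nonneg ht0.le _
    calc C * |t| ^ (-η) ≤ |C| * |t| ^ (-η) := by gcongr; exact le_abs_self C
      _ ≤ |C| * (2 ^ η * (1 + |t|) ^ (-η)) := by gcongr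
      _ = _ := by ring
  exact hφ.locallyIntegrable.integrable_of_isBigO_atBot_atTop (hO _ tendsto_abs_atBot_atTop)
    (hg.integrableAtFilter _) (hO _ tendsto_abs_atTop_atTop) (hg.integrableAtFilter _)

theorem DecaysInStrips.vanishesInStrip {f : ℂ → ℂ} (hf : DecaysInStrips f) (x₁ x₂ : ℝ) :
    VanishesInStrip f x₁ x₂ := by
  intro ε hε
  obtain ⟨C, T, η, hT, hη, h⟩ := hf (max |x₁| |x₂|) (le_max_of_le_left (abs_nonneg _))
  have hlim : Tendsto (fun y : ℝ => C * y ^ (-η)) atTop (𝓝 (C * 0)) :=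
    (tendsto_rpow_neg_atTop (by linarith)).const_mul C
  rw [mul_zero] at hlim
  obtain ⟨R, hR⟩ := eventually_atTop.1 (hlim.eventually_le_const hε)
  refine ⟨max R T, fun s h1 h2 h3 => ?_⟩
  rw [← Complex.re_add_im s]
  refine (h s.re s.im (abs_le_max_abs_abs h1.le h2.le) ((le_max_right _ _).trans h3)).trans ?_
  exact hR _ ((le_max_left _ _).trans h3)

theorem DecaysInStrips.integrable_comp {f : ℂ → ℂ} (hf : DecaysInStrips f) {γ : ℝ → ℂ}
    (hγ : ContDiff ℝ 1 γ) {σ T : ℝ}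
    (hv : ∀ t : ℝ, T ≤ |t| → γ t = (σ : ℂ) + (t : ℂ) * Complex.I)
    (hc : Continuous fun t => f (γ t)) : Integrable fun t => f (γ t) * deriv γ t := by
  obtain ⟨C, T', η, hT', hη, h⟩ := hf |σ| (abs_nonneg _)
  refine integrable_of_rpow_decay (hc.mul (hγ.continuous_deriv le_rfl)) (C := C)
    (T := max T' (|T| + 1)) (hT'.trans (le_max_left _ _)) hη fun t ht => ?_
  have ht1 : |T| + 1 ≤ |t| := (le_max_right _ _).trans ht
  have ht2 : T < |t| := by linarith [le_abs_self T]
  have hd : deriv γ t = Complex.I := by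
    have he : γ =ᶠ[𝓝 t] fun t : ℝ => (σ : ℂ) + (t : ℂ) * Complex.I := by
      have : ∀ᶠ u in 𝓝 t, T < |u| := continuous_abs.continuousAt.eventually_const_lt ht2
      filter_upwards [this] with u hu using hv u hu.le
    rw [he.deriv_eq]
    have : HasDerivAt (fun t : ℝ => (σ : ℂ) + (t : ℂ) * Complex.I) (Complex.ofRealCLM 1 * Complex.I) t :=
      ((Complex.ofRealCLM.hasDerivAt (x := t)).mul_const Complex.I).const_add (σ : ℂ)
    rw [this.deriv]; simp
  rw [norm_mul, hd, Complex.norm_I, mul_one, hv t ht2.le]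
  exact h σ t le_rfl ((le_max_left _ _).trans ht)

theorem exists_rpow_mul_exp_le (E : ℝ) {c : ℝ} (hc : 0 < c) :
    ∃ C : ℝ, ∀ y : ℝ, 1 ≤ y → y ^ E * Real.exp (-(c * y)) ≤ C := by
  refine ⟨(⌈|E|⌉₊).factorial / c ^ ⌈|E|⌉₊, fun y hy => ?_⟩
  have h1 : y ^ E ≤ y ^ ⌈|E|⌉₊ := by
    rw [← Real.rpow_natCast]
    exact Real.rpow_le_rpow_of_exponent_le hy ((le_abs_self E).trans (Nat.le_ceil _))
  have h2 := Real.pow_div_factorial_le_exp (c * y) (by positivity) ⌈|E|⌉₊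
  rw [div_le_iff₀ (by positivity), mul_pow] at h2
  rw [Real.exp_neg, ← div_eq_mul_inv, div_le_div_iff₀ (Real.exp_pos _) (by positivity)]
  calc _ ≤ y ^ ⌈|E|⌉₊ * c ^ ⌈|E|⌉₊ := by gcongr
    _ ≤ _ := by linarith

variable {ι₁ ι₂ ι₃ ι₄ : Type} [Fintype ι₁] [Fintype ι₂] [Fintype ι₃] [Fintype ι₄]

/-- The exponential contributes at most exp(|Im ℓ||y|), strictly less than the decay of the Gamma
quotient; the surplus absorbs every power of |y|, so the exponent 2 is an arbitrary choice. -/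
theorem decaysInStrips_mbKernel_of_abs_im_lt (α : ι₁ → ℂ) (β : ι₂ → ℂ) (ρ : ι₃ → ℂ) (τ : ι₄ → ℂ)
    {ℓ : ℂ} (hℓ : |ℓ.im| < Real.pi / 2 * ((Fintype.card ι₁ : ℝ) + Fintype.card ι₂ -
      Fintype.card ι₃ - Fintype.card ι₄)) :
    DecaysInStrips fun s => mbKernel α β ρ τ s * Complex.exp (ℓ * s) := by
  intro X hX
  obtain ⟨C, T, hC, hT, h⟩ := exists_mbKernel_strip_bound α β ρ τ hX
  set ω : ℝ := (Fintype.card ι₁ : ℝ) - Fintype.card ι₂ - Fintype.card ι₃ + Fintype.card ι₄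
  set N : ℝ := (Fintype.card ι₁ : ℝ) + Fintype.card ι₂ - Fintype.card ι₃ - Fintype.card ι₄
  set κ : ℝ := ((∑ i, α i) + (∑ i, β i) - (∑ i, ρ i) - ∑ i, τ i).re
  obtain ⟨D, hD⟩ := exists_rpow_mul_exp_le (|ω| * X + κ - N / 2 + 2) (sub_pos.2 hℓ)
  refine ⟨C * Real.exp (|ℓ.re| * X) * D, T, 2, hT, one_lt_two, fun x y hx hy => ?_⟩
  have hy1 : 1 ≤ |y| := hT.trans hy
  have hy0 : 0 < |y| := by linarith
  have hexp : ‖Complex.exp (ℓ * (x + y * Complex.I))‖ ≤ Real.exp (|ℓ.re| * X) * Real.exp (|ℓ.im| * |y|) := by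
    rw [Complex.norm_exp, ← Real.exp_add]
    refine Real.exp_le_exp.2 ?_
    have e : (ℓ * (x + y * Complex.I)).re = ℓ.re * x - ℓ.im * y := by simp
    have h1 : ℓ.re * x ≤ |ℓ.re| * X := (le_abs_self _).trans (by rw [abs_mul]; gcongr)
    have h2 : -(ℓ.im * y) ≤ |ℓ.im| * |y| := (neg_le_abs _).trans (abs_mul _ _).le
    rw [e]; linarith
  have hpow : |y| ^ (ω * x + κ - N / 2) ≤ |y| ^ (|ω| * X + κ - N / 2) := by
    refine Real.rpow_le_rpow_of_exponent_le hy1 ?_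
    have : ω * x ≤ |ω| * X := (le_abs_self _).trans (by rw [abs_mul]; gcongr)
    linarith
  have hDy := hD |y| hy1
  have e2 : |y| ^ (|ω| * X + κ - N / 2) = |y| ^ (|ω| * X + κ - N / 2 + 2) * |y| ^ (-2 : ℝ) := by
    rw [← Real.rpow_add hy0]; congr 1; ring
  have e3 : Real.exp (-(Real.pi / 2 * N * |y|)) * Real.exp (|ℓ.im| * |y|) =
      Real.exp (-((Real.pi / 2 * N - |ℓ.im|) * |y|)) := by
    rw [← Real.exp_add]; congr 1; ring
  have p2 : 0 ≤ |y| ^ (-2 : ℝ) := Real.rpow_nonneg hy0.le _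
  rw [norm_mul]
  calc _ ≤ (C * (|y| ^ (ω * x + κ - N / 2) * Real.exp (-(Real.pi / 2 * N * |y|)))) *
        (Real.exp (|ℓ.re| * X) * Real.exp (|ℓ.im| * |y|)) := by
        gcongr
        exact h x y hx hy
    _ ≤ (C * (|y| ^ (|ω| * X + κ - N / 2) * Real.exp (-(Real.pi / 2 * N * |y|)))) *
        (Real.exp (|ℓ.re| * X) * Real.exp (|ℓ.im| * |y|)) := by gcongr
    _ = C * Real.exp (|ℓ.re| * X) * (|y| ^ (|ω| * X + κ - N / 2 + 2) *
          Real.exp (-((Real.pi / 2 * N - |ℓ.im|) * |y|))) * |y| ^ (-2 : ℝ) := by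
        rw [e2, ← e3]; ring
    _ ≤ _ := by gcongr

/-- Balance removes x from the exponent of |y|, so one power of |y|, below -1 by assumption, serves
in all strips even if there is no exponential decay. -/
theorem decaysInStrips_mbKernel_of_balanced (α : ι₁ → ℂ) (β : ι₂ → ℂ) (ρ : ι₃ → ℂ) (τ : ι₄ → ℂ)
    {ℓ : ℂ} (hℓ : ℓ.im = 0)
    (hbal : Fintype.card ι₁ + Fintype.card ι₄ = Fintype.card ι₂ + Fintype.card ι₃)
    (hN : (0 : ℝ) ≤ (Fintype.card ι₁ : ℝ) + Fintype.card ι₂ - Fintype.card ι₃ - Fintype.card ι₄)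
    (hκ : ((∑ i, α i) + (∑ i, β i) - (∑ i, ρ i) - ∑ i, τ i).re -
      ((Fintype.card ι₁ : ℝ) + Fintype.card ι₂ - Fintype.card ι₃ - Fintype.card ι₄) / 2 < -1) :
    DecaysInStrips fun s => mbKernel α β ρ τ s * Complex.exp (ℓ * s) := by
  intro X hX
  obtain ⟨C, T, hC, hT, h⟩ := exists_mbKernel_strip_bound α β ρ τ hX
  have hω : (Fintype.card ι₁ : ℝ) - Fintype.card ι₂ - Fintype.card ι₃ + Fintype.card ι₄ = 0 := by
    have : (Fintype.card ι₁ : ℝ) + Fintype.card ι₄ = Fintype.card ι₂ + Fintype.card ι₃ := by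
      exact_mod_cast hbal
    linarith
  rw [hω] at h
  set N : ℝ := (Fintype.card ι₁ : ℝ) + Fintype.card ι₂ - Fintype.card ι₃ - Fintype.card ι₄
  set κ : ℝ := ((∑ i, α i) + (∑ i, β i) - (∑ i, ρ i) - ∑ i, τ i).re
  refine ⟨C * Real.exp (|ℓ.re| * X), T, -(κ - N / 2), hT, by linarith, fun x y hx hy => ?_⟩
  have hy1 : 1 ≤ |y| := hT.trans hy
  have hy0 : 0 < |y| := by linarith
  have hexp : ‖Complex.exp (ℓ * (x + y * Complex.I))‖ ≤ Real.exp (|ℓ.re| * X) := by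
    rw [Complex.norm_exp]
    refine Real.exp_le_exp.2 ?_
    have e : (ℓ * (x + y * Complex.I)).re = ℓ.re * x - ℓ.im * y := by simp
    have h1 : ℓ.re * x ≤ |ℓ.re| * X := (le_abs_self _).trans (by rw [abs_mul]; gcongr)
    rw [e, hℓ]; linarith
  have h1 : Real.exp (-(Real.pi / 2 * N * |y|)) ≤ 1 := by
    rw [Real.exp_le_one_iff]
    have := Real.pi_pos
    have : 0 ≤ Real.pi / 2 * N * |y| := by positivity
    linarith
  have hp : 0 ≤ |y| ^ (κ - N / 2) := Real.rpow_nonneg hy0.le _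
  rw [norm_mul, neg_neg]
  have hxy := h x y hx hy
  rw [zero_mul, zero_add] at hxy
  calc _ ≤ (C * (|y| ^ (κ - N / 2) * Real.exp (-(Real.pi / 2 * N * |y|)))) * Real.exp (|ℓ.re| * X) := by gcongr
    _ ≤ (C * (|y| ^ (κ - N / 2) * 1)) * Real.exp (|ℓ.re| * X) := by gcongr
    _ = _ := by ring

end Decay

/-! ### Analyticity and recurrence of the kernel -/

section KernelAnalytic
open Filter Topology

variable {ι₁ ι₂ ι₃ ι₄ : Type} [Fintype ι₁] [Fintype ι₂] [Fintype ι₃] [Fintype ι₄]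

theorem differentiableAt_Gamma_add {a s : ℂ} (h : ¬ IsNonposInt (a + s)) :
    DifferentiableAt ℂ (fun s => Complex.Gamma (a + s)) s :=
  DifferentiableAt.comp s (Complex.differentiableAt_Gamma _ fun m hm => h ⟨m, hm⟩)
    (by fun_prop : DifferentiableAt ℂ (fun s => a + s) s)

theorem differentiableAt_Gamma_sub {a s : ℂ} (h : ¬ IsNonposInt (a - s)) :
    DifferentiableAt ℂ (fun s => Complex.Gamma (a - s)) s :=
  DifferentiableAt.comp s (Complex.differentiableAt_Gamma _ fun m hm => h ⟨m, hm⟩)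
    (by fun_prop : DifferentiableAt ℂ (fun s => a - s) s)

theorem differentiable_Gamma_add_inv (a : ℂ) :
    Differentiable ℂ fun s => (Complex.Gamma (a + s))⁻¹ :=
  Complex.differentiable_one_div_Gamma.comp (by fun_prop : Differentiable ℂ fun s => a + s)

theorem differentiable_Gamma_sub_inv (a : ℂ) :
    Differentiable ℂ fun s => (Complex.Gamma (a - s))⁻¹ :=
  Complex.differentiable_one_div_Gamma.comp (by fun_prop : Differentiable ℂ fun s => a - s)

/-- Reciprocals of Γ are entire, so the denominator creates no poles. The default values Γ = 0 at
the poles and 0⁻¹ = 0 give exactly the convention 1/Γ = 0 there. -/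
theorem mbKernel_eq (α : ι₁ → ℂ) (β : ι₂ → ℂ) (ρ : ι₃ → ℂ) (τ : ι₄ → ℂ) (s : ℂ) :
    mbKernel α β ρ τ s = ((∏ i, Complex.Gamma (α i + s)) * ∏ i, Complex.Gamma (β i - s)) *
      ((∏ i, (Complex.Gamma (ρ i + s))⁻¹) * ∏ i, (Complex.Gamma (τ i - s))⁻¹) := by
  rw [mbKernel, div_eq_mul_inv, mul_inv, Finset.prod_inv_distrib, Finset.prod_inv_distrib]

theorem differentiable_prod_Gamma_inv (ρ : ι₃ → ℂ) (τ : ι₄ → ℂ) : Differentiable ℂ fun s =>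
    (∏ i, (Complex.Gamma (ρ i + s))⁻¹) * ∏ i, (Complex.Gamma (τ i - s))⁻¹ :=
  (Differentiable.fun_finsetProd fun i _ => differentiable_Gamma_add_inv (ρ i)).mul
    (Differentiable.fun_finsetProd fun i _ => differentiable_Gamma_sub_inv (τ i))

theorem differentiableAt_mbKernel {α : ι₁ → ℂ} {β : ι₂ → ℂ} (ρ : ι₃ → ℂ) (τ : ι₄ → ℂ) {s : ℂ}
    (hα : ∀ i, ¬ IsNonposInt (α i + s)) (hβ : ∀ i, ¬ IsNonposInt (β i - s)) :
    DifferentiableAt ℂ (mbKernel α β ρ τ) s := by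
  have e : mbKernel α β ρ τ = fun s => _ := funext fun s => mbKernel_eq α β ρ τ s
  rw [e]
  exact ((DifferentiableAt.fun_finsetProd fun i _ => differentiableAt_Gamma_add (hα i)).mul
    (DifferentiableAt.fun_finsetProd fun i _ => differentiableAt_Gamma_sub (hβ i))).mul
    (differentiable_prod_Gamma_inv ρ τ s)

theorem meromorphicAt_mbKernel (α : ι₁ → ℂ) (β : ι₂ → ℂ) (ρ : ι₃ → ℂ) (τ : ι₄ → ℂ) (P : ℂ) :
    MeromorphicAt (mbKernel α β ρ τ) P := by
  have h1 : ∀ a : ℂ, MeromorphicAt (fun s => Complex.Gamma (a + s)) P := fun a =>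
    (Meromorphic.Gamma _).comp_analyticAt (f := Complex.Gamma) (g := fun s => a + s) (by fun_prop)
  have h2 : ∀ a : ℂ, MeromorphicAt (fun s => Complex.Gamma (a - s)) P := fun a =>
    (Meromorphic.Gamma _).comp_analyticAt (f := Complex.Gamma) (g := fun s => a - s) (by fun_prop)
  exact ((MeromorphicAt.fun_prod fun i _ => h1 _).mul (MeromorphicAt.fun_prod fun i _ => h2 _)).div
    ((MeromorphicAt.fun_prod fun i _ => h1 _).mul (MeromorphicAt.fun_prod fun i _ => h2 _))

theorem rise_sub_natCast (z : ℂ) (k : ℕ) : rise (z - k) k = (-1) ^ k * rise (1 - z) k := by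
  have hc : (-1 : ℂ) ^ k = ∏ _i ∈ Finset.range k, (-1 : ℂ) := by simp
  rw [rise, ← Finset.prod_range_reflect, rise, hc, ← Finset.prod_mul_distrib]
  refine Finset.prod_congr rfl fun i hi => ?_
  have hi' := Finset.mem_range.1 hi
  have : ((k - 1 - i : ℕ) : ℂ) = k - 1 - i := by
    rw [Nat.sub_sub, Nat.cast_sub (by omega)]; push_cast; ring
  rw [this]; ring

theorem rise_one (n : ℕ) : rise 1 n = n.factorial := by
  rw [rise, ← Finset.prod_range_add_one_eq_factorial]
  push_cast
  exact Finset.prod_congr rfl fun i _ => add_comm _ _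

theorem rise_ne_zero {z : ℂ} (h : ¬ IsNonposInt z) (k : ℕ) : rise z k ≠ 0 := by
  rw [rise, Finset.prod_ne_zero_iff]
  exact fun i _ h0 => h ⟨i, eq_neg_of_add_eq_zero_left h0⟩

theorem Gamma_add_natCast {z : ℂ} (h : ¬ IsNonposInt z) (k : ℕ) :
    Complex.Gamma (z + k) = rise z k * Complex.Gamma z :=
  Gamma_add_nat_eq z k fun i _ h0 => h ⟨i, eq_neg_of_add_eq_zero_left h0⟩

theorem neg_one_pow_mul_self (k : ℕ) : (-1 : ℂ) ^ k * (-1) ^ k = 1 := by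
  rw [← mul_pow]; simp

theorem Gamma_sub_natCast {z : ℂ} (h : ¬ IsNonposInt (1 - z)) (k : ℕ) :
    Complex.Gamma (z - k) = (-1) ^ k * Complex.Gamma z / rise (1 - z) k := by
  have hr := rise_ne_zero h k
  have h1 := Gamma_add_nat_eq (z - k) k (fun i hi h0 => h ⟨k - 1 - i, by
    have : ((k - 1 - i : ℕ) : ℂ) = k - 1 - i := by
      rw [Nat.sub_sub, Nat.cast_sub (by omega)]; push_cast; ring
    rw [this]; linear_combination -h0⟩)
  rw [sub_add_cancel, ← rise, rise_sub_natCast] at h1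
  rw [eq_div_iff hr, h1]
  linear_combination (-(Complex.Gamma (z - k)) * rise (1 - z) k) * neg_one_pow_mul_self k

/-- No condition on z is needed: if the rising factorial vanishes, z - k is a pole of Γ and both
sides are zero. -/
theorem Gamma_sub_natCast_inv (z : ℂ) (k : ℕ) :
    (Complex.Gamma (z - k))⁻¹ = (-1) ^ k * rise (1 - z) k * (Complex.Gamma z)⁻¹ := by
  by_cases h : ∀ i < k, z - k + i ≠ 0
  · have h1 := Gamma_add_nat_eq (z - k) k h
    have hr : rise (z - k) k ≠ 0 := by
      rw [rise, Finset.prod_ne_zero_iff]; exact fun i hi => h i (Finset.mem_range.1 hi)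
    rw [sub_add_cancel, ← rise] at h1
    rw [h1, ← rise_sub_natCast, mul_inv, mul_inv_cancel_left₀ hr]
  · push Not at h
    obtain ⟨i, hi, h0⟩ := h
    have hr : rise (z - k) k = 0 := Finset.prod_eq_zero (Finset.mem_range.2 hi) h0
    rw [← rise_sub_natCast, hr, eq_neg_of_add_eq_zero_left h0, Complex.Gamma_neg_nat_eq_zero]
    simp

theorem Gamma_add_natCast_inv {z : ℂ} (h : ¬ IsNonposInt z) (k : ℕ) :
    (Complex.Gamma (z + k))⁻¹ = (Complex.Gamma z)⁻¹ / rise z k := by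
  rw [Gamma_add_natCast h, mul_inv, div_eq_mul_inv, mul_comm]

/-- Upper parameters of the coefficient recursion of the left residue series. -/
def upperShift (β : ι₂ → ℂ) (ρ : ι₃ → ℂ) : ι₂ ⊕ ι₃ → ℂ := Sum.elim β fun i => 1 - ρ i

/-- Lower parameters of the coefficient recursion of the left residue series. -/
def lowerShift (α : ι₁ → ℂ) (τ : ι₄ → ℂ) : ι₁ ⊕ ι₄ → ℂ := Sum.elim (fun i => 1 - α i) τ

/-- This makes the shifted line integrals accessible: on the line moved by k the kernel is the old
kernel times a quotient that `RatioCond` controls. -/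
theorem mbKernel_sub_natCast {α : ι₁ → ℂ} {β : ι₂ → ℂ} (ρ : ι₃ → ℂ) {τ : ι₄ → ℂ} {s : ℂ}
    (hα : ∀ i, ¬ IsNonposInt (1 - (α i + s))) (hβ : ∀ i, ¬ IsNonposInt (β i - s))
    (hτ : ∀ i, ¬ IsNonposInt (τ i - s)) (k : ℕ) :
    mbKernel α β ρ τ (s - k) = ((-1) ^ (k * (Fintype.card ι₁ + Fintype.card ι₃))) *
      (mbKernel α β ρ τ s * riseQuot (upperShift β ρ) (lowerShift α τ) (-s) k) := by
  have e1 : ∀ i, Complex.Gamma (α i + (s - k)) =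
      (-1) ^ k * Complex.Gamma (α i + s) / rise (1 - (α i + s)) k := fun i => by
    rw [← Gamma_sub_natCast (hα i)]; congr 1; ring
  have e2 : ∀ i, Complex.Gamma (β i - (s - k)) = rise (β i - s) k * Complex.Gamma (β i - s) := fun i => by
    rw [← Gamma_add_natCast (hβ i)]; congr 1; ring
  have e3 : ∀ i, (Complex.Gamma (ρ i + (s - k)))⁻¹ =
      (-1) ^ k * rise (1 - (ρ i + s)) k * (Complex.Gamma (ρ i + s))⁻¹ := fun i => by
    rw [← Gamma_sub_natCast_inv]; congr 2; ring
  have e4 : ∀ i, (Complex.Gamma (τ i - (s - k)))⁻¹ = (Complex.Gamma (τ i - s))⁻¹ / rise (τ i - s) k := fun i => by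
    rw [← Gamma_add_natCast_inv (hτ i)]; congr 2; ring
  rw [mbKernel_eq, mbKernel_eq]
  simp only [e1, e2, e3, e4, riseQuot, upperShift, lowerShift, Fintype.prod_sum_type, Sum.elim_inl,
    Sum.elim_inr, Finset.prod_mul_distrib, Finset.prod_div_distrib, Finset.prod_const,
    Finset.card_univ]
  have a1 : ∀ z : ℂ, -s + (1 - z) = 1 - (z + s) := fun z => by ring
  have a2 : ∀ z : ℂ, -s + z = z - s := fun z => by ring
  simp only [a1]
  simp only [a2]
  rw [mul_add, pow_add, pow_mul, pow_mul]
  ring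

end KernelAnalytic

/-! ### Residues at the left poles -/

section Residues
open Filter Topology

variable {ι₁ ι₂ ι₃ ι₄ : Type} [Fintype ι₁] [Fintype ι₂] [Fintype ι₃] [Fintype ι₄] [DecidableEq ι₁]

/-- The residue of `mbKernel α β ρ τ s * exp (ℓ s)` at the simple pole `s = -α μ - n`. -/
noncomputable def mbResidue (α : ι₁ → ℂ) (β : ι₂ → ℂ) (ρ : ι₃ → ℂ) (τ : ι₄ → ℂ) (ℓ : ℂ)
    (μ : ι₁) (n : ℕ) : ℂ :=
  (-1) ^ n / (n.factorial : ℂ) *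
    (((∏ i ∈ Finset.univ.erase μ, Complex.Gamma (α i - α μ - n)) *
        ∏ i, Complex.Gamma (β i + α μ + n)) *
      ((∏ i, (Complex.Gamma (ρ i - α μ - n))⁻¹) * ∏ i, (Complex.Gamma (τ i + α μ + n))⁻¹)) *
    Complex.exp (ℓ * (-α μ - n))

/-- The functional equation gives (s+a+n)Γ(a+s) = Γ(a+s+n+1)/(a+s)_n, and the right side is
continuous at the pole, with value 1/((-1)^n n!). -/
theorem tendsto_add_mul_Gamma (a : ℂ) (n : ℕ) :
    Tendsto (fun s : ℂ => (s - (-a - n)) * Complex.Gamma (a + s)) (𝓝[≠] (-a - n))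
      (𝓝 ((-1) ^ n / (n.factorial : ℂ))) := by
  have hev : ∀ᶠ s in 𝓝[≠] (-a - n : ℂ), ∀ i < n + 1, a + s + i ≠ 0 := by
    have h1 : ∀ i ∈ Finset.range n, ∀ᶠ s in 𝓝[≠] (-a - n : ℂ), a + s + i ≠ 0 := by
      intro i hi
      have hc : ContinuousAt (fun s : ℂ => a + s + i) (-a - n) := by fun_prop
      refine (hc.eventually_ne ?_).filter_mono nhdsWithin_le_nhds
      intro h0
      have h2 : (i : ℂ) = n := by linear_combination h0
      exact (Finset.mem_range.1 hi).ne (by exact_mod_cast h2)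
    filter_upwards [(Finset.eventually_all _).2 h1, self_mem_nhdsWithin] with s hs hs' i hi
    rcases Nat.lt_succ_iff_lt_or_eq.1 hi with h | h
    · exact hs i (Finset.mem_range.2 h)
    · rw [h]; intro h0
      have : s = -a - n := by linear_combination h0
      exact hs' this
  have e : ∀ᶠ s in 𝓝[≠] (-a - n : ℂ), Complex.Gamma (a + s + (n + 1 : ℕ)) / rise (a + s) n =
      (s - (-a - n)) * Complex.Gamma (a + s) := by
    filter_upwards [hev] with s hs
    have hr : rise (a + s) n ≠ 0 := by
      rw [rise, Finset.prod_ne_zero_iff]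
      exact fun i hi => hs i (by have := Finset.mem_range.1 hi; omega)
    rw [Gamma_add_nat_eq _ _ hs, ← rise, rise_succ, div_eq_iff hr]
    ring
  refine Tendsto.congr' e ?_
  have hval : rise (a + (-a - n)) n = (-1) ^ n * n.factorial := by
    have : a + (-a - n) = 0 - n := by ring
    rw [this, rise_sub_natCast, sub_zero, rise_one]
  have hc1 : ContinuousAt (fun s : ℂ => Complex.Gamma (a + s + (n + 1 : ℕ))) (-a - n) := by
    have : a + (-a - n) + ((n + 1 : ℕ) : ℂ) = 1 := by push_cast; ring
    refine ContinuousAt.comp_of_eq (y := 1) (g := Complex.Gamma) ?_ (by fun_prop) this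
    exact Complex.differentiableAt_Gamma_one.continuousAt
  have hc2 : ContinuousAt (fun s : ℂ => rise (a + s) n) (-a - n) := by
    unfold rise; fun_prop
  have hf : ((-1 : ℂ) ^ n * n.factorial) ≠ 0 :=
    mul_ne_zero (pow_ne_zero _ (by norm_num)) (by exact_mod_cast n.factorial_ne_zero)
  have hc := hc1.div hc2 (by rw [hval]; exact hf)
  have ht := hc.tendsto
  have hv2 : Complex.Gamma (a + (-a - n) + (n + 1 : ℕ)) / rise (a + (-a - n)) n =
      (-1) ^ n / (n.factorial : ℂ) := by
    have : a + (-a - n) + ((n + 1 : ℕ) : ℂ) = 1 := by push_cast; ring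
    rw [hval, this, Complex.Gamma_one, div_eq_div_iff hf (by exact_mod_cast n.factorial_ne_zero)]
    linear_combination (-(n.factorial : ℂ)) * neg_one_pow_mul_self n
  simp only [Pi.div_apply] at ht
  rw [hv2] at ht
  exact ht.mono_left nhdsWithin_le_nhds

theorem tendsto_sub_mul_mbKernel {α : ι₁ → ℂ} {β : ι₂ → ℂ} (ρ : ι₃ → ℂ) (τ : ι₄ → ℂ) (ℓ : ℂ)
    {μ : ι₁} {n : ℕ} (hα : ∀ i, i ≠ μ → ¬ IsNonposInt (α i - α μ - n))
    (hβ : ∀ i, ¬ IsNonposInt (β i + α μ + n)) :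
    Tendsto (fun s => (s - (-α μ - n)) * (mbKernel α β ρ τ s * Complex.exp (ℓ * s)))
      (𝓝[≠] (-α μ - n)) (𝓝 (mbResidue α β ρ τ ℓ μ n)) := by
  have hc : ContinuousAt (fun s => (((∏ i ∈ Finset.univ.erase μ, Complex.Gamma (α i + s)) *
        ∏ i, Complex.Gamma (β i - s)) *
      ((∏ i, (Complex.Gamma (ρ i + s))⁻¹) * ∏ i, (Complex.Gamma (τ i - s))⁻¹)) *
      Complex.exp (ℓ * s)) (-α μ - n) := by
    refine DifferentiableAt.continuousAt (𝕜 := ℂ) ?_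
    refine ((DifferentiableAt.mul ?_ ?_).mul (differentiable_prod_Gamma_inv ρ τ _)).mul (by fun_prop)
    · refine DifferentiableAt.fun_finsetProd fun i hi => differentiableAt_Gamma_add ?_
      convert hα i (Finset.ne_of_mem_erase hi) using 2; ring
    · refine DifferentiableAt.fun_finsetProd fun i hi => differentiableAt_Gamma_sub ?_
      convert hβ i using 2; ring
  have h := (tendsto_add_mul_Gamma (α μ) n).mul (hc.tendsto.mono_left nhdsWithin_le_nhds)
  have e : (-1) ^ n / (n.factorial : ℂ) *
      ((((∏ i ∈ Finset.univ.erase μ, Complex.Gamma (α i + (-α μ - n))) *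
        ∏ i, Complex.Gamma (β i - (-α μ - n))) *
      ((∏ i, (Complex.Gamma (ρ i + (-α μ - n)))⁻¹) * ∏ i, (Complex.Gamma (τ i - (-α μ - n)))⁻¹)) *
      Complex.exp (ℓ * (-α μ - n))) = mbResidue α β ρ τ ℓ μ n := by
    rw [mbResidue, ← mul_assoc]
    have a1 : ∀ z : ℂ, z + (-α μ - n) = z - α μ - n := fun z => by ring
    have a2 : ∀ z : ℂ, z - (-α μ - n) = z + α μ + n := fun z => by ring
    simp only [a1, a2]
  rw [e] at h
  refine h.congr fun s => ?_
  rw [mbKernel_eq, ← Finset.mul_prod_erase _ _ (Finset.mem_univ μ)]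
  ring

/-- The residues obey the same recurrence as the kernel, now based at w = α_μ. The factor of index μ
in `lowerShift` is (1)_n = n!, and the sign (-1)^n of the residue takes the place of its missing
sign. -/
theorem mbResidue_eq {α : ι₁ → ℂ} {β : ι₂ → ℂ} (ρ : ι₃ → ℂ) {τ : ι₄ → ℂ} (ℓ : ℂ) {μ : ι₁}
    (hα : ∀ i, i ≠ μ → ¬ IsInt (α i - α μ)) (hβ : ∀ i, ¬ IsNonposInt (β i + α μ))
    (hτ : ∀ i, ¬ IsNonposInt (τ i + α μ)) (n : ℕ) :
    mbResidue α β ρ τ ℓ μ n = (-1) ^ (n * (Fintype.card ι₁ + Fintype.card ι₃)) *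
      (mbResidue α β ρ τ ℓ μ 0 * (riseQuot (upperShift β ρ) (lowerShift α τ) (α μ) n *
        Complex.exp (-(ℓ * n)))) := by
  have e1 : ∀ i ∈ Finset.univ.erase μ, Complex.Gamma (α i - α μ - n) =
      (-1) ^ n * Complex.Gamma (α i - α μ) / rise (α μ + (1 - α i)) n := fun i hi => by
    have hint : ¬ IsNonposInt (1 - (α i - α μ)) := by
      rintro ⟨m, hm⟩
      exact hα i (Finset.ne_of_mem_erase hi) ⟨m + 1, by push_cast; linear_combination -hm⟩
    rw [Gamma_sub_natCast hint]; congr 2; ring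
  have e2 : ∀ i, Complex.Gamma (β i + α μ + n) = rise (α μ + β i) n * Complex.Gamma (β i + α μ) :=
    fun i => by rw [Gamma_add_natCast (hβ i), add_comm (β i)]
  have e3 : ∀ i, (Complex.Gamma (ρ i - α μ - n))⁻¹ =
      (-1) ^ n * rise (α μ + (1 - ρ i)) n * (Complex.Gamma (ρ i - α μ))⁻¹ := fun i => by
    rw [Gamma_sub_natCast_inv]; congr 3; ring
  have e4 : ∀ i, (Complex.Gamma (τ i + α μ + n))⁻¹ =
      (Complex.Gamma (τ i + α μ))⁻¹ / rise (α μ + τ i) n := fun i => by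
    rw [Gamma_add_natCast_inv (hτ i), add_comm (τ i)]
  have e5 : Complex.exp (ℓ * (-α μ - n)) = Complex.exp (ℓ * (-α μ)) * Complex.exp (-(ℓ * n)) := by
    rw [← Complex.exp_add]; ring_nf
  have hD : ∏ i, rise (α μ + (1 - α i)) n =
      n.factorial * ∏ i ∈ Finset.univ.erase μ, rise (α μ + (1 - α i)) n := by
    rw [← Finset.mul_prod_erase _ _ (Finset.mem_univ μ)]
    congr 1
    rw [← rise_one]; congr 1; ring
  have hsgn : ((-1 : ℂ) ^ n) ^ Fintype.card ι₁ = (-1) ^ n * ∏ _i ∈ Finset.univ.erase μ, (-1 : ℂ) ^ n := by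
    rw [Finset.mul_prod_erase _ (fun _ => (-1 : ℂ) ^ n) (Finset.mem_univ μ)]
    simp
  rw [mbResidue, mbResidue, Finset.prod_congr rfl e1]
  simp only [e2, e3, e4, e5, riseQuot, upperShift, lowerShift, Fintype.prod_sum_type, Sum.elim_inl,
    Sum.elim_inr, Finset.prod_mul_distrib, Finset.prod_div_distrib, Nat.cast_zero, sub_zero, add_zero,
    pow_zero, Nat.factorial_zero, Nat.cast_one, div_one, one_mul]
  rw [hD, mul_add, pow_add, pow_mul, pow_mul, hsgn, Finset.prod_const, Finset.prod_const,
    Finset.card_univ]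
  ring

end Residues

/-! ### Slater's theorem -/

section Slater
open Filter Topology MeasureTheory

variable {ι₁ ι₂ ι₃ ι₄ : Type} [Fintype ι₁] [Fintype ι₂] [Fintype ι₃] [Fintype ι₄] [DecidableEq ι₁]

theorem not_isLeftOf_and_isRightOf {γ : ℝ → ℂ} {P : ℂ} (h : IsLeftOf γ P) (h' : IsRightOf γ P) :
    False := by
  have h0 := tendsto_nhds_unique h.2 h'.2
  have : (Real.pi : ℂ) * Complex.I = 0 := by linear_combination h0 / 2
  simp [Real.pi_ne_zero] at this

theorem exists_abs_re_le {γ : ℝ → ℂ} (hγ : Continuous γ) {σ T : ℝ}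
    (hv : ∀ t : ℝ, T ≤ |t| → γ t = (σ : ℂ) + (t : ℂ) * Complex.I) : ∃ B : ℝ, ∀ t, |(γ t).re| ≤ B := by
  obtain ⟨B, hB⟩ := (isCompact_Icc (a := -|T|) (b := |T|)).exists_bound_of_continuousOn
    (Complex.continuous_re.comp hγ).continuousOn
  refine ⟨max B |σ|, fun t => ?_⟩
  by_cases ht : T ≤ |t|
  · rw [hv t ht]; simp
  · refine (hB t (abs_le.1 ?_)).trans (le_max_left _ _)
    linarith [le_abs_self T, not_le.1 ht]

/-- Only countably many values are forbidden. It supplies vertical lines that miss all poles,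
whatever their integer translate. -/
theorem exists_gt_sub_ne_int {ι : Type} [Finite ι] (r : ι → ℝ) (B : ℝ) :
    ∃ L, B < L ∧ ∀ (i : ι) (n : ℤ), L - r i ≠ n := by
  have hcount : (Set.range fun p : ι × ℤ => r p.1 + p.2).Countable := Set.countable_range _
  obtain ⟨L, hL, hBL⟩ := (hcount.dense_compl ℝ).exists_gt B
  exact ⟨L, hBL, fun i n h => hL ⟨(i, n), by simp only; linarith⟩⟩

/-- **Slater's theorem**: closing a Mellin–Barnes contour to the left. -/
theorem slater_left {α : ι₁ → ℂ} {β : ι₂ → ℂ} {ρ : ι₃ → ℂ} {τ : ι₄ → ℂ} {ℓ : ℂ} {γ : ℝ → ℂ}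
    (hγ : ContDiff ℝ 1 γ) {σ T : ℝ}
    (hv : ∀ t : ℝ, T ≤ |t| → γ t = (σ : ℂ) + (t : ℂ) * Complex.I)
    (hα : ∀ i (n : ℕ), IsLeftOf γ (-α i - n)) (hβ : ∀ i (n : ℕ), IsRightOf γ (β i + n))
    (hαα : ∀ i i', i ≠ i' → ¬ IsInt (α i - α i')) (hτ : ∀ i i', ¬ IsNonposInt (τ i + α i'))
    (hdec : DecaysInStrips fun s => mbKernel α β ρ τ s * Complex.exp (ℓ * s))
    (hratio : RatioCond (upperShift β ρ) (lowerShift α τ) ℓ) :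
    (∀ i, Summable fun n => mbResidue α β ρ τ ℓ i n) ∧
      ∫ t, mbKernel α β ρ τ (γ t) * Complex.exp (ℓ * γ t) * deriv γ t =
        2 * Real.pi * Complex.I * ∑ i, ∑' n, mbResidue α β ρ τ ℓ i n := by
  -- Otherwise a left pole would coincide with a right pole, although the contour separates them.
  have hβα : ∀ i j (n : ℕ), ¬ IsNonposInt (β i + α j + n) := by
    rintro i j n ⟨m, hm⟩
    refine not_isLeftOf_and_isRightOf (hα j n) (P := -α j - n) ?_
    have := hβ i m
    rwa [show β i + m = -α j - n by linear_combination hm] at this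
  have hβα0 : ∀ i j, ¬ IsNonposInt (β i + α j) := fun i j => by simpa using hβα i j 0
  have hsum : ∀ i, Summable fun n => mbResidue α β ρ τ ℓ i n := by
    intro i
    have h1 := ((hratio.summable (α i)).mul_left (mbResidue α β ρ τ ℓ i 0)).norm
    refine Summable.of_norm (h1.congr fun n => ?_)
    rw [mbResidue_eq ρ ℓ (fun j hj => hαα j i hj) (fun j => hβα0 j i) (fun j => hτ j i) n, norm_mul,
      norm_mul _ (_ * _)]
    simp
  refine ⟨hsum, ?_⟩
  set f : ℂ → ℂ := fun s => mbKernel α β ρ τ s * Complex.exp (ℓ * s) with hf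
  obtain ⟨B, hB⟩ := exists_abs_re_le hγ.continuous hv
  obtain ⟨C, L₀, hL₀, hbd⟩ := hratio.exists_bound
  -- L is so large that all right poles and the points τ_i + n lie to the right of Re s = -L and
  -- that the uniform ratio bound holds on that line. No line Re s = -(L+k) meets a left pole.
  obtain ⟨L, hL, hLα⟩ := exists_gt_sub_ne_int (fun i => (α i).re)
    (L₀ + (∑ i, |(β i).re|) + (∑ i, |(τ i).re|))
  have hβs : ∀ i, |(β i).re| ≤ ∑ i, |(β i).re| := fun i =>
    Finset.single_le_sum (f := fun i => |(β i).re|) (fun _ _ => abs_nonneg _) (Finset.mem_univ i)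
  have hτs : ∀ i, |(τ i).re| ≤ ∑ i, |(τ i).re| := fun i =>
    Finset.single_le_sum (f := fun i => |(τ i).re|) (fun _ _ => abs_nonneg _) (Finset.mem_univ i)
  have hβ0 : 0 ≤ ∑ i, |(β i).re| := Finset.sum_nonneg fun _ _ => abs_nonneg _
  have hτ0 : 0 ≤ ∑ i, |(τ i).re| := Finset.sum_nonneg fun _ _ => abs_nonneg _
  have hβL : ∀ i, 0 < (β i).re + L := fun i => by
    have := hβs i; have := neg_abs_le (β i).re; linarith
  have hτL : ∀ i, 0 < (τ i).re + L := fun i => by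
    have := hτs i; have := neg_abs_le (τ i).re; linarith
  have hdiff : ∀ s, (∀ i, ¬ IsNonposInt (α i + s)) → (∀ i, ¬ IsNonposInt (β i - s)) →
      DifferentiableAt ℂ f s := fun s h1 h2 =>
    (differentiableAt_mbKernel ρ τ h1 h2).mul (by fun_prop)
  have npos : ∀ z : ℂ, 0 < z.re → ¬ IsNonposInt z := by
    rintro z hz ⟨m, hm⟩
    rw [hm] at hz
    simp at hz
    have : (0 : ℝ) ≤ m := Nat.cast_nonneg m
    linarith
  -- the shifted vertical lines
  have hlineα : ∀ (k : ℕ) (t : ℝ) (i : ι₁), ∀ n : ℤ, α i + (((-(L + k) : ℝ) : ℂ) + t * Complex.I) ≠ n := by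
    intro k t i n h
    have := congrArg Complex.re h
    simp at this
    refine hLα i (-n - k) ?_
    push_cast; linarith
  have hlineβ : ∀ (k : ℕ) (t : ℝ) (i : ι₂), ¬ IsNonposInt (β i - (((-(L + k) : ℝ) : ℂ) + t * Complex.I)) := by
    intro k t i
    refine npos _ ?_
    simp
    have := hβL i
    have : (0 : ℝ) ≤ k := Nat.cast_nonneg k
    linarith
  have hlined : ∀ (k : ℕ) (t : ℝ), DifferentiableAt ℂ f (((-(L + k) : ℝ) : ℂ) + t * Complex.I) :=
    fun k t => hdiff _ (fun i => by
      rintro ⟨m, hm⟩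
      exact hlineα k t i (-m) (by rw [hm]; push_cast; rfl)) (hlineβ k t)
  have hlnC : ∀ lam : ℝ, ContDiff ℝ 1 fun t : ℝ => ((lam : ℂ) + t * Complex.I) := fun lam =>
    contDiff_const.add (Complex.ofRealCLM.contDiff.mul contDiff_const)
  have hlinec : ∀ k : ℕ, Continuous fun t : ℝ => f (((-(L + k) : ℝ) : ℂ) + t * Complex.I) := fun k =>
    continuous_iff_continuousAt.2 fun t =>
      ContinuousAt.comp_of_eq (hlined k t).continuousAt (hlnC _).continuous.continuousAt rfl
  have hlnd : ∀ (lam t : ℝ), deriv (fun t : ℝ => ((lam : ℂ) + t * Complex.I)) t = Complex.I := by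
    intro lam t
    have : HasDerivAt (fun t : ℝ => ((lam : ℂ) + t * Complex.I)) (Complex.ofRealCLM 1 * Complex.I) t :=
      ((Complex.ofRealCLM.hasDerivAt (x := t)).mul_const Complex.I).const_add (lam : ℂ)
    rw [this.deriv]; simp
  have hlinei : ∀ k : ℕ, Integrable fun t : ℝ => f (((-(L + k) : ℝ) : ℂ) + t * Complex.I) * Complex.I := by
    intro k
    have := hdec.integrable_comp (hlnC (-(L + k))) (σ := -(L + k)) (T := 0) (fun t _ => rfl) (hlinec k)
    simpa only [hlnd] using this
  have hγd : ∀ t, DifferentiableAt ℂ f (γ t) := fun t => hdiff _ (fun i => by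
      rintro ⟨m, hm⟩
      exact (hα i m).1 t (by linear_combination hm)) (fun i => by
      rintro ⟨m, hm⟩
      exact (hβ i m).1 t (by linear_combination -hm))
  have hγi : Integrable fun t => f (γ t) * deriv γ t :=
    hdec.integrable_comp hγ hv (continuous_iff_continuousAt.2 fun t =>
      ContinuousAt.comp_of_eq (hγd t).continuousAt hγ.continuous.continuousAt rfl)
  -- the contour shift
  set Nk : ℕ → ι₁ → ℕ := fun k i => ⌈L + k - (α i).re⌉₊ with hNk
  have hres : ∀ i (n : ℕ), Tendsto (fun s => (s - (-α i - n)) * f s) (𝓝[≠] (-α i - n))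
      (𝓝 (mbResidue α β ρ τ ℓ i n)) := by
    intro i n
    refine tendsto_sub_mul_mbKernel ρ τ ℓ (fun j hj => ?_) (fun j => hβα j i n)
    rintro ⟨m, hm⟩
    exact hαα j i hj ⟨n - m, by push_cast; linear_combination hm⟩
  have hshift : ∀ k : ℕ, (∫ t, f (γ t) * deriv γ t) -
      ∫ t : ℝ, f (((-(L + k) : ℝ) : ℂ) + t * Complex.I) * Complex.I =
      2 * Real.pi * Complex.I * ∑ i, ∑ n ∈ Finset.range (Nk k i), mbResidue α β ρ τ ℓ i n := by
    intro k
    set lam : ℝ := -(L + k) with hlam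
    set x₁ : ℝ := min lam (-B) - 1
    set x₂ : ℝ := max lam B + 1
    -- Poles with index at least M lie outside the strip, so finitely many suffice for the contour
    -- shift.
    obtain ⟨M, hM⟩ := exists_nat_ge ((∑ i, |(α i).re|) + (∑ i, |(β i).re|) + |x₁| + |x₂|)
    have hαs : ∀ i, |(α i).re| ≤ ∑ i, |(α i).re| := fun i =>
      Finset.single_le_sum (f := fun i => |(α i).re|) (fun _ _ => abs_nonneg _) (Finset.mem_univ i)
    have hα0 : 0 ≤ ∑ i, |(α i).re| := Finset.sum_nonneg fun _ _ => abs_nonneg _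
    set S₁ : Finset ℂ := (Finset.univ.sigma fun i => Finset.range (Nk k i)).image
      fun p : (_ : ι₁) × ℕ => -α p.1 - p.2 with hS₁
    set S₀ : Finset ℂ := ((Finset.univ ×ˢ Finset.range M).image
        fun p : ι₁ × ℕ => -α p.1 - p.2).filter (fun P => P.re < lam) ∪
      (Finset.univ ×ˢ Finset.range M).image fun p : ι₂ × ℕ => β p.1 + p.2 with hS₀
    have hS₀' : ∀ P ∈ S₀, (IsLeftOf γ P ∧ P.re < lam) ∨ (IsRightOf γ P ∧ lam < P.re) := by
      intro P hP
      rcases Finset.mem_union.1 hP with h | h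
      · rw [Finset.mem_filter, Finset.mem_image] at h
        obtain ⟨⟨p, -, rfl⟩, h2⟩ := h
        exact Or.inl ⟨hα _ _, h2⟩
      · obtain ⟨p, -, rfl⟩ := Finset.mem_image.1 h
        refine Or.inr ⟨hβ _ _, ?_⟩
        simp
        have := hβL p.1
        have : (0 : ℝ) ≤ k := Nat.cast_nonneg k
        have : (0 : ℝ) ≤ p.2 := Nat.cast_nonneg p.2
        linarith
    have hS₁' : ∀ P ∈ S₁, IsLeftOf γ P ∧ lam < P.re := by
      intro P hP
      obtain ⟨p, hp, rfl⟩ := Finset.mem_image.1 hP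
      refine ⟨hα _ _, ?_⟩
      have h1 := Finset.mem_range.1 (Finset.mem_sigma.1 hp).2
      rw [hNk, Nat.lt_ceil] at h1
      simp; linarith
    have hmain := contour_shift hγ hv (x₁ := x₁) (x₂ := x₂) (lam := lam) (S₀ := S₀) (S₁ := S₁) (f := f)
      (fun t => by
        have := abs_le.1 (hB t)
        exact ⟨by have := min_le_right lam (-B); simp only [x₁]; linarith,
          by have := le_max_right lam B; simp only [x₂]; linarith⟩)
      ⟨by have := min_le_left lam (-B); simp only [x₁]; linarith,
        by have := le_max_left lam B; simp only [x₂]; linarith⟩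
      (fun s h1 h2 h3 h4 => hdiff s (fun i => by
        rintro ⟨m, hm⟩
        have hs : s = -α i - m := by linear_combination hm
        have hre : s.re = -(α i).re - m := by rw [hs]; simp
        rcases lt_trichotomy s.re lam with h | h | h
        · refine h3 (Finset.mem_union_left _ (Finset.mem_filter.2 ⟨Finset.mem_image.2 ⟨(i, m), ?_, hs.symm⟩, h⟩))
          simp
          have : (m : ℝ) < M := by
            have := neg_abs_le (α i).re; have := hαs i; have := neg_abs_le x₁
            have := abs_nonneg x₂
            linarith
          exact_mod_cast this
        · refine hLα i (m - k) ?_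
          push_cast; linarith
        · refine h4 (Finset.mem_image.2 ⟨⟨i, m⟩, ?_, hs.symm⟩)
          simp only [Finset.mem_sigma, Finset.mem_univ, true_and, Finset.mem_range, hNk, Nat.lt_ceil]
          linarith) (fun i => by
        rintro ⟨m, hm⟩
        have hs : s = β i + m := by linear_combination -hm
        have hre : s.re = (β i).re + m := by rw [hs]; simp
        refine h3 (Finset.mem_union_right _ (Finset.mem_image.2 ⟨(i, m), ?_, hs.symm⟩))
        simp
        have : (m : ℝ) < M := by
          have := neg_abs_le (β i).re; have := hβs i; have := le_abs_self x₂
          have := abs_nonneg x₁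
          linarith
        exact_mod_cast this))
      (fun P => (meromorphicAt_mbKernel α β ρ τ P).mul
        (DifferentiableOn.analyticAt (s := Set.univ)
          (by fun_prop : Differentiable ℂ fun s => Complex.exp (ℓ * s)).differentiableOn
          univ_mem).meromorphicAt)
      (hdec.vanishesInStrip _ _) hS₀' hS₁'
      -- Residues are taken as a function of the point; since the poles -α_i - n are distinct, the
      -- sum over points is then a sum over indices.
      (r := fun P => limUnder (𝓝[≠] P) fun s => (s - P) * f s)
      (fun P hP => by
        obtain ⟨p, hp, rfl⟩ := Finset.mem_image.1 hP
        exact tendsto_nhds_limUnder ⟨_, hres p.1 p.2⟩)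
      hγi (hlinei k)
    rw [hmain, hS₁, Finset.sum_image, Finset.sum_sigma]
    · congr 1
      refine Finset.sum_congr rfl fun i _ => Finset.sum_congr rfl fun n _ => ?_
      exact (hres i n).limUnder_eq
    · rintro ⟨i, n⟩ - ⟨j, m⟩ - h
      simp only at h
      have hij : i = j := by
        by_contra hne
        exact hαα i j hne ⟨m - n, by push_cast; linear_combination -h⟩
      subst hij
      have : (n : ℂ) = m := by linear_combination -h
      rw [Nat.cast_inj.1 this]
  -- the shifted line integrals tend to zero
  have hline0 : Tendsto (fun k : ℕ => ∫ t : ℝ, f (((-(L + k) : ℝ) : ℂ) + t * Complex.I) * Complex.I)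
      atTop (𝓝 (∫ _t : ℝ, (0 : ℂ))) := by
    -- For each t the second factor is the term of a convergent series, hence tends to zero, and it
    -- is bounded uniformly in t and k. With the integrable first factor, dominated convergence
    -- applies.
    have hfe : ∀ (k : ℕ) (t : ℝ), ‖f (((-(L + k) : ℝ) : ℂ) + t * Complex.I) * Complex.I‖ =
        ‖f (((-L : ℝ) : ℂ) + t * Complex.I)‖ *
          ‖riseQuot (upperShift β ρ) (lowerShift α τ) (-(((-L : ℝ) : ℂ) + t * Complex.I)) k *
            Complex.exp (-(ℓ * k))‖ := by
      intro k t
      have h0 := hlineα 0 t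
      have h0' := hlineβ 0 t
      simp only [Nat.cast_zero, add_zero] at h0 h0'
      have e : (((-(L + k) : ℝ) : ℂ) + t * Complex.I) = (((-L : ℝ) : ℂ) + t * Complex.I) - k := by
        push_cast; ring
      rw [e, hf]
      dsimp only
      rw [mbKernel_sub_natCast ρ (fun i => ?_) h0' (fun i => ?_)]
      · have e5 : Complex.exp (ℓ * ((((-L : ℝ) : ℂ) + t * Complex.I) - k)) =
          Complex.exp (ℓ * (((-L : ℝ) : ℂ) + t * Complex.I)) * Complex.exp (-(ℓ * k)) := by
          rw [← Complex.exp_add]; ring_nf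
        rw [e5]
        simp only [norm_mul, norm_pow, norm_neg, norm_one, one_pow, one_mul, Complex.norm_I, mul_one]
        ring
      · rintro ⟨m, hm⟩
        exact h0 i (m + 1) (by push_cast at hm ⊢; linear_combination -hm)
      · refine npos _ ?_
        have := hτL i
        simp; linarith
    have hre : ∀ t : ℝ, L₀ ≤ (-(((-L : ℝ) : ℂ) + t * Complex.I)).re := fun t => by
      simp; linarith
    have hi0 := hlinei 0
    simp only [Nat.cast_zero, add_zero] at hi0
    refine tendsto_integral_of_dominated_convergence
      (fun t => ‖f (((-L : ℝ) : ℂ) + t * Complex.I) * Complex.I‖ * C) ?_ (hi0.norm.mul_const C) ?_ ?_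
    · exact fun k => ((hlinec k).mul continuous_const).aestronglyMeasurable
    · intro k
      refine Eventually.of_forall fun t => ?_
      rw [hfe, norm_mul _ Complex.I, Complex.norm_I, mul_one]
      gcongr
      exact (hbd _ (hre t)).1 k
    · refine Eventually.of_forall fun t => ?_
      rw [tendsto_zero_iff_norm_tendsto_zero]
      simp only [hfe]
      have := ((hbd _ (hre t)).2.tendsto_atTop_zero.norm).const_mul
        ‖f (((-L : ℝ) : ℂ) + t * Complex.I)‖
      simpa only [norm_zero, mul_zero] using this
  have hNkt : ∀ i, Tendsto (fun k => Nk k i) atTop atTop := by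
    intro i
    refine tendsto_atTop_mono (f := fun k : ℕ => k - ⌈|(α i).re|⌉₊) (fun k => ?_) (tendsto_sub_atTop_nat _)
    rw [hNk]
    rcases le_total ⌈|(α i).re|⌉₊ k with h | h
    · have h1 : ((k - ⌈|(α i).re|⌉₊ : ℕ) : ℝ) ≤ L + k - (α i).re := by
        rw [Nat.cast_sub h]
        have := Nat.le_ceil |(α i).re|
        have := le_abs_self (α i).re
        linarith
      exact_mod_cast h1.trans (Nat.le_ceil _)
    · simp [Nat.sub_eq_zero_of_le h]
  have hlim1 : Tendsto (fun k : ℕ => 2 * Real.pi * Complex.I *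
      ∑ i, ∑ n ∈ Finset.range (Nk k i), mbResidue α β ρ τ ℓ i n) atTop
      (𝓝 (2 * Real.pi * Complex.I * ∑ i, ∑' n, mbResidue α β ρ τ ℓ i n)) :=
    (tendsto_finsetSum _ fun i _ => (hsum i).hasSum.tendsto_sum_nat.comp (hNkt i)).const_mul _
  have hlim2 := hline0.const_sub (∫ t, f (γ t) * deriv γ t)
  simp only [hshift, integral_zero, sub_zero] at hlim2
  exact tendsto_nhds_unique hlim2 hlim1

end Slater

/-! ### Matching residues with the summands of Σ_A -/

theorem prod_erase_inl {ι κ : Type} [Fintype ι] [Fintype κ] [DecidableEq ι] [DecidableEq κ]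
    (μ : ι) (F : ι ⊕ κ → ℂ) : ∏ i ∈ Finset.univ.erase (Sum.inl μ), F i =
      (∏ i ∈ Finset.univ.erase μ, F (Sum.inl i)) * ∏ i, F (Sum.inr i) := by
  have : (Finset.univ.erase (Sum.inl μ) : Finset (ι ⊕ κ)) =
      (Finset.univ.erase μ).disjSum Finset.univ := by
    ext (i | i) <;> simp
  rw [this, Finset.prod_disjSum]

theorem prod_erase_inr {ι κ : Type} [Fintype ι] [Fintype κ] [DecidableEq ι] [DecidableEq κ]
    (μ : κ) (F : ι ⊕ κ → ℂ) : ∏ i ∈ Finset.univ.erase (Sum.inr μ), F i =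
      (∏ i, F (Sum.inl i)) * ∏ i ∈ Finset.univ.erase μ, F (Sum.inr i) := by
  have : (Finset.univ.erase (Sum.inr μ) : Finset (ι ⊕ κ)) =
      Finset.univ.disjSum (Finset.univ.erase μ) := by
    ext (i | i) <;> simp
  rw [this, Finset.prod_disjSum]

theorem poch_add_natCast (α : ℂ) (m n : ℕ) : poch α ((m : ℤ) + n) = rise α (m + n) := by
  rw [← poch_natCast]; push_cast; rfl

theorem poch_two_mul_add_natCast (α : ℂ) (m n : ℕ) :
    poch α (2 * (m : ℤ) + n) = rise α (2 * m + n) := by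
  rw [← poch_natCast]; push_cast; rfl

/-- Lets the signs with integer exponents such as G - J be compared with natural exponents such as G
+ J of the same parity. -/
theorem neg_one_zpow_eq_pow {x : ℤ} {y : ℕ} (h : ∃ z : ℤ, x = y + 2 * z) :
    (-1 : ℂ) ^ x = (-1) ^ y := by
  obtain ⟨z, rfl⟩ := h
  rw [zpow_add₀ (by norm_num), zpow_mul, zpow_natCast]
  simp

namespace MBParams

variable {A B C D E F G H J K : ℕ}

/-- The parameters `(a) + m, (g)`. -/
def leftNum (p : MBParams A B C D E F G H J K) (m : ℕ) : Fin A ⊕ Fin G → ℂ :=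
  Sum.elim (fun i => p.a i + m) p.g

/-- The parameters `(b) + m, (h)`. -/
def rightNum (p : MBParams A B C D E F G H J K) (m : ℕ) : Fin B ⊕ Fin H → ℂ :=
  Sum.elim (fun i => p.b i + m) p.h

/-- The parameters `(c) + m, (j)`. -/
def leftDen (p : MBParams A B C D E F G H J K) (m : ℕ) : Fin C ⊕ Fin J → ℂ :=
  Sum.elim (fun i => p.c i + m) p.j

/-- The parameters `(d) + m, (k)`. -/
def rightDen (p : MBParams A B C D E F G H J K) (m : ℕ) : Fin D ⊕ Fin K → ℂ :=
  Sum.elim (fun i => p.d i + m) p.k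

/-- The part of the `m`-th hypergeometric term that does not depend on `s`. -/
noncomputable def coef (p : MBParams A B C D E F G H J K) (x : ℂ) (m : ℕ) : ℂ :=
  (∏ i, rise (p.e i) m) / (∏ i, rise (p.f i) m) * x ^ m / (m.factorial : ℂ)

/-- The factor of `termA` left after splitting off `coef`. -/
noncomputable def restA (p : MBParams A B C D E F G H J K) (ℓ : ℂ) (μ : Fin A) (m n : ℕ) : ℂ :=
  ((∏ i, rise (p.b i + p.a μ) (2 * m + n)) * (∏ i, rise (p.h i + p.a μ) (m + n)) *
    (∏ i, rise (1 + p.a μ - p.c i) n) * (∏ i, rise (1 + p.a μ - p.j i) (m + n))) /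
  ((∏ i ∈ Finset.univ.erase μ, rise (1 + p.a μ - p.a i) n) *
    (∏ i, rise (1 + p.a μ - p.g i) (m + n)) * (∏ i, rise (p.d i + p.a μ) (2 * m + n)) *
    (∏ i, rise (p.k i + p.a μ) (m + n)) * (n.factorial : ℂ)) *
  (Complex.exp (ℓ * (-p.a μ - m - n)) * ((-1) ^ (n * (A + G + (C + J))) * (-1) ^ (m * (G + J))))

/-- The factor of `termG` left after splitting off `coef`. -/
noncomputable def restG (p : MBParams A B C D E F G H J K) (ℓ : ℂ) (μ : Fin G) (m n : ℕ) : ℂ :=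
  ((∏ i, poch (p.a i - p.g μ) ((m : ℤ) - n)) * (∏ i, rise (p.b i + p.g μ) (m + n)) *
    (∏ i, rise (1 + p.g μ - p.j i) n) * (∏ i, rise (p.h i + p.g μ) n)) /
  ((∏ i, poch (p.c i - p.g μ) ((m : ℤ) - n)) * (∏ i, rise (p.d i + p.g μ) (m + n)) *
    (∏ i ∈ Finset.univ.erase μ, rise (1 + p.g μ - p.g i) n) *
    (∏ i, rise (p.k i + p.g μ) n) * (n.factorial : ℂ)) *
  (Complex.exp (ℓ * (-p.g μ - n)) * (-1) ^ (n * (G + J)))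

theorem termA_eq (p : MBParams A B C D E F G H J K) (x : ℂ) {z : ℂ} (hz : z ≠ 0) (μ : Fin A)
    (m n : ℕ) : p.termA x z μ m n = p.coef x m * p.restA (Complex.log z) μ m n := by
  have hs : (-1 : ℂ) ^ ((n : ℤ) * ((A : ℤ) + G - C - J) + (m : ℤ) * ((G : ℤ) - J)) =
      (-1) ^ (n * (A + G + (C + J))) * (-1) ^ (m * (G + J)) := by
    rw [← pow_add]
    exact neg_one_zpow_eq_pow ⟨-(n * (C + J)) - m * J, by push_cast; ring⟩
  rw [termA, coef, restA, hs, Complex.cpow_def_of_ne_zero hz]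
  simp only [poch_two_mul_add_natCast, poch_add_natCast, poch_natCast]
  ring

theorem termG_eq (p : MBParams A B C D E F G H J K) (x : ℂ) {z : ℂ} (hz : z ≠ 0) (μ : Fin G)
    (m n : ℕ) : p.termG x z μ m n = p.coef x m * p.restG (Complex.log z) μ m n := by
  have hs : (-1 : ℂ) ^ ((n : ℤ) * ((G : ℤ) - J)) = (-1) ^ (n * (G + J)) :=
    neg_one_zpow_eq_pow ⟨-(n * J), by push_cast; ring⟩
  rw [termG, coef, restG, hs, Complex.cpow_def_of_ne_zero hz]
  simp only [poch_add_natCast, poch_natCast]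
  ring

/-- For the m-th kernel the left parameter is a_μ + m, so the base point is w = a_μ + m. This is the
origin of the index 2m + n at (b) and (d), whose members are raised by m as well, and of m + n at
the unraised families. -/
theorem restA_eq_mul (p : MBParams A B C D E F G H J K) (ℓ : ℂ) (μ : Fin A) (m n : ℕ) :
    p.restA ℓ μ m n = (-1) ^ (n * (A + G + (C + J))) * (p.restA ℓ μ m 0 *
      (riseQuot (upperShift (p.rightNum m) (p.leftDen m)) (lowerShift (p.leftNum m) (p.rightDen m))
        (p.a μ + m) n * Complex.exp (-(ℓ * n)))) := by
  have e1 : ∀ z : ℂ, rise (z + p.a μ) (2 * m + n) =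
      rise (z + p.a μ) (2 * m) * rise (p.a μ + m + (z + m)) n := fun z => by
    rw [rise_add]; congr 2; push_cast; ring
  have e2 : ∀ z : ℂ, rise (z + p.a μ) (m + n) = rise (z + p.a μ) m * rise (p.a μ + m + z) n :=
    fun z => by rw [rise_add]; congr 2; ring
  have e3 : ∀ z : ℂ, rise (1 + p.a μ - z) (m + n) =
      rise (1 + p.a μ - z) m * rise (p.a μ + m + (1 - z)) n :=
    fun z => by rw [rise_add]; congr 2; ring
  have e4 : ∀ z : ℂ, p.a μ + m + (1 - (z + m)) = 1 + p.a μ - z := fun z => by ring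
  have e5 : Complex.exp (ℓ * (-p.a μ - m - n)) =
      Complex.exp (ℓ * (-p.a μ - m)) * Complex.exp (-(ℓ * n)) := by
    rw [← Complex.exp_add]; ring_nf
  have hD : ∏ i, rise (1 + p.a μ - p.a i) n =
      n.factorial * ∏ i ∈ Finset.univ.erase μ, rise (1 + p.a μ - p.a i) n := by
    rw [← Finset.mul_prod_erase _ _ (Finset.mem_univ μ), ← rise_one]
    congr 2; ring
  simp only [restA, e1, e2, e3, e5, riseQuot, upperShift, lowerShift, rightNum, leftDen, leftNum,
    rightDen, Fintype.prod_sum_type, Sum.elim_inl, Sum.elim_inr, e4, add_zero, rise_zero,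
    Finset.prod_const_one, hD, Nat.cast_zero, sub_zero, zero_mul, pow_zero, Nat.factorial_zero,
    Nat.cast_one, one_mul, mul_one, Finset.prod_mul_distrib]
  ring

/-- Both sides follow the same recurrence in n, so the comparison with the residues reduces to the
value at n = 0. -/
theorem prefA_mul_restA_zero (p : MBParams A B C D E F G H J K) (ℓ : ℂ) (μ : Fin A) (m : ℕ)
    (hb : ∀ i, ¬ IsNonposInt (p.b i + p.a μ)) (hh : ∀ i, ¬ IsNonposInt (p.h i + p.a μ))
    (hg : ∀ i, ¬ IsInt (p.a μ - p.g i)) (hd : ∀ i, ¬ IsNonposInt (p.d i + p.a μ))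
    (hk : ∀ i, ¬ IsNonposInt (p.k i + p.a μ)) :
    p.prefA μ * p.restA ℓ μ m 0 = mbResidue (p.leftNum m) (p.rightNum m) (p.leftDen m)
      (p.rightDen m) ℓ (Sum.inl μ) 0 := by
  have g0 : ∀ z : ℂ, z + (m : ℂ) - (p.a μ + m) = z - p.a μ := fun z => by ring
  have g1 : ∀ i, Complex.Gamma (p.b i + m + (p.a μ + m)) =
      rise (p.b i + p.a μ) (2 * m) * Complex.Gamma (p.b i + p.a μ) := fun i => by
    rw [← Gamma_add_natCast (hb i)]; congr 1; push_cast; ring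
  have g2 : ∀ i, Complex.Gamma (p.h i + (p.a μ + m)) =
      rise (p.h i + p.a μ) m * Complex.Gamma (p.h i + p.a μ) := fun i => by
    rw [← Gamma_add_natCast (hh i)]; congr 1; ring
  have g3 : ∀ i, Complex.Gamma (p.g i - (p.a μ + m)) =
      (-1) ^ m * Complex.Gamma (p.g i - p.a μ) / rise (1 + p.a μ - p.g i) m := fun i => by
    have : 1 + p.a μ - p.g i = 1 - (p.g i - p.a μ) := by ring
    rw [this, ← Gamma_sub_natCast]
    · congr 1; ring
    · rintro ⟨q, hq⟩
      exact hg i ⟨-q - 1, by push_cast; linear_combination hq⟩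
  have g4 : ∀ i, (Complex.Gamma (p.j i - (p.a μ + m)))⁻¹ =
      (-1) ^ m * rise (1 + p.a μ - p.j i) m * (Complex.Gamma (p.j i - p.a μ))⁻¹ := fun i => by
    have : 1 + p.a μ - p.j i = 1 - (p.j i - p.a μ) := by ring
    rw [this, ← Gamma_sub_natCast_inv]; congr 2; ring
  have g5 : ∀ i, (Complex.Gamma (p.d i + m + (p.a μ + m)))⁻¹ =
      (Complex.Gamma (p.d i + p.a μ))⁻¹ / rise (p.d i + p.a μ) (2 * m) := fun i => by
    rw [← Gamma_add_natCast_inv (hd i)]; congr 2; push_cast; ring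
  have g6 : ∀ i, (Complex.Gamma (p.k i + (p.a μ + m)))⁻¹ =
      (Complex.Gamma (p.k i + p.a μ))⁻¹ / rise (p.k i + p.a μ) m := fun i => by
    rw [← Gamma_add_natCast_inv (hk i)]; congr 2; ring
  have e5 : Complex.exp (ℓ * -(p.a μ + m)) = Complex.exp (ℓ * (-p.a μ - m)) := by
    congr 1; ring
  simp only [mbResidue, prod_erase_inl, prefA, restA, rightNum, leftDen, leftNum,
    rightDen, Fintype.prod_sum_type, Sum.elim_inl, Sum.elim_inr, add_zero, rise_zero,
    Finset.prod_const_one, Nat.cast_zero, sub_zero, zero_mul, pow_zero, Nat.factorial_zero,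
    Nat.cast_one, one_mul, mul_one, g0, g1, g2, g3, g4, g5, g6, e5, Finset.prod_mul_distrib,
    Finset.prod_div_distrib, Finset.prod_const, Finset.card_univ, Fintype.card_fin]
  simp only [Finset.prod_inv_distrib]
  rw [mul_add m, pow_add, pow_mul, pow_mul]
  ring

/-- At s = -g_μ - n the raised parameter a_i + m meets the shift -n, hence the index m - n, which
may be negative. The genericity of a_i - g_μ and c_i - g_μ allows these symbols to be written as
Gamma quotients. -/
theorem restG_eq_mul (p : MBParams A B C D E F G H J K) (ℓ : ℂ) (μ : Fin G) (m n : ℕ)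
    (ha : ∀ i, ¬ IsInt (p.a i - p.g μ)) (hc : ∀ i, ¬ IsNonposInt (p.c i - p.g μ)) :
    p.restG ℓ μ m n = (-1) ^ (n * (A + G + (C + J))) * (p.restG ℓ μ m 0 *
      (riseQuot (upperShift (p.rightNum m) (p.leftDen m)) (lowerShift (p.leftNum m) (p.rightDen m))
        (p.g μ) n * Complex.exp (-(ℓ * n)))) := by
  have ha' : ∀ i, ¬ IsNonposInt (p.a i - p.g μ) := fun i ⟨q, hq⟩ =>
    ha i ⟨-q, by push_cast; exact hq⟩
  have e1 : ∀ z : ℂ, rise (z + p.g μ) (m + n) = rise (z + p.g μ) m * rise (p.g μ + (z + m)) n :=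
    fun z => by rw [rise_add]; congr 2; ring
  have e2 : ∀ z : ℂ, rise (z + p.g μ) n = rise (p.g μ + z) n := fun z => by rw [add_comm]
  have e3 : ∀ z : ℂ, p.g μ + (1 - z) = 1 + p.g μ - z := fun z => by ring
  have e5 : Complex.exp (ℓ * (-p.g μ - n)) =
      Complex.exp (ℓ * (-p.g μ)) * Complex.exp (-(ℓ * n)) := by
    rw [← Complex.exp_add]; ring_nf
  have cst : ∀ z : ℂ, z + (((m : ℤ) - (n : ℤ) : ℤ) : ℂ) = z + m - n := fun z => by push_cast; ring
  have e6 : ∀ i, poch (p.a i - p.g μ) ((m : ℤ) - n) =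
      (-1) ^ n * poch (p.a i - p.g μ) m / rise (1 + p.g μ - (p.a i + m)) n := fun i => by
    have : 1 + p.g μ - (p.a i + m) = 1 - (p.a i - p.g μ + m) := by ring
    rw [poch_eq_Gamma_div _ (ha' i), poch_eq_Gamma_div _ (ha' i), cst, this, Gamma_sub_natCast]
    · push_cast; ring
    · rintro ⟨q, hq⟩
      exact ha i ⟨q + 1 - m, by push_cast; linear_combination -hq⟩
  -- Stated for inverses: where the symbol is infinite, its default value 0 again has inverse 0, as
  -- the convention requires.
  have e7 : ∀ i, (poch (p.c i - p.g μ) ((m : ℤ) - n))⁻¹ =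
      (-1) ^ n * rise (1 + p.g μ - (p.c i + m)) n * (poch (p.c i - p.g μ) m)⁻¹ := fun i => by
    have : 1 + p.g μ - (p.c i + m) = 1 - (p.c i - p.g μ + m) := by ring
    rw [poch_eq_Gamma_div _ (hc i), poch_eq_Gamma_div _ (hc i), cst, this, inv_div, inv_div,
      div_eq_mul_inv, Gamma_sub_natCast_inv]
    push_cast; ring
  have e7' : (∏ i, poch (p.c i - p.g μ) ((m : ℤ) - n))⁻¹ = (((-1) ^ n) ^ C *
      ∏ i, rise (1 + p.g μ - (p.c i + m)) n) * (∏ i, poch (p.c i - p.g μ) m)⁻¹ := by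
    rw [← Finset.prod_inv_distrib, Finset.prod_congr rfl fun i _ => e7 i]
    simp [Finset.prod_mul_distrib]
  have hD : ∏ i, rise (1 + p.g μ - p.g i) n =
      n.factorial * ∏ i ∈ Finset.univ.erase μ, rise (1 + p.g μ - p.g i) n := by
    rw [← Finset.mul_prod_erase _ _ (Finset.mem_univ μ), ← rise_one]
    congr 2; ring
  have split : ∀ N D₁ D₂ D₃ D₄ D₅ : ℂ, N / (D₁ * D₂ * D₃ * D₄ * D₅) =
    N * D₁⁻¹ * (D₂ * D₃ * D₄ * D₅)⁻¹ := fun N D₁ D₂ D₃ D₄ D₅ => by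
      rw [div_eq_mul_inv]; simp only [mul_inv]; ring
  rw [restG, restG, split, split, e7', Finset.prod_congr rfl fun i _ => e6 i]
  simp only [e1, e2, e5, riseQuot, upperShift, lowerShift, rightNum, leftDen, leftNum,
    rightDen, Fintype.prod_sum_type, Sum.elim_inl, Sum.elim_inr, e3, add_zero, rise_zero,
    Finset.prod_const_one, hD, Nat.cast_zero, sub_zero, zero_mul, pow_zero, Nat.factorial_zero,
    Nat.cast_one, mul_one, Finset.prod_mul_distrib, Finset.prod_div_distrib,
    Finset.prod_const, Finset.card_univ, Fintype.card_fin]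
  simp only [mul_add n, pow_add, pow_mul]
  ring

theorem prefG_mul_restG_zero (p : MBParams A B C D E F G H J K) (ℓ : ℂ) (μ : Fin G) (m : ℕ)
    (ha : ∀ i, ¬ IsInt (p.a i - p.g μ)) (hb : ∀ i, ¬ IsNonposInt (p.b i + p.g μ))
    (hc : ∀ i, ¬ IsNonposInt (p.c i - p.g μ)) (hd : ∀ i, ¬ IsNonposInt (p.d i + p.g μ)) :
    p.prefG μ * p.restG ℓ μ m 0 = mbResidue (p.leftNum m) (p.rightNum m) (p.leftDen m)
      (p.rightDen m) ℓ (Sum.inr μ) 0 := by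
  have ha' : ∀ i, ¬ IsNonposInt (p.a i - p.g μ) := fun i ⟨q, hq⟩ =>
    ha i ⟨-q, by push_cast; exact hq⟩
  have g1 : ∀ i, Complex.Gamma (p.b i + m + p.g μ) =
      rise (p.b i + p.g μ) m * Complex.Gamma (p.b i + p.g μ) := fun i => by
    rw [← Gamma_add_natCast (hb i)]; congr 1; ring
  have g2 : ∀ i, Complex.Gamma (p.a i + m - p.g μ) =
      rise (p.a i - p.g μ) m * Complex.Gamma (p.a i - p.g μ) := fun i => by
    rw [← Gamma_add_natCast (ha' i)]; congr 1; ring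
  have g5 : ∀ i, (Complex.Gamma (p.d i + m + p.g μ))⁻¹ =
      (Complex.Gamma (p.d i + p.g μ))⁻¹ / rise (p.d i + p.g μ) m := fun i => by
    rw [← Gamma_add_natCast_inv (hd i)]; congr 2; ring
  have g6 : ∀ i, (Complex.Gamma (p.c i + m - p.g μ))⁻¹ =
      (Complex.Gamma (p.c i - p.g μ))⁻¹ / rise (p.c i - p.g μ) m := fun i => by
    rw [← Gamma_add_natCast_inv (hc i)]; congr 2; ring
  simp only [mbResidue, prod_erase_inr, prefG, restG, rightNum, leftDen, leftNum,
    rightDen, Fintype.prod_sum_type, Sum.elim_inl, Sum.elim_inr, add_zero, rise_zero,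
    Finset.prod_const_one, Nat.cast_zero, sub_zero, zero_mul, pow_zero, Nat.factorial_zero,
    Nat.cast_one, mul_one, g1, g2, g5, g6, Finset.prod_mul_distrib,
    Finset.prod_div_distrib, poch_natCast]
  simp only [Finset.prod_inv_distrib]
  ring

end MBParams

/-! ### Termwise integration along the contour -/

-- Passages through P with nonzero velocity are isolated. The contour is allowed to run through
-- poles of Γ(c+s) or Γ(d-s), where the hypergeometric terms divide by zero; this shows that such
-- parameters t can be neglected, since the integrand vanishes anyway where γ' = 0.
open Filter Topology in
theorem countable_preimage_of_deriv_ne_zero {γ : ℝ → ℂ} (hγ : Differentiable ℝ γ) (P : ℂ) :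
    {t | γ t = P ∧ deriv γ t ≠ 0}.Countable := by
  rw [← Set.countable_coe_iff]
  have : DiscreteTopology {t | γ t = P ∧ deriv γ t ≠ 0} := by
    rw [discreteTopology_subtype_iff]
    intro t ht
    rw [← disjoint_iff, Filter.disjoint_principal_right]
    filter_upwards [(hγ t).hasDerivAt.eventually_ne (c := P) ht.2] with u hu h
    exact hu h.1
  exact TopologicalSpace.separableSpace_iff_countable.1 inferInstance

theorem rise_add_natCast_inv {z : ℂ} {k : ℕ} (h : rise z k ≠ 0) :
    (Complex.Gamma (z + k))⁻¹ = (Complex.Gamma z)⁻¹ * (rise z k)⁻¹ := by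
  rw [rise, Finset.prod_ne_zero_iff] at h
  rw [Gamma_add_nat_eq z k fun i hi => h i (Finset.mem_range.2 hi), mul_inv, ← rise, mul_comm]

namespace MBParams
open Filter Topology MeasureTheory

variable {A B C D E F G H J K : ℕ}

/-- The kernel of the `m`-th term of the integrand. -/
noncomputable def kern (p : MBParams A B C D E F G H J K) (m : ℕ) (s : ℂ) : ℂ :=
  mbKernel (p.leftNum m) (p.rightNum m) (p.leftDen m) (p.rightDen m) s

theorem hypTerm_eq (p : MBParams A B C D E F G H J K) (x s : ℂ) (m : ℕ) :
    hypTerm (p.upper s) (p.lower s) x m = p.coef x m *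
      ((∏ i, rise (p.a i + s) m) * (∏ i, rise (p.b i - s) m) *
        ((∏ i, (rise (p.c i + s) m)⁻¹) * ∏ i, (rise (p.d i - s) m)⁻¹)) := by
  simp only [hypTerm, coef, upper, lower, Fintype.prod_sum_type, Sum.elim_inl, Sum.elim_inr,
    poch_natCast, Finset.prod_inv_distrib]
  ring

/-- The reduction on which everything rests: the Pochhammer symbols only move the Gamma arguments by
m. -/
theorem gammaRatio_mul_hypTerm (p : MBParams A B C D E F G H J K) (x : ℂ) {s : ℂ} (m : ℕ)
    (ha : ∀ i, ¬ IsNonposInt (p.a i + s)) (hb : ∀ i, ¬ IsNonposInt (p.b i - s))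
    (hc : ∀ i, rise (p.c i + s) m ≠ 0) (hd : ∀ i, rise (p.d i - s) m ≠ 0) :
    p.gammaRatio s * hypTerm (p.upper s) (p.lower s) x m = p.coef x m * p.kern m s := by
  have g1 : ∀ i, Complex.Gamma (p.a i + m + s) =
      rise (p.a i + s) m * Complex.Gamma (p.a i + s) := fun i => by
    rw [← Gamma_add_natCast (ha i)]; congr 1; ring
  have g2 : ∀ i, Complex.Gamma (p.b i + m - s) =
      rise (p.b i - s) m * Complex.Gamma (p.b i - s) := fun i => by
    rw [← Gamma_add_natCast (hb i)]; congr 1; ring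
  have g3 : ∀ i, (Complex.Gamma (p.c i + m + s))⁻¹ =
      (Complex.Gamma (p.c i + s))⁻¹ * (rise (p.c i + s) m)⁻¹ := fun i => by
    rw [← rise_add_natCast_inv (hc i)]; congr 2; ring
  have g4 : ∀ i, (Complex.Gamma (p.d i + m - s))⁻¹ =
      (Complex.Gamma (p.d i - s))⁻¹ * (rise (p.d i - s) m)⁻¹ := fun i => by
    rw [← rise_add_natCast_inv (hd i)]; congr 2; ring
  rw [hypTerm_eq, kern, mbKernel_eq]
  simp only [leftNum, rightNum, leftDen, rightDen, Fintype.prod_sum_type, Sum.elim_inl,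
    Sum.elim_inr, g1, g2, g3, g4, Finset.prod_mul_distrib]
  simp only [gammaRatio, Finset.prod_inv_distrib]
  ring

/-- Where a denominator symbol vanishes, division by zero makes the left side zero, so the
inequality holds at every point of the contour, not only almost everywhere. -/
theorem norm_gammaRatio_mul_hypTerm_le (p : MBParams A B C D E F G H J K) (x : ℂ) {s : ℂ} (m : ℕ)
    (ha : ∀ i, ¬ IsNonposInt (p.a i + s)) (hb : ∀ i, ¬ IsNonposInt (p.b i - s)) :
    ‖p.gammaRatio s * hypTerm (p.upper s) (p.lower s) x m‖ ≤ ‖p.coef x m * p.kern m s‖ := by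
  by_cases hc : ∀ i, rise (p.c i + s) m ≠ 0
  · by_cases hd : ∀ i, rise (p.d i - s) m ≠ 0
    · rw [gammaRatio_mul_hypTerm p x m ha hb hc hd]
    · push Not at hd
      obtain ⟨i, hi⟩ := hd
      rw [hypTerm_eq, Finset.prod_eq_zero (f := fun i => (rise (p.d i - s) m)⁻¹)
        (Finset.mem_univ i) (by rw [hi, inv_zero])]
      simp only [mul_zero, norm_zero]
      positivity
  · push Not at hc
    obtain ⟨i, hi⟩ := hc
    rw [hypTerm_eq, Finset.prod_eq_zero (f := fun i => (rise (p.c i + s) m)⁻¹)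
      (Finset.mem_univ i) (by rw [hi, inv_zero])]
    simp only [mul_zero, zero_mul, norm_zero]
    positivity

theorem IsContour.not_nonposInt_a {p : MBParams A B C D E F G H J K} {γ : ℝ → ℂ}
    (hγ : p.IsContour γ) (i : Fin A) (t : ℝ) : ¬ IsNonposInt (p.a i + γ t) := by
  rintro ⟨n, hn⟩
  exact (hγ.left_a i n).1 t (by linear_combination hn)

theorem IsContour.not_nonposInt_b {p : MBParams A B C D E F G H J K} {γ : ℝ → ℂ}
    (hγ : p.IsContour γ) (i : Fin B) (t : ℝ) : ¬ IsNonposInt (p.b i - γ t) := by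
  rintro ⟨n, hn⟩
  exact (hγ.right_b i n).1 t (by linear_combination -hn)

/-- Raising a_i by m discards its first m poles and creates none. -/
theorem IsContour.left {p : MBParams A B C D E F G H J K} {γ : ℝ → ℂ}
    (hγ : p.IsContour γ) (m : ℕ) (i : Fin A ⊕ Fin G) (n : ℕ) :
    IsLeftOf γ (-p.leftNum m i - n) := by
  rcases i with i | i
  · have := hγ.left_a i (m + n)
    convert this using 1
    simp only [leftNum, Sum.elim_inl]; push_cast; ring
  · exact hγ.left_g i n

theorem IsContour.right {p : MBParams A B C D E F G H J K} {γ : ℝ → ℂ}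
    (hγ : p.IsContour γ) (m : ℕ) (i : Fin B ⊕ Fin H) (n : ℕ) :
    IsRightOf γ (p.rightNum m i + n) := by
  rcases i with i | i
  · have := hγ.right_b i (m + n)
    convert this using 1
    simp only [rightNum, Sum.elim_inl]; push_cast; ring
  · exact hγ.right_h i n

theorem IsContour.continuous_kern {p : MBParams A B C D E F G H J K} {γ : ℝ → ℂ}
    (hγ : p.IsContour γ) (m : ℕ) : Continuous fun t => p.kern m (γ t) := by
  refine continuous_iff_continuousAt.2 fun t => ContinuousAt.comp_of_eq
    (y := γ t) (g := p.kern m) ?_ hγ.contDiff.continuous.continuousAt rfl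
  refine (differentiableAt_mbKernel _ _ (fun i => ?_) (fun i => ?_)).continuousAt
  · rintro ⟨n, hn⟩
    exact (hγ.left m i n).1 t (by linear_combination hn)
  · rintro ⟨n, hn⟩
    exact (hγ.right m i n).1 t (by linear_combination -hn)

theorem IsContour.ae_eq {p : MBParams A B C D E F G H J K} {γ : ℝ → ℂ} (hγ : p.IsContour γ)
    (x ℓ : ℂ) (m : ℕ) :
    (fun t => p.gammaRatio (γ t) * hypTerm (p.upper (γ t)) (p.lower (γ t)) x m *
      Complex.exp (ℓ * γ t) * deriv γ t) =ᵐ[volume]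
    fun t => p.coef x m * (p.kern m (γ t) * Complex.exp (ℓ * γ t) * deriv γ t) := by
  have hd : Differentiable ℝ γ := hγ.contDiff.differentiable one_ne_zero
  have h1 : (⋃ q : Fin C × ℕ, {t | γ t = -p.c q.1 - q.2 ∧ deriv γ t ≠ 0}).Countable :=
    Set.countable_iUnion fun q => countable_preimage_of_deriv_ne_zero hd _
  have h2 : (⋃ q : Fin D × ℕ, {t | γ t = p.d q.1 + q.2 ∧ deriv γ t ≠ 0}).Countable :=
    Set.countable_iUnion fun q => countable_preimage_of_deriv_ne_zero hd _
  filter_upwards [h1.ae_notMem volume, h2.ae_notMem volume] with t ht1 ht2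
  by_cases h0 : deriv γ t = 0
  · simp [h0]
  · rw [gammaRatio_mul_hypTerm p x m (fun i => hγ.not_nonposInt_a i t)
      (fun i => hγ.not_nonposInt_b i t)]
    · ring
    · intro i
      rw [rise, Finset.prod_ne_zero_iff]
      intro n _ hn
      exact ht1 (Set.mem_iUnion.2 ⟨(i, n), by linear_combination hn, h0⟩)
    · intro i
      rw [rise, Finset.prod_ne_zero_iff]
      intro n _ hn
      exact ht2 (Set.mem_iUnion.2 ⟨(i, n), by linear_combination -hn, h0⟩)

theorem IsContour.not_nonposInt_right_add_left {p : MBParams A B C D E F G H J K} {γ : ℝ → ℂ}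
    (hγ : p.IsContour γ) (m : ℕ) (i : Fin B ⊕ Fin H) (i' : Fin A ⊕ Fin G) :
    ¬ IsNonposInt (p.rightNum m i + p.leftNum m i') := by
  rintro ⟨n, hn⟩
  have := hγ.right m i n
  rw [show p.rightNum m i + n = -p.leftNum m i' - (0 : ℕ) by
    push_cast; linear_combination hn] at this
  exact not_isLeftOf_and_isRightOf (hγ.left m i' 0) this

theorem GenericA.leftNum_sub {p : MBParams A B C D E F G H J K} (hgen : p.GenericA) (m : ℕ)
    (i i' : Fin A ⊕ Fin G) (h : i ≠ i') : ¬ IsInt (p.leftNum m i - p.leftNum m i') := by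
  rcases i with i | i <;> rcases i' with i' | i' <;> rintro ⟨n, hn⟩ <;>
    simp only [leftNum, Sum.elim_inl, Sum.elim_inr] at hn
  · exact hgen.aa i i' (by simpa using h) ⟨n, by linear_combination hn⟩
  · exact hgen.ag i i' ⟨n - m, by push_cast; linear_combination hn⟩
  · exact hgen.ag i' i ⟨-n - m, by push_cast; linear_combination -hn⟩
  · exact hgen.gg i i' (by simpa using h) ⟨n, hn⟩

theorem GenericA.rightDen_add {p : MBParams A B C D E F G H J K} (hgen : p.GenericA) (m : ℕ)
    (i : Fin D ⊕ Fin K) (i' : Fin A ⊕ Fin G) :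
    ¬ IsNonposInt (p.rightDen m i + p.leftNum m i') := by
  rcases i with i | i <;> rcases i' with i' | i' <;> rintro ⟨n, hn⟩ <;>
    simp only [leftNum, rightDen, Sum.elim_inl, Sum.elim_inr] at hn
  · exact hgen.da i i' ⟨n + m + m, by push_cast; linear_combination hn⟩
  · exact hgen.dg i i' ⟨n + m, by push_cast; linear_combination hn⟩
  · exact hgen.ka i i' ⟨n + m, by push_cast; linear_combination hn⟩
  · exact hgen.kg i i' ⟨n, hn⟩

theorem IsContour.not_nonposInt_b_add_a {p : MBParams A B C D E F G H J K} {γ : ℝ → ℂ}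
    (hγ : p.IsContour γ) (i : Fin B) (i' : Fin A) : ¬ IsNonposInt (p.b i + p.a i') := by
  simpa [leftNum, rightNum] using hγ.not_nonposInt_right_add_left 0 (Sum.inl i) (Sum.inl i')

theorem IsContour.not_nonposInt_h_add_a {p : MBParams A B C D E F G H J K} {γ : ℝ → ℂ}
    (hγ : p.IsContour γ) (i : Fin H) (i' : Fin A) : ¬ IsNonposInt (p.h i + p.a i') := by
  simpa [leftNum, rightNum] using hγ.not_nonposInt_right_add_left 0 (Sum.inr i) (Sum.inl i')

theorem IsContour.not_nonposInt_b_add_g {p : MBParams A B C D E F G H J K} {γ : ℝ → ℂ}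
    (hγ : p.IsContour γ) (i : Fin B) (i' : Fin G) : ¬ IsNonposInt (p.b i + p.g i') := by
  simpa [leftNum, rightNum] using hγ.not_nonposInt_right_add_left 0 (Sum.inl i) (Sum.inr i')

theorem IsContour.prefA_mul_restA {p : MBParams A B C D E F G H J K} {γ : ℝ → ℂ}
    (hγ : p.IsContour γ) (hgen : p.GenericA) (ℓ : ℂ) (μ : Fin A) (m n : ℕ) :
    p.prefA μ * p.restA ℓ μ m n = mbResidue (p.leftNum m) (p.rightNum m) (p.leftDen m)
      (p.rightDen m) ℓ (Sum.inl μ) n := by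
  rw [mbResidue_eq _ _ (fun i hi => hgen.leftNum_sub m i _ hi)
    (fun i => hγ.not_nonposInt_right_add_left m i _) (fun i => hgen.rightDen_add m i _),
    ← p.prefA_mul_restA_zero ℓ μ m (fun i => hγ.not_nonposInt_b_add_a i μ)
    (fun i => hγ.not_nonposInt_h_add_a i μ) (fun i => hgen.ag μ i) (fun i => hgen.da i μ)
    (fun i => hgen.ka i μ), restA_eq_mul]
  simp only [Fintype.card_sum, Fintype.card_fin, leftNum, Sum.elim_inl]
  ring

theorem IsContour.prefG_mul_restG {p : MBParams A B C D E F G H J K} {γ : ℝ → ℂ}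
    (hγ : p.IsContour γ) (hgen : p.GenericA) (ℓ : ℂ) (μ : Fin G) (m n : ℕ) :
    p.prefG μ * p.restG ℓ μ m n = mbResidue (p.leftNum m) (p.rightNum m) (p.leftDen m)
      (p.rightDen m) ℓ (Sum.inr μ) n := by
  rw [mbResidue_eq _ _ (fun i hi => hgen.leftNum_sub m i _ hi)
    (fun i => hγ.not_nonposInt_right_add_left m i _) (fun i => hgen.rightDen_add m i _),
    ← p.prefG_mul_restG_zero ℓ μ m (fun i => hgen.ag i μ)
    (fun i => hγ.not_nonposInt_b_add_g i μ) (fun i => hgen.cg i μ) (fun i => hgen.dg i μ),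
    restG_eq_mul p ℓ μ m n (fun i => hgen.ag i μ) (fun i => hgen.cg i μ)]
  simp only [Fintype.card_sum, Fintype.card_fin, leftNum, Sum.elim_inr]
  ring

theorem summable_restA (p : MBParams A B C D E F G H J K) {ℓ : ℂ} {m : ℕ}
    (h : RatioCond (upperShift (p.rightNum m) (p.leftDen m))
      (lowerShift (p.leftNum m) (p.rightDen m)) ℓ) (μ : Fin A) :
    Summable fun n => p.restA ℓ μ m n := by
  refine Summable.of_norm (((h.summable (p.a μ + m)).mul_left (p.restA ℓ μ m 0)).norm.congr
    fun n => ?_)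
  rw [p.restA_eq_mul ℓ μ m n, norm_mul _ (p.restA ℓ μ m 0 * _)]
  simp

theorem GenericA.summable_restG {p : MBParams A B C D E F G H J K} (hgen : p.GenericA) {ℓ : ℂ}
    {m : ℕ} (h : RatioCond (upperShift (p.rightNum m) (p.leftDen m))
      (lowerShift (p.leftNum m) (p.rightDen m)) ℓ) (μ : Fin G) :
    Summable fun n => p.restG ℓ μ m n := by
  refine Summable.of_norm (((h.summable (p.g μ)).mul_left (p.restG ℓ μ m 0)).norm.congr
    fun n => ?_)
  rw [p.restG_eq_mul ℓ μ m n (fun i => hgen.ag i μ) (fun i => hgen.cg i μ),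
    norm_mul _ (p.restG ℓ μ m 0 * _)]
  simp

/-- The integrand of `𝓘` for a single term of the hypergeometric series, with `z = exp ℓ`. -/
noncomputable def integrand (p : MBParams A B C D E F G H J K) (γ : ℝ → ℂ) (x ℓ : ℂ) (m : ℕ)
    (t : ℝ) : ℂ :=
  p.gammaRatio (γ t) * hypTerm (p.upper (γ t)) (p.lower (γ t)) x m *
    Complex.exp (ℓ * γ t) * deriv γ t

theorem IsContour.continuous_kern_mul {p : MBParams A B C D E F G H J K} {γ : ℝ → ℂ}
    (hγ : p.IsContour γ) (ℓ : ℂ) (m : ℕ) :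
    Continuous fun t => p.kern m (γ t) * Complex.exp (ℓ * γ t) * deriv γ t :=
  ((hγ.continuous_kern m).mul (Complex.continuous_exp.comp
    (continuous_const.mul hγ.contDiff.continuous))).mul (hγ.contDiff.continuous_deriv le_rfl)

theorem IsContour.aestronglyMeasurable_integrand {p : MBParams A B C D E F G H J K} {γ : ℝ → ℂ}
    (hγ : p.IsContour γ) (x ℓ : ℂ) (m : ℕ) :
    AEStronglyMeasurable (p.integrand γ x ℓ m) volume :=
  ((continuous_const.mul (hγ.continuous_kern_mul ℓ m)).aestronglyMeasurable).congr
    (hγ.ae_eq x ℓ m).symm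

theorem IsContour.hasSum_integral_integrand {p : MBParams A B C D E F G H J K} {γ : ℝ → ℂ}
    (hγ : p.IsContour γ) {x ℓ : ℂ} (habs : ∫⁻ t, ∑' m, ‖p.integrand γ x ℓ m t‖ₑ < ⊤) :
    HasSum (fun m => ∫ t, p.integrand γ x ℓ m t)
      (∫ t, p.gammaRatio (γ t) * hypF (p.upper (γ t)) (p.lower (γ t)) x *
        Complex.exp (ℓ * γ t) * deriv γ t) := by
  have hm := fun m => hγ.aestronglyMeasurable_integrand x ℓ m
  rw [lintegral_tsum fun m => (hm m).enorm] at habs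
  have hi : ∀ m, Integrable (p.integrand γ x ℓ m) := fun m =>
    ⟨hm m, lt_of_le_of_lt (ENNReal.le_tsum m) habs⟩
  have hs : Summable fun m => ∫ t, ‖p.integrand γ x ℓ m t‖ := by
    have := ENNReal.summable_toReal habs.ne
    refine this.congr fun m => ?_
    rw [integral_norm_eq_lintegral_enorm (hm m)]
  have he : (fun t => p.gammaRatio (γ t) * hypF (p.upper (γ t)) (p.lower (γ t)) x *
      Complex.exp (ℓ * γ t) * deriv γ t) = fun t => ∑' m, p.integrand γ x ℓ m t := by
    funext t
    -- Constant factors pass through infinite sums in a field without any summability, so the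
    -- identity holds for every t.
    simp only [integrand, hypF]
    rw [← tsum_mul_left, ← tsum_mul_right, ← tsum_mul_right]
  rw [he]
  exact hasSum_integral_of_summable_integral_norm hi hs

/-- Only the finite sum over all left poles equals the m-th integral, so only these sums are known
to be summable over m. Decay and ratio conditions are required only where the coefficient is
nonzero, as the unit condition says nothing about the other m. -/
theorem IsContour.hasSum_left {p : MBParams A B C D E F G H J K} {γ : ℝ → ℂ}
    (hγ : p.IsContour γ) (hgen : p.GenericA) {x ℓ : ℂ}
    (habs : ∫⁻ t, ∑' m, ‖p.integrand γ x ℓ m t‖ₑ < ⊤)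
    (hdec : ∀ m, p.coef x m ≠ 0 → DecaysInStrips fun s => p.kern m s * Complex.exp (ℓ * s))
    (hratio : ∀ m, p.coef x m ≠ 0 → RatioCond (upperShift (p.rightNum m) (p.leftDen m))
      (lowerShift (p.leftNum m) (p.rightDen m)) ℓ) :
    (∀ μ m, Summable fun n => p.coef x m * p.restA ℓ μ m n) ∧
      (∀ μ m, Summable fun n => p.coef x m * p.restG ℓ μ m n) ∧
      HasSum (fun m => (∑ μ, p.prefA μ * ∑' n, p.coef x m * p.restA ℓ μ m n) +
        ∑ μ, p.prefG μ * ∑' n, p.coef x m * p.restG ℓ μ m n)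
      (1 / (2 * (Real.pi : ℂ) * Complex.I) * ∫ t, p.gammaRatio (γ t) *
        hypF (p.upper (γ t)) (p.lower (γ t)) x * Complex.exp (ℓ * γ t) * deriv γ t) := by
  have hA : ∀ μ m, Summable fun n => p.coef x m * p.restA ℓ μ m n := by
    intro μ m
    by_cases h : p.coef x m = 0
    · simp [h]
    · exact (p.summable_restA (hratio m h) μ).mul_left _
  have hG : ∀ μ m, Summable fun n => p.coef x m * p.restG ℓ μ m n := by
    intro μ m
    by_cases h : p.coef x m = 0
    · simp [h]
    · exact (hgen.summable_restG (hratio m h) μ).mul_left _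
  refine ⟨hA, hG, ?_⟩
  refine ((hγ.hasSum_integral_integrand habs).mul_left
    (1 / (2 * (Real.pi : ℂ) * Complex.I))).congr_fun fun m => ?_
  have h1 : ∫ t, p.integrand γ x ℓ m t = p.coef x m *
      ∫ t, p.kern m (γ t) * Complex.exp (ℓ * γ t) * deriv γ t := by
    rw [← integral_const_mul]
    exact integral_congr_ae (hγ.ae_eq x ℓ m)
  rw [h1]
  simp only [tsum_mul_left]
  by_cases h : p.coef x m = 0
  · simp [h]
  obtain ⟨σ, T, hv⟩ := hγ.vertical
  have h2 := (slater_left hγ.contDiff hv (hγ.left m) (hγ.right m) (hgen.leftNum_sub m)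
    (hgen.rightDen_add m) (hdec m h) (hratio m h)).2
  simp only [kern]
  rw [h2, Fintype.sum_sum_type]
  simp only [← hγ.prefA_mul_restA hgen, ← hγ.prefG_mul_restG hgen, tsum_mul_left]
  have : 2 * (Real.pi : ℂ) * Complex.I ≠ 0 := Complex.two_pi_I_ne_zero
  rw [mul_left_comm (1 / _), one_div_mul_eq_div, mul_div_cancel_left₀ _ this, mul_add,
    Finset.mul_sum, Finset.mul_sum]
  simp only [mul_left_comm]

theorem integral_eq_exp (p : MBParams A B C D E F G H J K) (γ : ℝ → ℂ) (x : ℂ) {z : ℂ}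
    (hz : z ≠ 0) : p.integral γ x z = 1 / (2 * (Real.pi : ℂ) * Complex.I) *
      ∫ t, p.gammaRatio (γ t) * hypF (p.upper (γ t)) (p.lower (γ t)) x *
        Complex.exp (Complex.log z * γ t) * deriv γ t := by
  simp only [integral, Complex.cpow_def_of_ne_zero hz]

theorem absConv_iff (p : MBParams A B C D E F G H J K) (γ : ℝ → ℂ) (x : ℂ) {z : ℂ}
    (hz : z ≠ 0) : p.AbsConv γ x z ↔ ∫⁻ t, ∑' m, ‖p.integrand γ x (Complex.log z) m t‖ₑ < ⊤ := by
  simp only [AbsConv, integrand, Complex.cpow_def_of_ne_zero hz]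

theorem IsContour.isSigmaA {p : MBParams A B C D E F G H J K} {γ : ℝ → ℂ}
    (hγ : p.IsContour γ) (hgen : p.GenericA) {x z : ℂ} (hz : z ≠ 0) (habs : p.AbsConv γ x z)
    (hdec : ∀ m, p.coef x m ≠ 0 →
      DecaysInStrips fun s => p.kern m s * Complex.exp (Complex.log z * s))
    (hratio : ∀ m, p.coef x m ≠ 0 → RatioCond (upperShift (p.rightNum m) (p.leftDen m))
      (lowerShift (p.leftNum m) (p.rightDen m)) (Complex.log z)) :
    p.IsSigmaA x z (p.integral γ x z) := by
  obtain ⟨h1, h2, h3⟩ := hγ.hasSum_left hgen ((p.absConv_iff γ x hz).1 habs) hdec hratio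
  rw [← p.integral_eq_exp γ x hz] at h3
  simp only [← p.termA_eq x hz, ← p.termG_eq x hz] at h1 h2 h3
  refine ⟨h1, h2, h3, fun h4 h5 => h3.unique ?_⟩
  exact (hasSum_sum fun μ _ => (h4 μ).hasSum.mul_left _).add
    (hasSum_sum fun μ _ => (h5 μ).hasSum.mul_left _)

end MBParams

/-! ### The three cases, and the reflection s ↦ -s -/

namespace MBParams
open Filter Topology MeasureTheory

variable {A B C D E F G H J K : ℕ}

theorem poch_prod_ne_zero_of_coef_ne_zero {p : MBParams A B C D E F G H J K} {x : ℂ} {m : ℕ}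
    (h : p.coef x m ≠ 0) : (∏ i, poch (p.e i) m) * x ^ m ≠ 0 := by
  simp only [poch_natCast]
  intro h0
  refine h ?_
  rw [coef, div_mul_eq_mul_div, h0, zero_div, zero_div]

theorem decaysInStrips_kern (p : MBParams A B C D E F G H J K) {ℓ : ℂ}
    (hℓ : |ℓ.im| < Real.pi / 2 * ((A : ℝ) + G + B + H - C - D - J - K)) (m : ℕ) :
    DecaysInStrips fun s => p.kern m s * Complex.exp (ℓ * s) := by
  refine decaysInStrips_mbKernel_of_abs_im_lt _ _ _ _ (hℓ.trans_eq ?_)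
  simp only [Fintype.card_sum, Fintype.card_fin]
  push_cast; ring

/-- The two equal excesses δ give the kernel N = 2δ, and the real-part inequality says exactly that
its power of |y| on vertical lines is below -1. -/
theorem UnitCondition.decaysInStrips_kern {p : MBParams A B C D E F G H J K} {x : ℂ}
    (h : p.UnitCondition x) {ℓ : ℂ} (hℓ : ℓ = 0) {m : ℕ} (hm : p.coef x m ≠ 0) :
    DecaysInStrips fun s => p.kern m s * Complex.exp (ℓ * s) := by
  obtain ⟨h1, h2, h3⟩ := h
  have h4 := h3 m (poch_prod_ne_zero_of_coef_ne_zero hm)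
  have h1' : (A : ℝ) + G - C - J = (B : ℝ) + H - D - K := by exact_mod_cast h1
  have h2' : (0 : ℝ) ≤ (A : ℝ) + G - C - J := by exact_mod_cast h2
  refine decaysInStrips_mbKernel_of_balanced _ _ _ _ (by rw [hℓ, Complex.zero_im]) ?_ ?_ ?_
  · simp only [Fintype.card_sum, Fintype.card_fin]; omega
  · simp only [Fintype.card_sum, Fintype.card_fin]; push_cast; linarith
  · simp only [Fintype.card_sum, Fintype.card_fin, Fintype.sum_sum_type, leftNum, rightNum,
      leftDen, rightDen, Sum.elim_inl, Sum.elim_inr, Complex.sub_re, Complex.add_re] at h4 ⊢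
    push_cast; linarith

theorem ratioCond_of_lt (p : MBParams A B C D E F G H J K) {ℓ : ℂ} (m : ℕ)
    (h : B + H + C + J < A + G + D + K ∨ (A + G + D + K = B + H + C + J ∧ 0 < ℓ.re)) :
    RatioCond (upperShift (p.rightNum m) (p.leftDen m))
      (lowerShift (p.leftNum m) (p.rightDen m)) ℓ := by
  simp only [RatioCond, Fintype.card_sum, Fintype.card_fin]
  rcases h with h | ⟨h, h'⟩
  · left; omega
  · exact Or.inr ⟨by omega, Or.inl h'⟩

/-- The same inequality once more: the parameters 1 - c, 1 - j, 1 - a, 1 - g contribute C + J - A -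
G = -δ, so the exponent of the residue series is also below -1. -/
theorem UnitCondition.ratioCond {p : MBParams A B C D E F G H J K} {x : ℂ}
    (h : p.UnitCondition x) {ℓ : ℂ} (hℓ : ℓ = 0) {m : ℕ} (hm : p.coef x m ≠ 0) :
    RatioCond (upperShift (p.rightNum m) (p.leftDen m))
      (lowerShift (p.leftNum m) (p.rightDen m)) ℓ := by
  obtain ⟨h1, -, h3⟩ := h
  have h4 := h3 m (poch_prod_ne_zero_of_coef_ne_zero hm)
  refine Or.inr ⟨?_, Or.inr ⟨by rw [hℓ, Complex.zero_re], ?_⟩⟩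
  · simp only [Fintype.card_sum, Fintype.card_fin]; omega
  · simp only [upperShift, lowerShift, Fintype.sum_sum_type, leftNum, rightNum,
      leftDen, rightDen, Sum.elim_inl, Sum.elim_inr, Complex.sub_re, Complex.add_re,
      Finset.sum_sub_distrib, Finset.sum_const, Finset.card_univ, Fintype.card_fin,
      Fintype.card_sum, nsmul_eq_mul, mul_one, Complex.natCast_re, Nat.cast_add] at h4 ⊢
    linarith

/-- Exchange the roles of `s` and `-s`. -/
def swap (p : MBParams A B C D E F G H J K) : MBParams B A D C E F H G K J where
  a := p.b
  b := p.a
  c := p.d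
  d := p.c
  e := p.e
  f := p.f
  g := p.h
  h := p.g
  j := p.k
  k := p.j

theorem GenericB.swap {p : MBParams A B C D E F G H J K} (h : p.GenericB) : p.swap.GenericA :=
  ⟨h.bb, h.hh, h.bh, h.cb, h.jb, h.ch, h.jh, h.dh⟩

theorem UnitCondition.swap {p : MBParams A B C D E F G H J K} {x : ℂ} (h : p.UnitCondition x) :
    p.swap.UnitCondition x := by
  obtain ⟨h1, h2, h3⟩ := h
  have h1' : (A : ℝ) + G - C - J = (B : ℝ) + H - D - K := by exact_mod_cast h1
  refine ⟨h1.symm, h1 ▸ h2, fun m hm => ?_⟩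
  have h4 := h3 m hm
  simp only [MBParams.swap, Complex.sub_re, Complex.add_re] at h4 ⊢
  linarith

theorem deriv_neg_comp_neg (γ : ℝ → ℂ) (t : ℝ) : deriv (fun t => -γ (-t)) t = deriv γ (-t) := by
  rw [deriv.fun_neg, deriv_comp_neg, neg_neg]

theorem integral_div_neg_comp_neg (γ : ℝ → ℂ) (P : ℂ) (R : ℝ) :
    ∫ t in (-R)..R, deriv (fun t => -γ (-t)) t / (-γ (-t) - P) =
      -∫ t in (-R)..R, deriv γ t / (γ t - -P) := by
  rw [← intervalIntegral.integral_neg]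
  have := intervalIntegral.integral_comp_neg (a := -R) (b := R)
    (fun t => -(deriv γ t / (γ t - -P)))
  rw [neg_neg] at this
  rw [← this]
  refine intervalIntegral.integral_congr fun t _ => ?_
  simp only [deriv_neg_comp_neg]
  rw [show -γ (-t) - P = -(γ (-t) - -P) by ring, div_neg]

theorem IsRightOf.neg_comp_neg {γ : ℝ → ℂ} {P : ℂ} (h : IsRightOf γ (-P)) :
    IsLeftOf (fun t => -γ (-t)) P := by
  refine ⟨fun t ht => h.1 (-t) (by rw [← ht, neg_neg]), ?_⟩
  simp only [integral_div_neg_comp_neg]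
  simpa using h.2.neg

theorem IsLeftOf.neg_comp_neg {γ : ℝ → ℂ} {P : ℂ} (h : IsLeftOf γ (-P)) :
    IsRightOf (fun t => -γ (-t)) P := by
  refine ⟨fun t ht => h.1 (-t) (by rw [← ht, neg_neg]), ?_⟩
  simp only [integral_div_neg_comp_neg]
  exact h.2.neg

/-- The curve t ↦ -γ(-t) again runs upwards, with left and right exchanged. -/
theorem IsContour.swap {p : MBParams A B C D E F G H J K} {γ : ℝ → ℂ} (h : p.IsContour γ) :
    p.swap.IsContour fun t => -γ (-t) where
  contDiff := (h.contDiff.comp contDiff_neg).neg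
  vertical := by
    obtain ⟨σ, T, hv⟩ := h.vertical
    refine ⟨-σ, T, fun t ht => ?_⟩
    rw [hv (-t) (by rwa [abs_neg])]
    push_cast; ring
  left_a i n := IsRightOf.neg_comp_neg (by
    rw [show -(-p.swap.a i - n) = p.b i + n by simp only [MBParams.swap]; ring]
    exact h.right_b i n)
  left_g i n := IsRightOf.neg_comp_neg (by
    rw [show -(-p.swap.g i - n) = p.h i + n by simp only [MBParams.swap]; ring]
    exact h.right_h i n)
  right_b i n := IsLeftOf.neg_comp_neg (by
    rw [show -(p.swap.b i + n) = -p.a i - n by simp only [MBParams.swap]; ring]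
    exact h.left_a i n)
  right_h i n := IsLeftOf.neg_comp_neg (by
    rw [show -(p.swap.h i + n) = -p.g i - n by simp only [MBParams.swap]; ring]
    exact h.left_g i n)

theorem swap_gammaRatio (p : MBParams A B C D E F G H J K) (s : ℂ) :
    p.swap.gammaRatio s = p.gammaRatio (-s) := by
  simp only [gammaRatio, swap, sub_neg_eq_add, ← sub_eq_add_neg]
  ring

theorem swap_hypTerm (p : MBParams A B C D E F G H J K) (x s : ℂ) (m : ℕ) :
    hypTerm (p.swap.upper s) (p.swap.lower s) x m =
      hypTerm (p.upper (-s)) (p.lower (-s)) x m := by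
  rw [hypTerm_eq, hypTerm_eq]
  simp only [coef, swap, sub_neg_eq_add, ← sub_eq_add_neg]
  ring

/-- The reflection replaces ℓ by -ℓ. Carrying ℓ = log z instead of z matters for negative z, where
the principal logarithm of 1/z is not -log z. -/
theorem swap_integrand (p : MBParams A B C D E F G H J K) (γ : ℝ → ℂ) (x ℓ : ℂ) (m : ℕ) (t : ℝ) :
    p.swap.integrand (fun t => -γ (-t)) x (-ℓ) m t = p.integrand γ x ℓ m (-t) := by
  simp only [integrand, swap_gammaRatio, swap_hypTerm, neg_neg, deriv_neg_comp_neg, neg_mul_neg]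

theorem swap_prefA (p : MBParams A B C D E F G H J K) (ν : Fin B) :
    p.swap.prefA ν = p.prefB ν := by
  simp only [prefA, prefB, swap]
  ring

theorem swap_prefG (p : MBParams A B C D E F G H J K) (ν : Fin H) :
    p.swap.prefG ν = p.prefH ν := by
  simp only [prefG, prefH, swap]
  ring

theorem termB_eq (p : MBParams A B C D E F G H J K) (x : ℂ) {z : ℂ} (hz : z ≠ 0) (ν : Fin B)
    (m n : ℕ) : p.termB x z ν m n = p.swap.coef x m * p.swap.restA (-Complex.log z) ν m n := by
  have hs : (-1 : ℂ) ^ ((n : ℤ) * ((B : ℤ) + H - K - D) + (m : ℤ) * ((H : ℤ) - K)) =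
      (-1) ^ (n * (B + H + (D + K))) * (-1) ^ (m * (H + K)) := by
    rw [← pow_add]
    exact neg_one_zpow_eq_pow ⟨-(n * (D + K)) - m * K, by push_cast; ring⟩
  have he : -Complex.log z * (-p.swap.a ν - m - n) = Complex.log z * (p.b ν + m + n) := by
    simp only [swap]; ring
  rw [termB, coef, restA, hs, Complex.cpow_def_of_ne_zero hz, he]
  simp only [poch_two_mul_add_natCast, poch_add_natCast, poch_natCast, swap]
  ring

theorem termH_eq (p : MBParams A B C D E F G H J K) (x : ℂ) {z : ℂ} (hz : z ≠ 0) (ν : Fin H)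
    (m n : ℕ) : p.termH x z ν m n = p.swap.coef x m * p.swap.restG (-Complex.log z) ν m n := by
  have hs : (-1 : ℂ) ^ ((n : ℤ) * ((H : ℤ) - K)) = (-1) ^ (n * (H + K)) :=
    neg_one_zpow_eq_pow ⟨-(n * K), by push_cast; ring⟩
  have he : -Complex.log z * (-p.swap.g ν - n) = Complex.log z * (p.h ν + n) := by
    simp only [swap]; ring
  rw [termH, coef, restG, hs, Complex.cpow_def_of_ne_zero hz, he]
  simp only [poch_add_natCast, poch_natCast, swap]
  ring

theorem IsContour.isSigmaB {p : MBParams A B C D E F G H J K} {γ : ℝ → ℂ}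
    (hγ : p.IsContour γ) (hgen : p.GenericB) {x z : ℂ} (hz : z ≠ 0) (habs : p.AbsConv γ x z)
    (hdec : ∀ m, p.swap.coef x m ≠ 0 →
      DecaysInStrips fun s => p.swap.kern m s * Complex.exp (-Complex.log z * s))
    (hratio : ∀ m, p.swap.coef x m ≠ 0 →
      RatioCond (upperShift (p.swap.rightNum m) (p.swap.leftDen m))
        (lowerShift (p.swap.leftNum m) (p.swap.rightDen m)) (-Complex.log z)) :
    p.IsSigmaB x z (p.integral γ x z) := by
  have habs' : ∫⁻ t, ∑' m, ‖p.swap.integrand (fun t => -γ (-t)) x (-Complex.log z) m t‖ₑ < ⊤ := by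
    simp only [swap_integrand]
    rw [lintegral_neg_eq_self fun t => ∑' m, ‖p.integrand γ x (Complex.log z) m t‖ₑ]
    exact (p.absConv_iff γ x hz).1 habs
  obtain ⟨h1, h2, h3⟩ := hγ.swap.hasSum_left hgen.swap habs' hdec hratio
  have hI : ∫ t, p.swap.gammaRatio (-γ (-t)) *
      hypF (p.swap.upper (-γ (-t))) (p.swap.lower (-γ (-t))) x *
      Complex.exp (-Complex.log z * -γ (-t)) * deriv (fun t => -γ (-t)) t =
      ∫ t, p.gammaRatio (γ t) * hypF (p.upper (γ t)) (p.lower (γ t)) x *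
        Complex.exp (Complex.log z * γ t) * deriv γ t := by
    rw [← integral_neg_eq_self]
    simp only [hypF, swap_gammaRatio, swap_hypTerm, neg_neg, deriv_neg_comp_neg, neg_mul_neg]
  rw [hI, ← p.integral_eq_exp γ x hz] at h3
  simp only [← p.termB_eq x hz, ← p.termH_eq x hz, swap_prefA, swap_prefG] at h1 h2 h3
  refine ⟨h1, h2, h3, fun h4 h5 => h3.unique ?_⟩
  exact (hasSum_sum fun μ _ => (h4 μ).hasSum.mul_left _).add
    (hasSum_sum fun μ _ => (h5 μ).hasSum.mul_left _)

theorem IsContour.isSigmaA_of_abs_arg_lt {p : MBParams A B C D E F G H J K} {γ : ℝ → ℂ}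
    (hγ : p.IsContour γ) (hgen : p.GenericA) {x z : ℂ} (hz : z ≠ 0)
    (harg : |z.arg| < Real.pi / 2 * ((A : ℝ) + G + B + H - C - D - J - K))
    (habs : p.AbsConv γ x z)
    (h : B + H + C + J < A + G + D + K ∨ (A + G + D + K = B + H + C + J ∧ 1 < ‖z‖)) :
    p.IsSigmaA x z (p.integral γ x z) :=
  hγ.isSigmaA hgen hz habs (fun m _ => p.decaysInStrips_kern (by rwa [Complex.log_im]) m)
    fun m _ => p.ratioCond_of_lt m (h.imp_right fun h => ⟨h.1, by
      rw [Complex.log_re]; exact Real.log_pos h.2⟩)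

theorem IsContour.isSigmaB_of_abs_arg_lt {p : MBParams A B C D E F G H J K} {γ : ℝ → ℂ}
    (hγ : p.IsContour γ) (hgen : p.GenericB) {x z : ℂ} (hz : z ≠ 0)
    (harg : |z.arg| < Real.pi / 2 * ((A : ℝ) + G + B + H - C - D - J - K))
    (habs : p.AbsConv γ x z)
    (h : A + G + D + K < B + H + C + J ∨ (A + G + D + K = B + H + C + J ∧ ‖z‖ < 1)) :
    p.IsSigmaB x z (p.integral γ x z) :=
  hγ.isSigmaB hgen hz habs
    (fun m _ => p.swap.decaysInStrips_kern (by
      rw [Complex.neg_im, abs_neg, Complex.log_im]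
      exact harg.trans_eq (by ring)) m)
    fun m _ => p.swap.ratioCond_of_lt m (by
      rcases h with h | ⟨h, h'⟩
      · left; omega
      · refine Or.inr ⟨by omega, ?_⟩
        rw [Complex.neg_re, Complex.log_re, neg_pos]
        exact Real.log_neg (norm_pos_iff.2 hz) h')

theorem IsContour.isSigmaA_one {p : MBParams A B C D E F G H J K} {γ : ℝ → ℂ}
    (hγ : p.IsContour γ) (hgen : p.GenericA) {x : ℂ} (hu : p.UnitCondition x)
    (habs : p.AbsConv γ x 1) : p.IsSigmaA x 1 (p.integral γ x 1) :=
  hγ.isSigmaA hgen one_ne_zero habs (fun _ hm => hu.decaysInStrips_kern Complex.log_one hm)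
    fun _ hm => hu.ratioCond Complex.log_one hm

theorem IsContour.isSigmaB_one {p : MBParams A B C D E F G H J K} {γ : ℝ → ℂ}
    (hγ : p.IsContour γ) (hgen : p.GenericB) {x : ℂ} (hu : p.UnitCondition x)
    (habs : p.AbsConv γ x 1) : p.IsSigmaB x 1 (p.integral γ x 1) :=
  hγ.isSigmaB hgen one_ne_zero habs
    (fun _ hm => hu.swap.decaysInStrips_kern (by simp) hm)
    fun _ hm => hu.swap.ratioCond (by simp) hm

end MBParams

/-! ### Comparison of rising factorials with factors polynomial in m -/

section CrudeRiseBounds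

/-- Bernoulli's inequality; it is the induction step of the two comparisons below. -/
theorem succ_pow_mul_le (c m : ℕ) :
    ((m : ℝ) + 1) ^ c * (1 + c / ((m : ℝ) + 1)) ≤ ((m : ℝ) + 1 + 1) ^ c := by
  have h0 : (0 : ℝ) < (m : ℝ) + 1 := by positivity
  have h := one_add_mul_le_pow (a := 1 / ((m : ℝ) + 1)) (by
    have : 0 < 1 / ((m : ℝ) + 1) := by positivity
    linarith) c
  calc ((m : ℝ) + 1) ^ c * (1 + c / ((m : ℝ) + 1))
      = ((m : ℝ) + 1) ^ c * (1 + c * (1 / ((m : ℝ) + 1))) := by ring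
    _ ≤ ((m : ℝ) + 1) ^ c * (1 + 1 / ((m : ℝ) + 1)) ^ c := by gcongr
    _ = _ := by rw [← mul_pow, mul_add, mul_one, mul_one_div_cancel h0.ne']

/-- In contrast to `exists_rise_ratio_bound` the factor does not involve w, which makes the bound
uniform along the contour. Since |w+m| ≥ m+1, adding β costs at most 1 + c/(m+1) in each step. -/
theorem norm_rise_add_le {β w : ℂ} {c : ℕ} (hβ : ‖β‖ ≤ c) (hw : 1 ≤ w.re) (m : ℕ) :
    ‖rise (w + β) m‖ ≤ ((m : ℝ) + 1) ^ c * ‖rise w m‖ := by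
  induction m with
  | zero => simp [rise_zero]
  | succ m ih =>
    have hv := natCast_le_norm_add hw m
    have h0 : (0 : ℝ) < (m : ℝ) + 1 := by positivity
    have h1 : ‖w + β + m‖ ≤ (1 + c / ((m : ℝ) + 1)) * ‖w + m‖ := by
      have h2 : ‖w + β + m‖ ≤ ‖w + m‖ + c := by
        rw [show w + β + m = (w + m) + β by ring]
        exact (norm_add_le _ _).trans (by linarith)
      have h3 : (c : ℝ) ≤ c / ((m : ℝ) + 1) * ‖w + m‖ := by
        rw [div_mul_eq_mul_div, le_div_iff₀ h0]; gcongr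
      linarith
    rw [rise_succ, rise_succ, norm_mul, norm_mul]
    push_cast
    calc _ ≤ (((m : ℝ) + 1) ^ c * ‖rise w m‖) * ((1 + c / ((m : ℝ) + 1)) * ‖w + m‖) := by gcongr
      _ = (((m : ℝ) + 1) ^ c * (1 + c / ((m : ℝ) + 1))) * (‖rise w m‖ * ‖w + m‖) := by ring
      _ ≤ _ := by gcongr; exact succ_pow_mul_le c m

theorem norm_rise_le_add {β w : ℂ} {c : ℕ} (hβ : ‖β‖ ≤ c) (hw : 1 ≤ w.re) (hwc : 2 * c + 2 ≤ ‖w‖)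
    (m : ℕ) : ‖rise w m‖ ≤ ((m : ℝ) + 1) ^ (2 * c + 2) * ‖rise (w + β) m‖ := by
  induction m with
  | zero => simp [rise_zero]
  | succ m ih =>
    have hv := natCast_le_norm_add hw m
    have hv' := norm_add_natCast_ge (w := w) (by linarith) m
    have h0 : (0 : ℝ) < (m : ℝ) + 1 := by positivity
    have hc : (0 : ℝ) ≤ c := Nat.cast_nonneg c
    have h1 : ‖w + m‖ ≤ (1 + ((2 * c + 2 : ℕ) : ℝ) / ((m : ℝ) + 1)) * ‖w + β + m‖ := by
      have h2 : ‖w + m‖ - c ≤ ‖w + β + m‖ := by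
        have := norm_sub_le (w + β + m) β
        rw [show w + β + m - β = w + m by ring] at this
        linarith
      -- As |w+m| ≥ 2c+2, subtracting c leaves at least half of |w+m|; the exponent 2c+2 makes up
      -- for this half.
      have h3 : (c : ℝ) ≤ ((2 * c + 2 : ℕ) : ℝ) / ((m : ℝ) + 1) * (‖w + m‖ - c) := by
        rw [div_mul_eq_mul_div, le_div_iff₀ h0]
        push_cast
        have : (c : ℝ) * (m + 1) ≤ c * ‖w + m‖ := by gcongr
        nlinarith
      have h4 : ((2 * c + 2 : ℕ) : ℝ) / ((m : ℝ) + 1) * (‖w + m‖ - c) ≤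
        ((2 * c + 2 : ℕ) : ℝ) / ((m : ℝ) + 1) * ‖w + β + m‖ := by gcongr
      linarith
    rw [rise_succ, rise_succ, norm_mul, norm_mul]
    push_cast
    calc _ ≤ (((m : ℝ) + 1) ^ (2 * c + 2) * ‖rise (w + β) m‖) *
          ((1 + ((2 * c + 2 : ℕ) : ℝ) / ((m : ℝ) + 1)) * ‖w + β + m‖) := by gcongr
      _ = (((m : ℝ) + 1) ^ (2 * c + 2) * (1 + ((2 * c + 2 : ℕ) : ℝ) / ((m : ℝ) + 1))) *
          (‖rise (w + β) m‖ * ‖w + β + m‖) := by ring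
      _ ≤ _ := by gcongr; exact succ_pow_mul_le _ m

theorem exists_norm_rise_le (α : ℂ) :
    ∃ P : ℕ, ∀ m : ℕ, ‖rise α m‖ ≤ ((m : ℝ) + 1) ^ P * (m.factorial : ℝ) := by
  refine ⟨⌈‖α - 1‖⌉₊, fun m => ?_⟩
  have := norm_rise_add_le (β := α - 1) (w := 1) (Nat.le_ceil _) (by simp) m
  rwa [add_sub_cancel, rise_one, Complex.norm_natCast] at this

theorem exists_factorial_le_norm_rise {α : ℂ} (hα : ¬ IsNonposInt α) :
    ∃ (C : ℝ) (P : ℕ), 0 ≤ C ∧ ∀ m : ℕ,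
      (m.factorial : ℝ) ≤ C * ((m : ℝ) + 1) ^ P * ‖rise α m‖ := by
  set c := ⌈‖α - 1‖⌉₊
  -- After M factors the base point is 1 + M = 2c + 2, far enough out for the lower comparison; the
  -- indices up to M go into the constant.
  set M := 2 * c + 1 with hM
  have hpos : ∀ m, 0 < ‖rise α m‖ := fun m => norm_pos_iff.2 (rise_ne_zero hα m)
  have hCn : ∀ i ∈ Finset.range (M + 1), 0 ≤ (i.factorial : ℝ) / ‖rise α i‖ := fun i _ => by
    positivity
  set C := ∑ i ∈ Finset.range (M + 1), (i.factorial : ℝ) / ‖rise α i‖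
  have hC : ∀ i ≤ M, (i.factorial : ℝ) ≤ C * ‖rise α i‖ := fun i hi => by
    rw [← div_le_iff₀ (hpos i)]
    exact Finset.single_le_sum hCn (Finset.mem_range.2 (Nat.lt_succ_of_le hi))
  have hC0 : 0 ≤ C := Finset.sum_nonneg hCn
  refine ⟨C, 2 * c + 2, hC0, fun m => ?_⟩
  rcases le_total m M with h | h
  · refine (hC m h).trans ?_
    have : (1 : ℝ) ≤ ((m : ℝ) + 1) ^ (2 * c + 2) := one_le_pow₀ (by linarith [Nat.cast_nonneg (α := ℝ) m])
    have h2 : 0 ≤ C * ‖rise α m‖ := by positivity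
    calc C * ‖rise α m‖ ≤ (C * ‖rise α m‖) * ((m : ℝ) + 1) ^ (2 * c + 2) :=
          le_mul_of_one_le_right h2 this
      _ = _ := by ring
  · obtain ⟨k, rfl⟩ := Nat.exists_eq_add_of_le h
    have h1 := norm_rise_le_add (β := α - 1) (w := 1 + M) (c := c) (Nat.le_ceil _)
      (by simp) (by
        rw [show (1 + M : ℂ) = ((1 + M : ℕ) : ℂ) by push_cast; rfl, Complex.norm_natCast, hM]
        push_cast; linarith) k
    rw [show 1 + (M : ℂ) + (α - 1) = α + M by ring] at h1
    have h2 : ((M + k).factorial : ℝ) = M.factorial * ‖rise (1 + M : ℂ) k‖ := by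
      rw [← Complex.norm_natCast, ← rise_one, rise_add, norm_mul, rise_one, Complex.norm_natCast]
    rw [h2, rise_add, norm_mul]
    calc _ ≤ (C * ‖rise α M‖) * (((k : ℝ) + 1) ^ (2 * c + 2) * ‖rise (α + M) k‖) := by
          gcongr; exact hC M le_rfl
      _ ≤ (C * ‖rise α M‖) * ((((M + k : ℕ) : ℝ) + 1) ^ (2 * c + 2) * ‖rise (α + M) k‖) := by
          gcongr; simp
      _ = _ := by ring

/-- Two reference points serve the families with +s and -s. On the vertical ends they are conjugate,
hence the hypothesis of equal moduli, and the whole quotient reduces to powers of a single |rise w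
m|. -/
theorem norm_prod_rise_quot_le {ι₁ ι₂ ι₃ ι₄ : Type} [Fintype ι₁] [Fintype ι₂] [Fintype ι₃]
    [Fintype ι₄] {α : ι₁ → ℂ} {β : ι₂ → ℂ} {ρ : ι₃ → ℂ} {τ : ι₄ → ℂ} {w w' : ℂ} {c m : ℕ}
    (hα : ∀ i, ‖α i - w‖ ≤ c) (hβ : ∀ i, ‖β i - w'‖ ≤ c) (hρ : ∀ i, ‖ρ i - w‖ ≤ c)
    (hτ : ∀ i, ‖τ i - w'‖ ≤ c) (hw : 1 ≤ w.re) (hw' : 1 ≤ w'.re) (hwc : 2 * c + 2 ≤ ‖w‖)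
    (hwc' : 2 * c + 2 ≤ ‖w'‖) (heq : ‖rise w' m‖ = ‖rise w m‖) :
    (∀ i, rise (ρ i) m ≠ 0) ∧ (∀ i, rise (τ i) m ≠ 0) ∧
    ‖(∏ i, rise (α i) m) * (∏ i, rise (β i) m) *
      ((∏ i, (rise (ρ i) m)⁻¹) * ∏ i, (rise (τ i) m)⁻¹)‖ ≤
    ((m : ℝ) + 1) ^ (c * (Fintype.card ι₁ + Fintype.card ι₂) +
      (2 * c + 2) * (Fintype.card ι₃ + Fintype.card ι₄)) *
      (‖rise w m‖ ^ (Fintype.card ι₁ + Fintype.card ι₂) /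
        ‖rise w m‖ ^ (Fintype.card ι₃ + Fintype.card ι₄)) := by
  have hR := norm_rise_pos hw m
  have hR' := norm_rise_pos hw' m
  have num : ∀ {ι : Type} [Fintype ι] {u : ι → ℂ} {v : ℂ}, (∀ i, ‖u i - v‖ ≤ c) → 1 ≤ v.re →
      ‖∏ i, rise (u i) m‖ ≤ (((m : ℝ) + 1) ^ c * ‖rise v m‖) ^ Fintype.card ι := by
    intro ι _ u v h hv
    rw [norm_prod, ← Finset.card_univ, ← Finset.prod_const]
    refine Finset.prod_le_prod (fun _ _ => norm_nonneg _) fun i _ => ?_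
    simpa using norm_rise_add_le (h i) hv m
  have lb : ∀ {u v : ℂ}, ‖u - v‖ ≤ c → 1 ≤ v.re → 2 * c + 2 ≤ ‖v‖ →
      ‖rise v m‖ ≤ ((m : ℝ) + 1) ^ (2 * c + 2) * ‖rise u m‖ := fun h hv hvc => by
    simpa using norm_rise_le_add h hv hvc m
  have ne : ∀ {u v : ℂ}, ‖u - v‖ ≤ c → 1 ≤ v.re → 2 * c + 2 ≤ ‖v‖ → rise u m ≠ 0 := by
    intro u v h hv hvc h0
    have := lb h hv hvc
    rw [h0, norm_zero, mul_zero] at this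
    exact absurd this (not_le.2 (norm_rise_pos hv m))
  have den : ∀ {ι : Type} [Fintype ι] {u : ι → ℂ} {v : ℂ}, (∀ i, ‖u i - v‖ ≤ c) → 1 ≤ v.re →
      2 * c + 2 ≤ ‖v‖ → ‖∏ i, (rise (u i) m)⁻¹‖ ≤
        (((m : ℝ) + 1) ^ (2 * c + 2) * ‖rise v m‖⁻¹) ^ Fintype.card ι := by
    intro ι _ u v h hv hvc
    rw [norm_prod, ← Finset.card_univ, ← Finset.prod_const]
    refine Finset.prod_le_prod (fun _ _ => norm_nonneg _) fun i _ => ?_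
    have h1 := norm_rise_pos hv m
    have h2 : 0 < ‖rise (u i) m‖ := norm_pos_iff.2 (ne (h i) hv hvc)
    rw [norm_inv, ← div_eq_mul_inv, inv_le_iff_one_le_mul₀ h2, div_mul_eq_mul_div, one_le_div h1]
    exact lb (h i) hv hvc
  refine ⟨fun i => ne (hρ i) hw hwc, fun i => ne (hτ i) hw' hwc', ?_⟩
  have h1 := num hα hw
  have h2 := num hβ hw'
  have h3 := den hρ hw hwc
  have h4 := den hτ hw' hwc'
  rw [heq] at h2 h4
  rw [norm_mul, norm_mul, norm_mul]
  calc _ ≤ (((m : ℝ) + 1) ^ c * ‖rise w m‖) ^ Fintype.card ι₁ *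
        (((m : ℝ) + 1) ^ c * ‖rise w m‖) ^ Fintype.card ι₂ *
        ((((m : ℝ) + 1) ^ (2 * c + 2) * ‖rise w m‖⁻¹) ^ Fintype.card ι₃ *
        (((m : ℝ) + 1) ^ (2 * c + 2) * ‖rise w m‖⁻¹) ^ Fintype.card ι₄) := by gcongr
    _ = _ := by
      rw [← pow_add, ← pow_add, mul_pow, mul_pow, ← pow_mul, ← pow_mul, pow_add _ (c * _), inv_pow]
      ring

end CrudeRiseBounds

/-! ### Exponential bound for (1+it)_m -/

section ExponentialRiseBound
open Metric

theorem one_sub_mem_slitPlane {z : ℂ} (hz : z ∈ ball (0 : ℂ) 1) : 1 - z ∈ Complex.slitPlane := by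
  refine Complex.mem_slitPlane_iff.2 (Or.inl ?_)
  have h := Complex.re_le_norm z
  rw [mem_ball_zero_iff] at hz
  simp; linarith

theorem iteratedDeriv_one_sub_cpow (a : ℂ) (n : ℕ) : ∀ z ∈ ball (0 : ℂ) 1,
    iteratedDeriv n (fun z => (1 - z) ^ (-a)) z = rise a n * (1 - z) ^ (-(a + n)) := by
  induction n with
  | zero => simp [rise_zero]
  | succ n ih =>
    intro z hz
    have hev : iteratedDeriv n (fun z => (1 - z) ^ (-a)) =ᶠ[nhds z]
        fun z => rise a n * (1 - z) ^ (-(a + n)) :=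
      Filter.eventually_of_mem (isOpen_ball.mem_nhds hz) ih
    rw [iteratedDeriv_succ, hev.deriv_eq]
    have h := ((((hasDerivAt_id z).const_sub 1).cpow_const (c := -(a + n))
      (one_sub_mem_slitPlane hz))).const_mul (rise a n)
    rw [show (fun z => rise a n * (1 - z) ^ (-(a + n))) =
      fun z => rise a n * (1 - id z) ^ (-(a + n)) from rfl, h.deriv, rise_succ]
    push_cast
    rw [show -(a + (n + 1)) = -(a + n) - 1 by ring]
    simp only [id]
    ring

/-- The disc of radius R about 1 is seen from the origin under the half-angle arcsin R. -/
theorem abs_arg_one_sub_le {R : ℝ} (hR : R < 1) {z : ℂ} (hz : ‖z‖ ≤ R) :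
    |(1 - z).arg| ≤ Real.arcsin R := by
  have hR0 : 0 ≤ R := (norm_nonneg z).trans hz
  have hre : 0 ≤ (1 - z).re := by
    have h := Complex.re_le_norm z
    simp; linarith
  have h0 : 0 < ‖1 - z‖ := by
    have := norm_sub_norm_le 1 z
    rw [norm_one] at this
    linarith
  rw [Complex.arg_of_re_nonneg hre]
  have key : |(1 - z).im| / ‖1 - z‖ ≤ R := by
    rw [div_le_iff₀ h0]
    refine abs_le_of_sq_le_sq ?_ (by positivity)
    rw [mul_pow, ← Complex.normSq_eq_norm_sq, Complex.normSq_apply]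
    have h1 : z.re * z.re + z.im * z.im ≤ R ^ 2 := by
      rw [← Complex.normSq_apply, Complex.normSq_eq_norm_sq]
      gcongr
    simp only [Complex.sub_re, Complex.sub_im, Complex.one_re, Complex.one_im]
    nlinarith [sq_nonneg (z.re - R ^ 2), mul_le_mul_of_nonneg_right h1
      (by nlinarith : (0 : ℝ) ≤ 1 - R ^ 2)]
  rw [← abs_of_pos h0, ← abs_div] at key
  rw [abs_le] at key ⊢
  rw [← Real.arcsin_neg]
  exact ⟨Real.arcsin_le_arcsin key.1, Real.arcsin_le_arcsin key.2⟩

/-- The numbers (1+it)_m/m! are the Taylor coefficients of (1-z)^(-1-it). On |z| = sin θ the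
argument of 1 - z is at most θ, so the modulus is at most exp(θ|t|)/(1 - sin θ), and Cauchy's
estimate applies. This is the origin of the arcsine in the convergence region. -/
theorem norm_rise_one_add_mul_I_le {θ : ℝ} (hθ : 0 < θ) (hθ' : θ < Real.pi / 2) (t : ℝ) (m : ℕ) :
    ‖rise (1 + t * Complex.I) m‖ ≤
      (m.factorial : ℝ) * (Real.exp (θ * |t|) / (1 - Real.sin θ)) / Real.sin θ ^ m := by
  have hs : 0 < Real.sin θ := Real.sin_pos_of_pos_of_lt_pi hθ (by linarith)
  have hs1 : Real.sin θ < 1 := by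
    rw [← Real.sin_pi_div_two]
    exact Real.sin_lt_sin_of_lt_of_le_pi_div_two (by linarith) le_rfl hθ'
  have hd : DifferentiableOn ℂ (fun z : ℂ => (1 - z) ^ (-(1 + t * Complex.I))) (ball 0 1) :=
    fun z hz => (((hasDerivAt_id z).const_sub 1).cpow_const
      (one_sub_mem_slitPlane hz)).differentiableAt.differentiableWithinAt
  have h := Complex.norm_iteratedDeriv_le_of_forall_mem_sphere_norm_le (n := m) hs
    (hd.diffContOnCl_ball (closedBall_subset_ball hs1))
    (C := Real.exp (θ * |t|) / (1 - Real.sin θ)) ?_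
  · rw [iteratedDeriv_one_sub_cpow _ _ 0 (by simp)] at h
    simpa using h
  · intro z hz
    rw [mem_sphere_zero_iff_norm] at hz
    have h1 : 1 - Real.sin θ ≤ ‖1 - z‖ := by
      have := norm_sub_norm_le 1 z
      rw [norm_one, hz] at this
      exact this
    have h0 : 0 < ‖1 - z‖ := by linarith
    have harg := abs_arg_one_sub_le hs1 hz.le
    rw [Real.arcsin_sin (by linarith) hθ'.le] at harg
    rw [Complex.norm_cpow_of_ne_zero (norm_pos_iff.1 h0)]
    simp only [Complex.neg_re, Complex.add_re, Complex.one_re, Complex.mul_re, Complex.ofReal_re,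
      Complex.I_re, mul_zero, Complex.ofReal_im, Complex.I_im, mul_one, sub_self, add_zero,
      Complex.neg_im, Complex.add_im, Complex.one_im, Complex.mul_im, zero_add]
    rw [Real.rpow_neg_one, mul_neg, Real.exp_neg, div_inv_eq_mul, mul_comm, ← div_eq_mul_inv]
    have h2 : (1 - z).arg * t ≤ θ * |t| := (le_abs_self _).trans (by rw [abs_mul]; gcongr)
    have h3 : 0 < 1 - Real.sin θ := by linarith
    gcongr

theorem norm_rise_one_sub_mul_I (t : ℝ) (m : ℕ) :
    ‖rise (1 - t * Complex.I) m‖ = ‖rise (1 + t * Complex.I) m‖ := by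
  rw [rise, rise, norm_prod, norm_prod]
  refine Finset.prod_congr rfl fun i _ => ?_
  rw [← Complex.norm_conj]
  congr 1
  simp

end ExponentialRiseBound

/-! ### Absolute convergence -/

theorem summable_succ_pow_mul_pow_mul_factorial (P : ℕ) {y : ℝ} (hy : 0 ≤ y) {n₁ n₂ : ℕ}
    (h : n₁ < n₂ ∨ (n₁ = n₂ ∧ y < 1)) : Summable fun m : ℕ =>
      ((m : ℝ) + 1) ^ P * (y ^ m * ((m.factorial : ℝ) ^ n₁ / (m.factorial : ℝ) ^ n₂)) := by
  have hf : ∀ m : ℕ, (1 : ℝ) ≤ m.factorial := fun m => by exact_mod_cast m.factorial_pos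
  rcases h with h | ⟨rfl, h⟩
  · refine Summable.of_nonneg_of_le (fun m => by positivity) (fun m => ?_)
      (summable_succ_pow_mul_div_factorial P hy)
    have h1 : (m.factorial : ℝ) ^ n₁ / (m.factorial : ℝ) ^ n₂ ≤ 1 / m.factorial := by
      have := hf m
      rw [div_le_div_iff₀ (by positivity) (by positivity), one_mul, ← pow_succ]
      exact pow_le_pow_right₀ (hf m) h
    rw [div_eq_mul_one_div (y ^ m)]
    gcongr
  · refine (summable_succ_pow_mul_geometric P hy h).congr fun m => ?_
    rw [div_self (by have := hf m; positivity), mul_one]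

open MeasureTheory in
theorem lintegral_lt_top_of_rpow_decay {F : ℝ → ENNReal} {C T η : ℝ} (hT : 1 ≤ T) (hη : 1 < η)
    (h₁ : ∀ t, |t| ≤ T → F t ≤ ENNReal.ofReal C)
    (h₂ : ∀ t, T < |t| → F t ≤ ENNReal.ofReal (C * |t| ^ (-η))) : ∫⁻ t, F t < ⊤ := by
  have hg : Integrable fun t : ℝ => (1 + ‖t‖) ^ (-η) :=
    integrable_one_add_norm (by simpa using hη)
  have hi := (hg.const_mul (|C| * (1 + T) ^ η)).lintegral_lt_top
  refine (lintegral_mono fun t => ?_).trans_lt hi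
  have h0 : 0 < 1 + |t| := by positivity
  have hCC : C ≤ |C| := le_abs_self C
  rcases le_or_gt |t| T with ht | ht
  · refine (h₁ t ht).trans (ENNReal.ofReal_le_ofReal ?_)
    have h1 : (1 + |t|) ^ η ≤ (1 + T) ^ η :=
      Real.rpow_le_rpow h0.le (by linarith) (by linarith)
    have h2 : 1 ≤ (1 + T) ^ η * (1 + |t|) ^ (-η) := by
      rw [Real.rpow_neg h0.le, ← div_eq_mul_inv, one_le_div (Real.rpow_pos_of_pos h0 _)]
      exact h1
    rw [Real.norm_eq_abs, mul_assoc]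
    exact hCC.trans (le_mul_of_one_le_right (abs_nonneg C) h2)
  · refine (h₂ t ht).trans (ENNReal.ofReal_le_ofReal ?_)
    have ht0 : 0 < |t| := by linarith
    have h1 : (1 + |t|) ^ η ≤ (1 + T) ^ η * |t| ^ η := by
      rw [← Real.mul_rpow (by linarith) ht0.le]
      exact Real.rpow_le_rpow h0.le (by nlinarith) (by linarith)
    have h2 : |t| ^ (-η) ≤ (1 + T) ^ η * (1 + |t|) ^ (-η) := by
      rw [Real.rpow_neg ht0.le, Real.rpow_neg h0.le, ← div_eq_mul_inv,
        inv_le_iff_one_le_mul₀ (Real.rpow_pos_of_pos ht0 _), div_mul_eq_mul_div,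
        one_le_div (Real.rpow_pos_of_pos h0 _)]
      exact h1
    rw [Real.norm_eq_abs, mul_assoc]
    have h3 : 0 ≤ |t| ^ (-η) := Real.rpow_nonneg ht0.le _
    calc C * |t| ^ (-η) ≤ |C| * |t| ^ (-η) := by gcongr
      _ ≤ _ := by gcongr

namespace MBParams
open Filter Topology MeasureTheory

variable {A B C D E F G H J K : ℕ}

theorem exists_norm_coef_le (p : MBParams A B C D E F G H J K)
    (hf : ∀ i, ¬ IsNonposInt (p.f i)) (x : ℂ) : ∃ (M : ℝ) (P : ℕ), 0 ≤ M ∧ ∀ m : ℕ,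
      ‖p.coef x m‖ ≤ M * (((m : ℝ) + 1) ^ P *
        (‖x‖ ^ m * ((m.factorial : ℝ) ^ E / (m.factorial : ℝ) ^ (F + 1)))) := by
  choose P hP using fun i => exists_norm_rise_le (p.e i)
  choose M Q hM hQ using fun i => exists_factorial_le_norm_rise (hf i)
  refine ⟨∏ i, M i, (∑ i, P i) + ∑ i, Q i, Finset.prod_nonneg fun i _ => hM i, fun m => ?_⟩
  have hfac : (0 : ℝ) < m.factorial := by exact_mod_cast m.factorial_pos
  have h1 : ‖∏ i, rise (p.e i) m‖ ≤ ((m : ℝ) + 1) ^ (∑ i, P i) * (m.factorial : ℝ) ^ E := by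
    rw [norm_prod]
    refine (Finset.prod_le_prod (fun i _ => norm_nonneg _) fun i _ => hP i m).trans_eq ?_
    rw [Finset.prod_mul_distrib, Finset.prod_pow_eq_pow_sum]; simp
  have h2 : (m.factorial : ℝ) ^ F ≤
      (∏ i, M i) * ((m : ℝ) + 1) ^ (∑ i, Q i) * ‖∏ i, rise (p.f i) m‖ := by
    calc (m.factorial : ℝ) ^ F = ∏ _i : Fin F, (m.factorial : ℝ) := by simp
      _ ≤ ∏ i, (M i * ((m : ℝ) + 1) ^ Q i * ‖rise (p.f i) m‖) :=
        Finset.prod_le_prod (fun i _ => hfac.le) fun i _ => hQ i m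
      _ = _ := by
        rw [Finset.prod_mul_distrib, Finset.prod_mul_distrib, Finset.prod_pow_eq_pow_sum, norm_prod]
  have h3 : 0 < ‖∏ i, rise (p.f i) m‖ :=
    norm_pos_iff.2 (Finset.prod_ne_zero_iff.2 fun i _ => rise_ne_zero (hf i) m)
  have h4 : ‖∏ i, rise (p.f i) m‖⁻¹ ≤
      (∏ i, M i) * ((m : ℝ) + 1) ^ (∑ i, Q i) / (m.factorial : ℝ) ^ F := by
    rw [inv_le_iff_one_le_mul₀ h3, div_mul_eq_mul_div, one_le_div (by positivity)]
    exact h2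
  rw [coef, norm_div, norm_mul, norm_div, norm_pow, Complex.norm_natCast, div_eq_mul_inv _ ‖∏ i, _‖]
  calc _ ≤ (((m : ℝ) + 1) ^ (∑ i, P i) * (m.factorial : ℝ) ^ E) *
        ((∏ i, M i) * ((m : ℝ) + 1) ^ (∑ i, Q i) / (m.factorial : ℝ) ^ F) * ‖x‖ ^ m /
          m.factorial := by gcongr
    _ = _ := by rw [pow_add, pow_succ]; field_simp

theorem norm_integrand_le {p : MBParams A B C D E F G H J K} {γ : ℝ → ℂ} (hγ : p.IsContour γ)
    (x ℓ : ℂ) (m : ℕ) (t : ℝ) : ‖p.integrand γ x ℓ m t‖ ≤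
      ‖p.coef x m‖ * ‖p.kern m (γ t)‖ * ‖Complex.exp (ℓ * γ t) * deriv γ t‖ := by
  rw [integrand, mul_assoc _ (Complex.exp _), norm_mul, ← norm_mul (p.coef x m)]
  gcongr
  exact norm_gammaRatio_mul_hypTerm_le p x m (fun i => hγ.not_nonposInt_a i t)
    fun i => hγ.not_nonposInt_b i t

/-- Finitely many integrable terms; decay is required only for those that occur. -/
theorem IsContour.absConv_of_finite {p : MBParams A B C D E F G H J K} {γ : ℝ → ℂ}
    (hγ : p.IsContour γ) {x ℓ : ℂ} {M : ℕ} (hM : ∀ m, M ≤ m → p.coef x m = 0)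
    (hdec : ∀ m, p.coef x m ≠ 0 → DecaysInStrips fun s => p.kern m s * Complex.exp (ℓ * s)) :
    ∫⁻ t, ∑' m, ‖p.integrand γ x ℓ m t‖ₑ < ⊤ := by
  obtain ⟨σ, T, hv⟩ := hγ.vertical
  rw [lintegral_tsum fun m => (hγ.aestronglyMeasurable_integrand x ℓ m).enorm]
  have hz : ∀ m, p.coef x m = 0 → ∫⁻ t, ‖p.integrand γ x ℓ m t‖ₑ = 0 := by
    intro m hm
    have : ∀ t, p.integrand γ x ℓ m t = 0 := fun t => by simp [integrand, hypTerm_eq, hm]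
    simp [this]
  rw [tsum_eq_sum (s := Finset.range M) fun m hm => hz m (hM m (by simpa using hm))]
  refine ENNReal.sum_lt_top.2 fun m _ => ?_
  by_cases h : p.coef x m = 0
  · rw [hz m h]; exact ENNReal.zero_lt_top
  · have hi := ((hdec m h).integrable_comp hγ.contDiff hv ((hγ.continuous_kern m).mul
      (Complex.continuous_exp.comp (continuous_const.mul hγ.contDiff.continuous)))).const_mul
        (p.coef x m)
    exact (hi.congr (hγ.ae_eq x ℓ m).symm).2

theorem kern_add (p : MBParams A B C D E F G H J K) (M k : ℕ) (s : ℂ)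
    (ha : ∀ i, ¬ IsNonposInt (p.a i + M + s)) (hb : ∀ i, ¬ IsNonposInt (p.b i + M - s))
    (hc : ∀ i, rise (p.c i + M + s) k ≠ 0) (hd : ∀ i, rise (p.d i + M - s) k ≠ 0) :
    p.kern (M + k) s = p.kern M s *
      ((∏ i, rise (p.a i + M + s) k) * (∏ i, rise (p.b i + M - s) k) *
        ((∏ i, (rise (p.c i + M + s) k)⁻¹) * ∏ i, (rise (p.d i + M - s) k)⁻¹)) := by
  have g1 : ∀ i, Complex.Gamma (p.a i + (M + k : ℕ) + s) =
      rise (p.a i + M + s) k * Complex.Gamma (p.a i + M + s) := fun i => by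
    rw [← Gamma_add_natCast (ha i)]; congr 1; push_cast; ring
  have g2 : ∀ i, Complex.Gamma (p.b i + (M + k : ℕ) - s) =
      rise (p.b i + M - s) k * Complex.Gamma (p.b i + M - s) := fun i => by
    rw [← Gamma_add_natCast (hb i)]; congr 1; push_cast; ring
  have g3 : ∀ i, (Complex.Gamma (p.c i + (M + k : ℕ) + s))⁻¹ =
      (Complex.Gamma (p.c i + M + s))⁻¹ * (rise (p.c i + M + s) k)⁻¹ := fun i => by
    rw [← rise_add_natCast_inv (hc i)]; congr 2; push_cast; ring
  have g4 : ∀ i, (Complex.Gamma (p.d i + (M + k : ℕ) - s))⁻¹ =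
      (Complex.Gamma (p.d i + M - s))⁻¹ * (rise (p.d i + M - s) k)⁻¹ := fun i => by
    rw [← rise_add_natCast_inv (hd i)]; congr 2; push_cast; ring
  rw [kern, kern, mbKernel_eq, mbKernel_eq]
  simp only [leftNum, rightNum, leftDen, rightDen, Fintype.prod_sum_type, Sum.elim_inl,
    Sum.elim_inr, g1, g2, g3, g4, Finset.prod_mul_distrib]
  ring

theorem IsContour.not_nonposInt_a_add {p : MBParams A B C D E F G H J K} {γ : ℝ → ℂ}
    (hγ : p.IsContour γ) (i : Fin A) (M : ℕ) (t : ℝ) : ¬ IsNonposInt (p.a i + M + γ t) := by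
  rintro ⟨n, hn⟩
  exact (hγ.left_a i (M + n)).1 t (by push_cast; linear_combination hn)

theorem IsContour.not_nonposInt_b_add {p : MBParams A B C D E F G H J K} {γ : ℝ → ℂ}
    (hγ : p.IsContour γ) (i : Fin B) (M : ℕ) (t : ℝ) : ¬ IsNonposInt (p.b i + M - γ t) := by
  rintro ⟨n, hn⟩
  exact (hγ.right_b i (M + n)).1 t (by push_cast; linear_combination -hn)

/-- A bound for all the parameters that are shifted by `m` in the kernels. -/
noncomputable def size (p : MBParams A B C D E F G H J K) : ℝ :=
  (∑ i, ‖p.a i‖) + (∑ i, ‖p.b i‖) + (∑ i, ‖p.c i‖) + ∑ i, ‖p.d i‖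

theorem norm_le_size (p : MBParams A B C D E F G H J K) :
    (∀ i, ‖p.a i‖ ≤ p.size) ∧ (∀ i, ‖p.b i‖ ≤ p.size) ∧ (∀ i, ‖p.c i‖ ≤ p.size) ∧
      ∀ i, ‖p.d i‖ ≤ p.size := by
  have h0 : ∀ {n : ℕ} (u : Fin n → ℂ), 0 ≤ ∑ i, ‖u i‖ := fun u =>
    Finset.sum_nonneg fun _ _ => norm_nonneg _
  have h1 : ∀ {n : ℕ} (u : Fin n → ℂ) (i : Fin n), ‖u i‖ ≤ ∑ i, ‖u i‖ := fun u i =>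
    Finset.single_le_sum (f := fun i => ‖u i‖) (fun _ _ => norm_nonneg _) (Finset.mem_univ i)
  have ha := h0 p.a
  have hb := h0 p.b
  have hc := h0 p.c
  have hd := h0 p.d
  refine ⟨fun i => ?_, fun i => ?_, fun i => ?_, fun i => ?_⟩ <;> unfold size
  · linarith [h1 p.a i]
  · linarith [h1 p.b i]
  · linarith [h1 p.c i]
  · linarith [h1 p.d i]

/-- Uniform bound for the kernels on the compact part of the contour. -/
theorem IsContour.exists_norm_kern_le {p : MBParams A B C D E F G H J K} {γ : ℝ → ℂ}
    (hγ : p.IsContour γ) (R : ℝ) : ∃ (M : ℝ) (P : ℕ), 0 ≤ M ∧ ∀ (m : ℕ) (t : ℝ), |t| ≤ R →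
      ‖p.kern m (γ t)‖ ≤ M * (((m : ℝ) + 1) ^ P *
        ((m.factorial : ℝ) ^ (A + B) / (m.factorial : ℝ) ^ (C + D))) := by
  obtain ⟨Y, hY⟩ := (isCompact_Icc (a := -R) (b := R)).exists_bound_of_continuousOn
    hγ.contDiff.continuous.continuousOn
  choose S hS using fun m => (isCompact_Icc (a := -R) (b := R)).exists_bound_of_continuousOn
    (hγ.continuous_kern m).continuousOn
  obtain ⟨c, hc⟩ := exists_nat_ge (p.size + |Y| + 1)
  -- The kernels with m ≤ N are bounded by compactness. From N on, the reference point 1 + N = 2c +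
  -- 2 is far enough out, and its rising factorial is (N+k)!/N!.
  set N := 2 * c + 1 with hN
  have hfac : ∀ m : ℕ, (0 : ℝ) < m.factorial := fun m => by exact_mod_cast m.factorial_pos
  set q : ℕ → ℝ := fun m => (m.factorial : ℝ) ^ (A + B) / (m.factorial : ℝ) ^ (C + D) with hq
  have hq0 : ∀ m, 0 < q m := fun m => by have := hfac m; positivity
  have hterm : ∀ i ∈ Finset.range (N + 1), 0 ≤ |S i| / q i := fun i _ => by
    have := hq0 i; positivity
  set M := ∑ i ∈ Finset.range (N + 1), |S i| / q i
  have hM0 : 0 ≤ M := Finset.sum_nonneg hterm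
  have hM : ∀ i ≤ N, ∀ t : ℝ, |t| ≤ R → ‖p.kern i (γ t)‖ ≤ M * q i := fun i hi t ht => by
    refine ((hS i t (abs_le.1 ht)).trans (le_abs_self _)).trans ?_
    rw [← div_le_iff₀ (hq0 i)]
    exact Finset.single_le_sum hterm (Finset.mem_range.2 (Nat.lt_succ_of_le hi))
  set P := c * (A + B) + (2 * c + 2) * (C + D) with hP
  refine ⟨M, P, hM0, fun m t ht => ?_⟩
  rcases le_total m N with h | h
  · refine (hM m h t ht).trans ?_
    have h1 : (1 : ℝ) ≤ ((m : ℝ) + 1) ^ P := one_le_pow₀ (by linarith [Nat.cast_nonneg (α := ℝ) m])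
    gcongr
    exact le_mul_of_one_le_left (hq0 m).le h1
  · obtain ⟨k, rfl⟩ := Nat.exists_eq_add_of_le h
    obtain ⟨sa, sb, sc, sd⟩ := p.norm_le_size
    have hg : ‖γ t‖ ≤ |Y| := (hY t (abs_le.1 ht)).trans (le_abs_self _)
    have e1 : ∀ {z : ℂ}, ‖z‖ ≤ p.size → ‖z + N + γ t - (1 + N)‖ ≤ c := fun {z} hz => by
      rw [show z + N + γ t - (1 + N) = z + γ t - 1 by ring]
      refine (norm_sub_le _ _).trans ?_
      have := norm_add_le z (γ t)
      rw [norm_one]; linarith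
    have e2 : ∀ {z : ℂ}, ‖z‖ ≤ p.size → ‖z + N - γ t - (1 + N)‖ ≤ c := fun {z} hz => by
      rw [show z + N - γ t - (1 + N) = z - γ t - 1 by ring]
      refine (norm_sub_le _ _).trans ?_
      have := norm_sub_le z (γ t)
      rw [norm_one]; linarith
    have hwre : (1 : ℝ) ≤ (1 + N : ℂ).re := by simp
    have hwn : 2 * (c : ℝ) + 2 ≤ ‖(1 + N : ℂ)‖ := by
      rw [show (1 + N : ℂ) = ((1 + N : ℕ) : ℂ) by push_cast; rfl, Complex.norm_natCast, hN]
      push_cast; linarith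
    obtain ⟨n1, n2, n3⟩ := norm_prod_rise_quot_le (m := k) (fun i => e1 (sa i)) (fun i => e2 (sb i))
      (fun i => e1 (sc i)) (fun i => e2 (sd i)) hwre hwre hwn hwn rfl
    simp only [Fintype.card_fin] at n3
    have hR : ((N + k).factorial : ℝ) = N.factorial * ‖rise (1 + N : ℂ) k‖ := by
      rw [← Complex.norm_natCast, ← rise_one, rise_add, norm_mul, rise_one, Complex.norm_natCast]
    have hR0 := norm_rise_pos hwre k
    rw [kern_add p N k (γ t) (fun i => hγ.not_nonposInt_a_add i N t)
      (fun i => hγ.not_nonposInt_b_add i N t) n1 n2, norm_mul]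
    calc _ ≤ (M * q N) * (((k : ℝ) + 1) ^ P * (‖rise (1 + N : ℂ) k‖ ^ (A + B) /
          ‖rise (1 + N : ℂ) k‖ ^ (C + D))) := by
          have := (hq0 N).le
          gcongr; exact hM N le_rfl t ht
      _ ≤ (M * q N) * ((((N + k : ℕ) : ℝ) + 1) ^ P * (‖rise (1 + N : ℂ) k‖ ^ (A + B) /
          ‖rise (1 + N : ℂ) k‖ ^ (C + D))) := by
          have := (hq0 N).le
          gcongr; simp
      _ = _ := by
          rw [hR, mul_pow, mul_pow, hq]
          field_simp

end MBParams

theorem deriv_eq_I_of_vertical {γ : ℝ → ℂ} {σ T : ℝ}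
    (hv : ∀ t : ℝ, T ≤ |t| → γ t = (σ : ℂ) + (t : ℂ) * Complex.I) {t : ℝ} (ht : T < |t|) :
    deriv γ t = Complex.I := by
  have he : γ =ᶠ[nhds t] fun t : ℝ => (σ : ℂ) + (t : ℂ) * Complex.I := by
    have : ∀ᶠ u in nhds t, T < |u| := continuous_abs.continuousAt.eventually_const_lt ht
    filter_upwards [this] with u hu using hv u hu.le
  rw [he.deriv_eq]
  have : HasDerivAt (fun t : ℝ => (σ : ℂ) + (t : ℂ) * Complex.I) (Complex.ofRealCLM 1 * Complex.I) t :=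
    ((Complex.ofRealCLM.hasDerivAt (x := t)).mul_const Complex.I).const_add (σ : ℂ)
  rw [this.deriv]; simp

namespace MBParams
open Filter Topology MeasureTheory

variable {A B C D E F G H J K : ℕ}

/-- On the vertical ends a + s and c + s stay within a fixed distance of 1 + it, and b - s and d - s
of 1 - it, so the dependence on m and t is carried by |(1+it)_m|. -/
theorem IsContour.exists_norm_integrand_le_tail {p : MBParams A B C D E F G H J K} {γ : ℝ → ℂ}
    (hγ : p.IsContour γ) {σ T : ℝ}
    (hv : ∀ t : ℝ, T ≤ |t| → γ t = (σ : ℂ) + (t : ℂ) * Complex.I) (x ℓ : ℂ) :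
    ∃ (T' : ℝ) (P : ℕ), ∀ (m : ℕ) (t : ℝ), T' < |t| → ‖p.integrand γ x ℓ m t‖ ≤
      ‖p.coef x m‖ * (((m : ℝ) + 1) ^ P * (‖rise (1 + t * Complex.I) m‖ ^ (A + B) /
        ‖rise (1 + t * Complex.I) m‖ ^ (C + D))) *
        ‖p.kern 0 (σ + t * Complex.I) * Complex.exp (ℓ * (σ + t * Complex.I))‖ := by
  obtain ⟨c, hc⟩ := exists_nat_ge (p.size + |σ| + 1)
  refine ⟨max T (2 * c + 2), c * (A + B) + (2 * c + 2) * (C + D), fun m t ht => ?_⟩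
  have ht1 : T < |t| := (le_max_left _ _).trans_lt ht
  have ht2 : 2 * (c : ℝ) + 2 ≤ |t| := (le_max_right _ _).trans ht.le
  obtain ⟨sa, sb, sc, sd⟩ := p.norm_le_size
  have hγt := hv t ht1.le
  have hσ : ‖(σ : ℂ)‖ = |σ| := by rw [Complex.norm_real, Real.norm_eq_abs]
  have e1 : ∀ {z : ℂ}, ‖z‖ ≤ p.size → ‖z + (0 : ℕ) + γ t - (1 + t * Complex.I)‖ ≤ c := fun {z} hz => by
    rw [hγt, show z + (0 : ℕ) + (σ + t * Complex.I) - (1 + t * Complex.I) = z + σ - 1 by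
      push_cast; ring]
    refine (norm_sub_le _ _).trans ?_
    have := norm_add_le z σ
    rw [norm_one]; linarith
  have e2 : ∀ {z : ℂ}, ‖z‖ ≤ p.size → ‖z + (0 : ℕ) - γ t - (1 - t * Complex.I)‖ ≤ c := fun {z} hz => by
    rw [hγt, show z + (0 : ℕ) - (σ + t * Complex.I) - (1 - t * Complex.I) = z - σ - 1 by
      push_cast; ring]
    refine (norm_sub_le _ _).trans ?_
    have := norm_sub_le z σ
    rw [norm_one]; linarith
  have w1 : 2 * (c : ℝ) + 2 ≤ ‖1 + t * Complex.I‖ := ht2.trans (by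
    simpa using Complex.abs_im_le_norm (1 + t * Complex.I))
  have w2 : 2 * (c : ℝ) + 2 ≤ ‖1 - t * Complex.I‖ := ht2.trans (by
    simpa using Complex.abs_im_le_norm (1 - t * Complex.I))
  obtain ⟨n1, n2, n3⟩ := norm_prod_rise_quot_le (m := m) (fun i => e1 (sa i)) (fun i => e2 (sb i))
    (fun i => e1 (sc i)) (fun i => e2 (sd i)) (by simp) (by simp) w1 w2
    (norm_rise_one_sub_mul_I t m)
  simp only [Fintype.card_fin] at n3
  have hk := kern_add p 0 m (γ t) (fun i => hγ.not_nonposInt_a_add i 0 t)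
    (fun i => hγ.not_nonposInt_b_add i 0 t) n1 n2
  rw [zero_add] at hk
  refine (norm_integrand_le hγ x ℓ m t).trans ?_
  rw [hk, norm_mul (p.kern 0 _), norm_mul _ (deriv γ t), deriv_eq_I_of_vertical hv ht1,
    Complex.norm_I, mul_one, ← hγt, norm_mul (p.kern 0 _)]
  refine (mul_le_mul_of_nonneg_right (mul_le_mul_of_nonneg_left (mul_le_mul_of_nonneg_left n3
    (norm_nonneg _)) (norm_nonneg _)) (norm_nonneg _)).trans_eq ?_
  ring

/-- Common frame of the two cases. A bound of the form y^m exp(κ|t|) is split: y^m is charged to the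
radius of convergence, exp(κ|t|) to the decay of the kernel with m = 0. The compact part of the
contour needs only |x| < 1, the ends need |x| y < 1. -/
theorem IsContour.lintegral_lt_top_of_rise_bound {p : MBParams A B C D E F G H J K} {γ : ℝ → ℂ}
    (hγ : p.IsContour γ) (hf : ∀ i, ¬ IsNonposInt (p.f i)) {x ℓ : ℂ} {κ Q y : ℝ} (hQ : 0 ≤ Q)
    (hy : 0 ≤ y)
    (hconv : A + B + E < C + D + (F + 1) ∨
      (A + B + E = C + D + (F + 1) ∧ ‖x‖ < 1 ∧ ‖x‖ * y < 1))
    (hdec : ∀ σ : ℝ, ∃ S T η : ℝ, 1 < η ∧ ∀ t : ℝ, T ≤ |t| →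
      ‖p.kern 0 (σ + t * Complex.I) * Complex.exp (ℓ * (σ + t * Complex.I))‖ *
        Real.exp (κ * |t|) ≤ S * |t| ^ (-η))
    (hrise : ∀ (t : ℝ) (m : ℕ), ‖rise (1 + t * Complex.I) m‖ ^ (A + B) /
        ‖rise (1 + t * Complex.I) m‖ ^ (C + D) ≤
      Q * (y ^ m * ((m.factorial : ℝ) ^ (A + B) / (m.factorial : ℝ) ^ (C + D))) *
        Real.exp (κ * |t|)) :
    ∫⁻ t, ∑' m, ‖p.integrand γ x ℓ m t‖ₑ < ⊤ := by
  obtain ⟨σ, T, hv⟩ := hγ.vertical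
  obtain ⟨S, T₁, η, hη, hS⟩ := hdec σ
  obtain ⟨T₂, P₂, h₂⟩ := hγ.exists_norm_integrand_le_tail hv x ℓ
  obtain ⟨M₀, P₀, hM₀, h₀⟩ := p.exists_norm_coef_le hf x
  set R := max 1 (max T₁ T₂) with hR
  obtain ⟨M₁, P₁, hM₁, h₁⟩ := hγ.exists_norm_kern_le R
  obtain ⟨Y, hY⟩ := (isCompact_Icc (a := -R) (b := R)).exists_bound_of_continuousOn
    (f := fun t => Complex.exp (ℓ * γ t) * deriv γ t)
    ((Complex.continuous_exp.comp (continuous_const.mul hγ.contDiff.continuous)).mul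
      (hγ.contDiff.continuous_deriv le_rfl)).continuousOn
  have hfac : ∀ m : ℕ, (0 : ℝ) < m.factorial := fun m => by exact_mod_cast m.factorial_pos
  have sum₁ := (summable_succ_pow_mul_pow_mul_factorial (P₀ + P₁) (norm_nonneg x)
    (hconv.imp_right fun h => ⟨h.1, h.2.1⟩)).mul_left (M₀ * M₁ * |Y|)
  have sum₂ := (summable_succ_pow_mul_pow_mul_factorial (P₀ + P₂) (mul_nonneg (norm_nonneg x) hy)
    (hconv.imp_right fun h => ⟨h.1, h.2.2⟩)).mul_left (M₀ * Q * |S|)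
  set b₁ : ℕ → ℝ := fun m => M₀ * M₁ * |Y| * (((m : ℝ) + 1) ^ (P₀ + P₁) * (‖x‖ ^ m *
    ((m.factorial : ℝ) ^ (A + B + E) / (m.factorial : ℝ) ^ (C + D + (F + 1))))) with hb₁
  set b₂ : ℕ → ℝ := fun m => M₀ * Q * |S| * (((m : ℝ) + 1) ^ (P₀ + P₂) * ((‖x‖ * y) ^ m *
    ((m.factorial : ℝ) ^ (A + B + E) / (m.factorial : ℝ) ^ (C + D + (F + 1))))) with hb₂
  have pos₁ : ∀ m, 0 ≤ b₁ m := fun m => by have := hfac m; positivity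
  have pos₂ : ∀ m, 0 ≤ b₂ m := fun m => by have := hfac m; positivity
  have c1 : ∀ m t, |t| ≤ R → ‖p.integrand γ x ℓ m t‖ ≤ b₁ m := by
    intro m t ht
    refine (norm_integrand_le hγ x ℓ m t).trans ?_
    have i1 := h₁ m t ht
    have i2 := (hY t (abs_le.1 ht)).trans (le_abs_self Y)
    have := hfac m
    calc _ ≤ (M₀ * (((m : ℝ) + 1) ^ P₀ *
          (‖x‖ ^ m * ((m.factorial : ℝ) ^ E / (m.factorial : ℝ) ^ (F + 1))))) *
          (M₁ * (((m : ℝ) + 1) ^ P₁ *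
          ((m.factorial : ℝ) ^ (A + B) / (m.factorial : ℝ) ^ (C + D)))) * |Y| := by
          gcongr; exact h₀ m
      _ = b₁ m := by
        rw [hb₁]
        simp only [pow_add _ P₀, pow_add _ (A + B), pow_add _ (C + D)]
        field_simp
  have c2 : ∀ m t, R < |t| → ‖p.integrand γ x ℓ m t‖ ≤ b₂ m * |t| ^ (-η) := by
    intro m t ht
    have t1 : T₁ ≤ |t| := ((le_max_left _ _).trans (le_max_right _ _)).trans ht.le
    have t2 : T₂ < |t| := ((le_max_right _ _).trans (le_max_right _ _)).trans_lt ht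
    have i1 := (hS t t1).trans (mul_le_mul_of_nonneg_right (le_abs_self S)
      (Real.rpow_nonneg (abs_nonneg t) _))
    have := hfac m
    refine (h₂ m t t2).trans ?_
    calc _ ≤ (M₀ * (((m : ℝ) + 1) ^ P₀ *
          (‖x‖ ^ m * ((m.factorial : ℝ) ^ E / (m.factorial : ℝ) ^ (F + 1))))) *
          (((m : ℝ) + 1) ^ P₂ * (Q * (y ^ m * ((m.factorial : ℝ) ^ (A + B) /
            (m.factorial : ℝ) ^ (C + D))) * Real.exp (κ * |t|))) *
          ‖p.kern 0 (σ + t * Complex.I) * Complex.exp (ℓ * (σ + t * Complex.I))‖ := by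
          gcongr
          · exact h₀ m
          · exact hrise t m
      _ = (M₀ * (((m : ℝ) + 1) ^ P₀ *
          (‖x‖ ^ m * ((m.factorial : ℝ) ^ E / (m.factorial : ℝ) ^ (F + 1))))) *
          (((m : ℝ) + 1) ^ P₂ * (Q * (y ^ m * ((m.factorial : ℝ) ^ (A + B) /
            (m.factorial : ℝ) ^ (C + D))))) *
          (‖p.kern 0 (σ + t * Complex.I) * Complex.exp (ℓ * (σ + t * Complex.I))‖ *
            Real.exp (κ * |t|)) := by ring
      _ ≤ (M₀ * (((m : ℝ) + 1) ^ P₀ *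
          (‖x‖ ^ m * ((m.factorial : ℝ) ^ E / (m.factorial : ℝ) ^ (F + 1))))) *
          (((m : ℝ) + 1) ^ P₂ * (Q * (y ^ m * ((m.factorial : ℝ) ^ (A + B) /
            (m.factorial : ℝ) ^ (C + D))))) * (|S| * |t| ^ (-η)) := by gcongr
      _ = b₂ m * |t| ^ (-η) := by
        rw [hb₂]
        simp only [pow_add _ P₀, pow_add _ (A + B), pow_add _ (C + D), mul_pow]
        field_simp
  have key : ∀ {b : ℕ → ℝ} {t : ℝ}, Summable b → (∀ m, ‖p.integrand γ x ℓ m t‖ ≤ b m) →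
      ∑' m, ‖p.integrand γ x ℓ m t‖ₑ ≤ ENNReal.ofReal (∑' m, b m) := by
    intro b t hb h
    rw [ENNReal.ofReal_tsum_of_nonneg (fun m => (norm_nonneg _).trans (h m)) hb]
    refine ENNReal.tsum_le_tsum fun m => ?_
    rw [← ofReal_norm]
    exact ENNReal.ofReal_le_ofReal (h m)
  refine lintegral_lt_top_of_rpow_decay (C := (∑' m, b₁ m) + ∑' m, b₂ m) (T := R)
    (le_max_left _ _) hη (fun t ht => ?_) fun t ht => ?_
  · exact (key sum₁ fun m => c1 m t ht).trans
      (ENNReal.ofReal_le_ofReal (le_add_of_nonneg_right (tsum_nonneg pos₂)))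
  · refine (key (sum₂.mul_right _) fun m => c2 m t ht).trans (ENNReal.ofReal_le_ofReal ?_)
    rw [tsum_mul_right]
    have : 0 ≤ |t| ^ (-η) := Real.rpow_nonneg (abs_nonneg t) _
    have : 0 ≤ ∑' m, b₁ m := tsum_nonneg pos₁
    gcongr
    linarith

/-- The case `A + B ≤ C + D`, in which the hypergeometric series is bounded uniformly on the
contour. -/
theorem IsContour.lintegral_lt_top_of_le {p : MBParams A B C D E F G H J K} {γ : ℝ → ℂ}
    (hγ : p.IsContour γ) (hf : ∀ i, ¬ IsNonposInt (p.f i)) {x ℓ : ℂ} (hle : A + B ≤ C + D)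
    (hconv : A + B + E < C + D + (F + 1) ∨ (A + B + E = C + D + (F + 1) ∧ ‖x‖ < 1))
    (hdec : DecaysInStrips fun s => p.kern 0 s * Complex.exp (ℓ * s)) :
    ∫⁻ t, ∑' m, ‖p.integrand γ x ℓ m t‖ₑ < ⊤ := by
  refine hγ.lintegral_lt_top_of_rise_bound hf (κ := 0) zero_le_one zero_le_one
    (hconv.imp_right fun h => ⟨h.1, h.2, by rw [mul_one]; exact h.2⟩) (fun σ => ?_) fun t m => ?_
  · obtain ⟨S, T, η, -, hη, h⟩ := hdec |σ| (abs_nonneg _)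
    refine ⟨S, T, η, hη, fun t ht => ?_⟩
    rw [zero_mul, Real.exp_zero, mul_one]
    exact h σ t le_rfl ht
  · have hre : (1 : ℝ) ≤ (1 + t * Complex.I : ℂ).re := by simp
    have h1 := factorial_le_norm_rise hre m
    have h2 : (0 : ℝ) < m.factorial := by exact_mod_cast m.factorial_pos
    have h3 := norm_rise_pos hre m
    rw [zero_mul, Real.exp_zero, mul_one, one_pow, one_mul, one_mul]
    -- With C + D = A + B + n both quotients are n-th powers of reciprocals, and |(1+it)_m| ≥ m!
    -- compares them.
    obtain ⟨n, hn⟩ := Nat.exists_eq_add_of_le hle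
    simp only [hn, pow_add _ (A + B) n]
    rw [div_mul_cancel_left₀ (pow_pos h3 _).ne', div_mul_cancel_left₀ (pow_pos h2 _).ne']
    gcongr

/-- The factor exp(κ|t|) is absorbed by enlarging |Im ℓ| by κ, with the sign of the new imaginary
part chosen according to the sign of t. -/
theorem exists_norm_kern_mul_exp_le (p : MBParams A B C D E F G H J K) {ℓ : ℂ} {κ : ℝ} (hκ : 0 ≤ κ)
    (hℓ : |ℓ.im| + κ < Real.pi / 2 * ((A : ℝ) + G + B + H - C - D - J - K)) (σ : ℝ) :
    ∃ S T η : ℝ, 1 < η ∧ ∀ t : ℝ, T ≤ |t| →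
      ‖p.kern 0 (σ + t * Complex.I) * Complex.exp (ℓ * (σ + t * Complex.I))‖ *
        Real.exp (κ * |t|) ≤ S * |t| ^ (-η) := by
  have habs : |(|ℓ.im| + κ)| = |ℓ.im| + κ := abs_of_nonneg (by positivity)
  obtain ⟨S₁, T₁, η₁, hT₁, hη₁, h₁⟩ := p.decaysInStrips_kern
    (ℓ := ⟨ℓ.re, |ℓ.im| + κ⟩) (by rwa [habs]) 0 |σ| (abs_nonneg _)
  obtain ⟨S₂, T₂, η₂, hT₂, hη₂, h₂⟩ := p.decaysInStrips_kern
    (ℓ := ⟨ℓ.re, -(|ℓ.im| + κ)⟩) (by rwa [abs_neg, habs]) 0 |σ| (abs_nonneg _)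
  refine ⟨|S₁| + |S₂|, max T₁ T₂, min η₁ η₂, lt_min hη₁ hη₂, fun t ht => ?_⟩
  have t1 : T₁ ≤ |t| := (le_max_left _ _).trans ht
  have t2 : T₂ ≤ |t| := (le_max_right _ _).trans ht
  have hp1 : |t| ^ (-η₁) ≤ |t| ^ (-(min η₁ η₂)) :=
    Real.rpow_le_rpow_of_exponent_le (by linarith) (neg_le_neg (min_le_left _ _))
  have hp2 : |t| ^ (-η₂) ≤ |t| ^ (-(min η₁ η₂)) :=
    Real.rpow_le_rpow_of_exponent_le (by linarith) (neg_le_neg (min_le_right _ _))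
  have hp0 : 0 ≤ |t| ^ (-η₁) := Real.rpow_nonneg (abs_nonneg t) _
  have hp0' : 0 ≤ |t| ^ (-η₂) := Real.rpow_nonneg (abs_nonneg t) _
  have key : ∀ ε : ℝ, -(ℓ.im * t) + κ * |t| ≤ -(ε * t) →
      ‖p.kern 0 (σ + t * Complex.I) * Complex.exp (ℓ * (σ + t * Complex.I))‖ *
        Real.exp (κ * |t|) ≤ ‖p.kern 0 (σ + t * Complex.I) *
          Complex.exp ((⟨ℓ.re, ε⟩ : ℂ) * (σ + t * Complex.I))‖ := by
    intro ε hε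
    rw [norm_mul, norm_mul, mul_assoc, Complex.norm_exp, Complex.norm_exp, ← Real.exp_add]
    refine mul_le_mul_of_nonneg_left (Real.exp_le_exp.2 ?_) (norm_nonneg _)
    simp only [Complex.mul_re, Complex.add_re, Complex.ofReal_re, Complex.I_re, mul_zero,
      Complex.ofReal_im, Complex.I_im, mul_one, sub_self, add_zero, Complex.add_im,
      Complex.mul_im, zero_add]
    linarith
  have hb1 : -ℓ.im ≤ |ℓ.im| := neg_le_abs _
  have hb2 : ℓ.im ≤ |ℓ.im| := le_abs_self _
  rcases le_total 0 t with h | h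
  · refine (key _ ?_).trans ((h₂ σ t le_rfl t2).trans ?_)
    · rw [abs_of_nonneg h]; nlinarith
    · calc S₂ * |t| ^ (-η₂) ≤ (|S₁| + |S₂|) * |t| ^ (-η₂) := by
            gcongr; linarith [le_abs_self S₂, abs_nonneg S₁]
        _ ≤ _ := by gcongr
  · refine (key _ ?_).trans ((h₁ σ t le_rfl t1).trans ?_)
    · rw [abs_of_nonpos h]; nlinarith
    · calc S₁ * |t| ^ (-η₁) ≤ (|S₁| + |S₂|) * |t| ^ (-η₁) := by
            gcongr; linarith [le_abs_self S₁, abs_nonneg S₂]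
        _ ≤ _ := by gcongr

/-- The case `A + B = C + D + q`, in which the hypergeometric series grows at most like
`exp (q θ |t|)` along the contour. -/
theorem IsContour.lintegral_lt_top_of_sin {p : MBParams A B C D E F G H J K} {γ : ℝ → ℂ}
    (hγ : p.IsContour γ) (hf : ∀ i, ¬ IsNonposInt (p.f i)) {x ℓ : ℂ} {q : ℕ}
    (hq : A + B = C + D + q) {θ : ℝ} (hθ : 0 < θ) (hθ' : θ < Real.pi / 2)
    (hℓ : |ℓ.im| + q * θ < Real.pi / 2 * ((A : ℝ) + G + B + H - C - D - J - K))
    (hconv : A + B + E < C + D + (F + 1) ∨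
      (A + B + E = C + D + (F + 1) ∧ ‖x‖ < 1 ∧ ‖x‖ < Real.sin θ ^ q)) :
    ∫⁻ t, ∑' m, ‖p.integrand γ x ℓ m t‖ₑ < ⊤ := by
  have hs : 0 < Real.sin θ := Real.sin_pos_of_pos_of_lt_pi hθ (by linarith)
  have hs1 : Real.sin θ < 1 := by
    rw [← Real.sin_pi_div_two]
    exact Real.sin_lt_sin_of_lt_of_le_pi_div_two (by linarith) le_rfl hθ'
  have hs2 : 0 < 1 - Real.sin θ := by linarith
  -- The three constants are those of the q-th power of Cauchy's estimate.
  refine hγ.lintegral_lt_top_of_rise_bound hf (κ := q * θ) (Q := ((1 - Real.sin θ)⁻¹) ^ q)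
    (y := (Real.sin θ ^ q)⁻¹) (by positivity) (by positivity) (hconv.imp_right fun h =>
      ⟨h.1, h.2.1, by rw [← div_eq_mul_inv, div_lt_one (by positivity)]; exact h.2.2⟩)
    (p.exists_norm_kern_mul_exp_le (by positivity) hℓ) fun t m => ?_
  have h1 := norm_rise_one_add_mul_I_le hθ hθ' t m
  have h2 : (0 : ℝ) < m.factorial := by exact_mod_cast m.factorial_pos
  have h3 := norm_rise_pos (w := 1 + t * Complex.I) (by simp) m
  simp only [hq, pow_add _ (C + D) q]
  rw [mul_div_cancel_left₀ _ (pow_pos h3 _).ne', mul_div_cancel_left₀ _ (pow_pos h2 _).ne']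
  refine (pow_le_pow_left₀ h3.le h1 q).trans_eq ?_
  rw [mul_assoc (q : ℝ), Real.exp_nat_mul, inv_pow, inv_pow, ← pow_mul, mul_comm q m, pow_mul,
    div_pow, mul_pow, div_pow]
  field_simp

theorem coef_eq_zero_of_terminating {p : MBParams A B C D E F G H J K} {x : ℂ}
    (h : x = 0 ∨ ∃ i, IsNonposInt (p.e i)) : ∃ M : ℕ, ∀ m, M ≤ m → p.coef x m = 0 := by
  rcases h with rfl | ⟨i, n, hn⟩
  · refine ⟨1, fun m hm => ?_⟩
    rw [coef, zero_pow (by omega), mul_zero, zero_div]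
  · refine ⟨n + 1, fun m hm => ?_⟩
    have : rise (p.e i) m = 0 :=
      Finset.prod_eq_zero (Finset.mem_range.2 (show n < m by omega)) (by rw [hn]; ring)
    rw [coef, Finset.prod_eq_zero (Finset.mem_univ i) this, zero_div, zero_mul, zero_div]

theorem IsContour.absConv_of_abs_arg_lt {p : MBParams A B C D E F G H J K} {γ : ℝ → ℂ}
    (hγ : p.IsContour γ) (hf : ∀ i, ¬ IsNonposInt (p.f i)) {x z : ℂ} (hz : z ≠ 0)
    (harg : |z.arg| < Real.pi / 2 * ((A : ℝ) + G + B + H - C - D - J - K))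
    (hreg : p.ConvRegion x z) : p.AbsConv γ x z := by
  rw [absConv_iff _ _ _ hz]
  have hdec := fun m => p.decaysInStrips_kern (ℓ := Complex.log z) (by rwa [Complex.log_im]) m
  rw [ConvRegion, ← or_assoc] at hreg
  rcases hreg with h | h
  · obtain ⟨M, hM⟩ := coef_eq_zero_of_terminating h
    exact hγ.absConv_of_finite hM fun m _ => hdec m
  rcases le_or_gt (A + B) (C + D) with hle | hlt
  · exact hγ.lintegral_lt_top_of_le hf hle
      (h.imp (fun h => by omega) fun h => ⟨by omega, h.2.1⟩) (hdec 0)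
  obtain ⟨q, hq⟩ := Nat.exists_eq_add_of_lt hlt
  have hq' : A + B = C + D + (q + 1) := by omega
  have hq0 : (0 : ℝ) < ((q + 1 : ℕ) : ℝ) := by positivity
  -- The strict inequalities leave room for θ slightly above θ₀. For an entire series θ₀ = 0 will
  -- do; for radius 1, θ₀ = arcsin(|x|^(1/q)) makes |x| < (sin θ)^q.
  have choose_θ : ∀ θ₀ : ℝ, 0 ≤ θ₀ → θ₀ < Real.pi / 2 →
      ((q + 1 : ℕ) : ℝ) * θ₀ + |z.arg| <
        Real.pi / 2 * ((A : ℝ) + G + B + H - C - D - J - K) →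
      ∃ θ, θ₀ < θ ∧ 0 < θ ∧ θ < Real.pi / 2 ∧ |(Complex.log z).im| + ((q + 1 : ℕ) : ℝ) * θ <
        Real.pi / 2 * ((A : ℝ) + G + B + H - C - D - J - K) := by
    intro θ₀ h0 h1 h2
    obtain ⟨θ, h3, h4⟩ := exists_between (lt_min h1 ((lt_div_iff₀' hq0).2 (lt_sub_iff_add_lt.2 h2)))
    refine ⟨θ, h3, h0.trans_lt h3, h4.trans_le (min_le_left _ _), ?_⟩
    have := (lt_div_iff₀' hq0).1 (h4.trans_le (min_le_right _ _))
    rw [Complex.log_im]; linarith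
  rcases h with h | ⟨h, hx, hxq⟩
  · obtain ⟨θ, -, h1, h2, h3⟩ := choose_θ 0 le_rfl (by positivity) (by simpa using harg)
    exact hγ.lintegral_lt_top_of_sin hf hq' h1 h2 h3 (Or.inl (by omega))
  · have hr1 : ‖x‖ ^ (1 / ((q + 1 : ℕ) : ℝ)) < 1 :=
      Real.rpow_lt_one (norm_nonneg x) hx (by positivity)
    have hr0 : 0 ≤ ‖x‖ ^ (1 / ((q + 1 : ℕ) : ℝ)) := Real.rpow_nonneg (norm_nonneg x) _
    obtain ⟨θ, h0, h1, h2, h3⟩ := choose_θ (Real.arcsin (‖x‖ ^ (1 / ((q + 1 : ℕ) : ℝ))))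
      (Real.arcsin_nonneg.2 hr0) (Real.arcsin_lt_pi_div_two.2 hr1) (hxq (q + 1) (by omega) hq')
    refine hγ.lintegral_lt_top_of_sin hf hq' h1 h2 h3 (Or.inr ⟨by omega, hx, ?_⟩)
    have h4 : ‖x‖ ^ (1 / ((q + 1 : ℕ) : ℝ)) < Real.sin θ :=
      (Real.arcsin_lt_iff_lt_sin' ⟨by linarith, h2.le⟩).1 h0
    calc ‖x‖ = (‖x‖ ^ (1 / ((q + 1 : ℕ) : ℝ))) ^ (q + 1) := by
          rw [← Real.rpow_natCast, ← Real.rpow_mul (norm_nonneg x), one_div_mul_cancel hq0.ne',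
            Real.rpow_one]
      _ < _ := pow_lt_pow_left₀ h4 hr0 (by omega)

/-- No term vanishes, so the inequality holds for all m. Its left-over is affine in m with slope C +
D - A - B, which therefore cannot be negative. Hence at z = 1 the arcsine condition plays no role.
-/
theorem UnitCondition.add_le_add {p : MBParams A B C D E F G H J K} {x : ℂ}
    (h : p.UnitCondition x) (hx : x ≠ 0) (he : ∀ i, ¬ IsNonposInt (p.e i)) : A + B ≤ C + D := by
  by_contra hlt
  have hlt' : ((C + D + 1 : ℕ) : ℝ) ≤ (A + B : ℕ) := by exact_mod_cast not_le.1 hlt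
  obtain ⟨-, -, h3⟩ := h
  have h4 : ∀ m : ℕ, 1 - ((A : ℝ) + G - C - J) <
      ((∑ i, p.c i) + (∑ i, p.d i) + (∑ i, p.j i) + (∑ i, p.k i)
        - (∑ i, p.a i) - (∑ i, p.b i) - (∑ i, p.g i) - (∑ i, p.h i)).re +
        ((C : ℝ) + D - A - B) * m := by
    intro m
    have := h3 m (mul_ne_zero (Finset.prod_ne_zero_iff.2 fun i _ => rise_ne_zero (he i) m)
      (pow_ne_zero m hx))
    refine this.trans_eq ?_
    simp only [Finset.sum_add_distrib, Finset.sum_const, Finset.card_univ, Fintype.card_fin,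
      nsmul_eq_mul, Complex.sub_re, Complex.add_re, Complex.mul_re, Complex.natCast_re,
      Complex.natCast_im, mul_zero, sub_zero]
    ring
  set S := ((∑ i, p.c i) + (∑ i, p.d i) + (∑ i, p.j i) + (∑ i, p.k i)
        - (∑ i, p.a i) - (∑ i, p.b i) - (∑ i, p.g i) - (∑ i, p.h i)).re
  obtain ⟨m, hm⟩ := exists_nat_ge (S - (1 - ((A : ℝ) + G - C - J)))
  have := h4 m
  push_cast at hlt'
  have hm0 : (0 : ℝ) ≤ m := Nat.cast_nonneg m
  nlinarith

theorem IsContour.absConv_one {p : MBParams A B C D E F G H J K} {γ : ℝ → ℂ}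
    (hγ : p.IsContour γ) (hf : ∀ i, ¬ IsNonposInt (p.f i)) {x : ℂ} (hu : p.UnitCondition x)
    (hreg : p.ConvRegion x 1) : p.AbsConv γ x 1 := by
  rw [absConv_iff _ _ _ one_ne_zero]
  by_cases h : x = 0 ∨ ∃ i, IsNonposInt (p.e i)
  · obtain ⟨M, hM⟩ := coef_eq_zero_of_terminating h
    exact hγ.absConv_of_finite hM fun m hm => hu.decaysInStrips_kern Complex.log_one hm
  · rw [ConvRegion, ← or_assoc] at hreg
    have h' := hreg.resolve_left h
    push Not at h
    refine hγ.lintegral_lt_top_of_le hf (hu.add_le_add h.1 h.2)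
      (h'.imp (fun h => by omega) fun h => ⟨by omega, h.2.1⟩)
      (hu.decaysInStrips_kern Complex.log_one ?_)
    simp [coef, rise_zero]

end MBParams

theorem corollary2p1 {A B C D E F G H J K : ℕ} (p : MBParams A B C D E F G H J K)
    (hf : ∀ i, ¬ IsNonposInt (p.f i)) (γ : ℝ → ℂ) (hγ : p.IsContour γ) (x : ℂ) :
    -- absolute convergence
    (∀ z : ℂ, z ≠ 0 →
      |z.arg| < Real.pi / 2 * ((A : ℝ) + G + B + H - C - D - J - K) →
      p.ConvRegion x z → p.AbsConv γ x z) ∧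
    (p.UnitCondition x → p.ConvRegion x 1 → p.AbsConv γ x 1) ∧
    -- (i)
    (p.GenericA → ∀ z : ℂ, z ≠ 0 →
      |z.arg| < Real.pi / 2 * ((A : ℝ) + G + B + H - C - D - J - K) →
      p.AbsConv γ x z →
      (B + H + C + J < A + G + D + K ∨ (A + G + D + K = B + H + C + J ∧ 1 < ‖z‖)) →
      p.IsSigmaA x z (p.integral γ x z)) ∧
    -- (ii)
    (p.GenericB → ∀ z : ℂ, z ≠ 0 →
      |z.arg| < Real.pi / 2 * ((A : ℝ) + G + B + H - C - D - J - K) →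
      p.AbsConv γ x z →
      (A + G + D + K < B + H + C + J ∨ (A + G + D + K = B + H + C + J ∧ ‖z‖ < 1)) →
      p.IsSigmaB x z (p.integral γ x z)) ∧
    -- (iii)
    (p.GenericA → p.GenericB → p.UnitCondition x → p.AbsConv γ x 1 →
      p.IsSigmaA x 1 (p.integral γ x 1) ∧ p.IsSigmaB x 1 (p.integral γ x 1)) :=
  ⟨fun _ hz harg hreg => hγ.absConv_of_abs_arg_lt hf hz harg hreg,
    fun hu hreg => hγ.absConv_one hf hu hreg,
    fun hgen _ hz harg habs h => hγ.isSigmaA_of_abs_arg_lt hgen hz harg habs h,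
    fun hgen _ hz harg habs h => hγ.isSigmaB_of_abs_arg_lt hgen hz harg habs h,
    fun hA hB hu habs => ⟨hγ.isSigmaA_one hA hu habs, hγ.isSigmaB_one hB hu habs⟩⟩
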